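/- **Banach–Lamperti theorem for partial isometries.** Let $\mathbb F\in\{\mathbb R,\mathbb C\}$, let $p\in[1,\infty]\setminus\{2\}$, and let $(\Omega,\Sigma,\mu)$ be a measure space with $\mu$ localizable, i.e. $\mu$ is semi-finite and the Boolean algebra $[\Sigma]$ of measurable sets modulo $\mu$-null sets is Dedekind complete. Write $L^p(\mu)=L^p(\mu,\mathbb F)$, write $B(L^p(\mu))$ for the bounded operators on it, and let $L_0(\mu)$ be the space of $\mathbb F$-valued measurable functions modulo a.e. equality. *Definitions.* A generalized inverse of $T$ is an element $T^*$ with $T=TT^*T$ and $T^*=T^*TT^*$. For $D\in\Sigma$ let $\Sigma_D=\{C\in\Sigma: C\subseteq D\}$. A partial set automorphism $\Phi$ is a map $\Phi:\Sigma_{D_{\Phi^*}}\to\Sigma_{D_\Phi}$, with $D_\Phi,D_{\Phi^*}\in\Sigma$, that descends to an isomorphism $[\Sigma_{D_{\Phi^*}}]\to[\Sigma_{D_\Phi}]$ of Boolean algebras modulo null sets; $\Phi^*:\Sigma_{D_\Phi}\to\Sigma_{D_{\Phi^*}}$ denotes a map inducing the inverse isomorphism. $T_\Phi:L_0(\mu)\to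 L_0(\mu)$ is the unique linear operator that preserves a.e. limits of sequences and satisfies $T_\Phi 1_C=1_{\Phi(C\cap D_{\Phi^*})}$ for $C\in\Sigma$. The set $\mathrm{SPIso}(L^p(\mu))$ of spatial partial isometries consists of the operators on $L^p(\mu)$ of the form $$\omega\Big(\frac{d\,\mu\circ\Phi^*}{d\,\mu|_{D_\Phi}}\Big)^{1/p}T_\Phi,$$ where $\Phi$ is a partial set automorphism and $\omega:D_\Phi\to\{z\in\mathbb F:|z|=1\}$ is measurable (with $1/\infty=0$). A multiplication operator on $L^p(\mu)$ is an operator $f\mapsto gf$ with $g\in L^\infty(\mu)$. An $L^p$-projection on a Banach space $E$ is an idempotent $P\in B(E)$ such that, for all $\xi\in E$, $\|\xi\|^p=\|P\xi\|^p+\|\xi-P\xi\|^p$ if $p<\infty$, and $\|\xi\|=\max\{\|P\xi\|,\|\xi-P\xi\|\}$ if $p=\infty$. An $L^p$-partial isometry on $E$ is a contraction $T\in B(E)$ that has a contractive generalized inverse $T^*\in B(E)$ such that $TT^*$ and $T^*T$ are $L^p$-projections. An MP-partial isometry in a unital complex Banach algebra $B$ is a contractive element $t$ that has a contractive generalized inverse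 $t^*$ such that $tt^*$ and $t^*t$ are hermitian, where $a\in B$ is hermitian if $\|e^{isa}\|=1$ for all $s\in\mathbb R$. *Theorem.* 1. An operator $T\in B(L^p(\mu))$ is a spatial partial isometry if and only if it is a contraction and has a contractive generalized inverse $T^*\in B(L^p(\mu))$ such that both $TT^*$ and $T^*T$ are multiplication operators. 2. $\mathrm{SPIso}(L^p(\mu))$ equals the set of $L^p$-partial isometries on $L^p(\mu)$, and this set is an inverse semigroup under composition: it is closed under composition and each of its elements has exactly one generalized inverse in it. 3. If $\mathbb F=\mathbb C$ and $\mu\neq0$, then $\mathrm{SPIso}(L^p(\mu))$ also equals the set of MP-partial isometries in $B(L^p(\mu))$. -/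

import Mathlib

open MeasureTheory Filter Topology
open scoped ENNReal NNReal

noncomputable section

namespace SpatialPI

/-! ### Localizable measures -/

/-- `μ` is localizable: it is semi-finite (the measure of a measurable set is the supremum of the
measures of its measurable subsets of finite measure), and the Boolean algebra of measurable sets
modulo null sets is Dedekind complete, i.e. every family of measurable sets has an essential
supremum. -/
structure IsLocalizable {Ω : Type*} [MeasurableSpace Ω] (μ : Measure Ω) : Prop where
  semifinite : ∀ A : Set Ω, MeasurableSet A →
    μ A = ⨆ (B : Set Ω) (_ : MeasurableSet B) (_ : B ⊆ A) (_ : μ B < ∞), μ B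
  exists_essSup : ∀ F : Set (Set Ω), (∀ A ∈ F, MeasurableSet A) →
    ∃ S : Set Ω, MeasurableSet S ∧ (∀ A ∈ F, μ (A \ S) = 0) ∧
      ∀ S' : Set Ω, MeasurableSet S' → (∀ A ∈ F, μ (A \ S') = 0) → μ (S \ S') = 0

/-! ### Generalized inverses and inverse semigroups -/

/-- `s` is a generalized inverse of `t`. -/
def IsGenInverse {M : Type*} [Mul M] (t s : M) : Prop :=
  t = t * s * t ∧ s = s * t * s

/-- The subset `S` of a semigroup is a subsemigroup which, as a semigroup in its own right, is an
inverse semigroup: every element of `S` has exactly one generalized inverse in `S`. -/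
def IsInverseSubsemigroup {M : Type*} [Semigroup M] (S : Set M) : Prop :=
  (∀ s ∈ S, ∀ t ∈ S, s * t ∈ S) ∧ ∀ t ∈ S, ∃! s, s ∈ S ∧ IsGenInverse t s

/-! ### `L^p`-partial isometries on a normed space, MP-partial isometries in a Banach algebra -/

/-- `L^p`-projections on a normed space. -/
def IsLpProjection {𝕜 E : Type*} [RCLike 𝕜] [NormedAddCommGroup E] [NormedSpace 𝕜 E]
    (p : ℝ≥0∞) (P : E →L[𝕜] E) : Prop :=
  P * P = P ∧
    (p ≠ ∞ → ∀ ξ : E, ‖ξ‖ ^ p.toReal = ‖P ξ‖ ^ p.toReal + ‖ξ - P ξ‖ ^ p.toReal) ∧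
    (p = ∞ → ∀ ξ : E, ‖ξ‖ = max ‖P ξ‖ ‖ξ - P ξ‖)

/-- The set of `L^p`-partial isometries on `E`. -/
def LpPIso (𝕜 E : Type*) [RCLike 𝕜] [NormedAddCommGroup E] [NormedSpace 𝕜 E]
    (p : ℝ≥0∞) : Set (E →L[𝕜] E) :=
  {T | ‖T‖ ≤ 1 ∧ ∃ S : E →L[𝕜] E, ‖S‖ ≤ 1 ∧ IsGenInverse T S ∧
    IsLpProjection p (T * S) ∧ IsLpProjection p (S * T)}

/-- Hermitian elements of a complex unital Banach algebra. -/
def IsHermitianElem {B : Type*} [NormedRing B] [NormedAlgebra ℂ B] (a : B) : Prop :=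
  ∀ t : ℝ, ‖NormedSpace.exp ((Complex.I * (t : ℂ)) • a)‖ = 1

/-- The set of MP-partial isometries: contractive elements that admit a contractive
Moore--Penrose generalized inverse. -/
def MPPIso (B : Type*) [NormedRing B] [NormedAlgebra ℂ B] : Set B :=
  {t | ‖t‖ ≤ 1 ∧ ∃ s : B, ‖s‖ ≤ 1 ∧ IsGenInverse t s ∧
    IsHermitianElem (t * s) ∧ IsHermitianElem (s * t)}

/-! ### Spatial partial isometries -/

section Spatial

variable {Ω : Type*} [MeasurableSpace Ω]

/-- A partial set automorphism `Φ` of `(Ω, Σ, μ)`: a map from the measurable subsets of `dom` to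
the measurable subsets of `cod` that descends to an isomorphism of the Boolean algebras of
measurable sets modulo null sets, together with a choice of representatives `invFun` of the
inverse isomorphism `Φ*`. The values of `toFun` and `invFun` on other sets play no role. -/
structure PartialSetAut (μ : Measure Ω) where
  /-- the domain `D_{Φ*}` -/
  dom : Set Ω
  /-- the codomain `D_Φ` -/
  cod : Set Ω
  measurableSet_dom : MeasurableSet dom
  measurableSet_cod : MeasurableSet cod
  /-- `Φ` -/
  toFun : Set Ω → Set Ω
  /-- `Φ*` -/
  invFun : Set Ω → Set Ω
  toFun_mem : ∀ C, MeasurableSet C → C ⊆ dom → MeasurableSet (toFun C) ∧ toFun C ⊆ cod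
  invFun_mem : ∀ C, MeasurableSet C → C ⊆ cod → MeasurableSet (invFun C) ∧ invFun C ⊆ dom
  null_diff_iff : ∀ C C', MeasurableSet C → C ⊆ dom → MeasurableSet C' → C' ⊆ dom →
    (μ (C \ C') = 0 ↔ μ (toFun C \ toFun C') = 0)
  toFun_invFun : ∀ C, MeasurableSet C → C ⊆ cod → toFun (invFun C) =ᵐ[μ] C

/-- `V : L_0(μ) → L_0(μ)` is the composition operator `T_Φ`: the linear operator with
`T_Φ 1_C = 1_{Φ(C ∩ dom)}` that preserves almost everywhere limits of sequences. -/
structure IsCompositionOp {𝕜 : Type*} [RCLike 𝕜] {μ : Measure Ω} (Φ : PartialSetAut μ)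
    (V : (Ω →ₘ[μ] 𝕜) →ₗ[𝕜] (Ω →ₘ[μ] 𝕜)) : Prop where
  map_indicator : ∀ C : Set Ω, MeasurableSet C → ∀ f : Ω →ₘ[μ] 𝕜,
    f =ᵐ[μ] C.indicator (fun _ => (1 : 𝕜)) →
      V f =ᵐ[μ] (Φ.toFun (C ∩ Φ.dom)).indicator (fun _ => (1 : 𝕜))
  map_lim : ∀ (f : ℕ → Ω →ₘ[μ] 𝕜) (g : Ω →ₘ[μ] 𝕜),
    (∀ᵐ x ∂μ, Tendsto (fun n => f n x) atTop (𝓝 (g x))) →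
      ∀ᵐ x ∂μ, Tendsto (fun n => V (f n) x) atTop (𝓝 (V g x))

/-- `h` is the Radon--Nikodym derivative of `μ ∘ Φ*` with respect to `μ` on `D_Φ`, extended by
zero. -/
structure IsRNDeriv {μ : Measure Ω} (Φ : PartialSetAut μ) (h : Ω → ℝ≥0) : Prop where
  measurable : Measurable h
  eq_zero : ∀ x, x ∉ Φ.cod → h x = 0
  lintegral_eq : ∀ C, MeasurableSet C → C ⊆ Φ.cod →
    μ (Φ.invFun C) = ∫⁻ x in C, (h x : ℝ≥0∞) ∂μ

/-- The set of spatial partial isometries on `L^p(μ)`: the operators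
`ω (d(μ ∘ Φ*) / dμ|_{D_Φ})^{1/p} T_Φ`, with `Φ` a partial set automorphism and `ω` a measurable
function of modulus one on `D_Φ`. For `p = ∞` the exponent `1 / p.toReal` is `0`, as it should. -/
def SPIso (𝕜 : Type*) [RCLike 𝕜] (p : ℝ≥0∞) [Fact (1 ≤ p)] (μ : Measure Ω) :
    Set (Lp 𝕜 p μ →L[𝕜] Lp 𝕜 p μ) :=
  {T | ∃ (Φ : PartialSetAut μ) (V : (Ω →ₘ[μ] 𝕜) →ₗ[𝕜] (Ω →ₘ[μ] 𝕜)) (h : Ω → ℝ≥0) (ω : Ω → 𝕜),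
    IsCompositionOp Φ V ∧ IsRNDeriv Φ h ∧ Measurable ω ∧ (∀ x ∈ Φ.cod, ‖ω x‖ = 1) ∧
    ∀ f : Lp 𝕜 p μ, T f =ᵐ[μ] fun x =>
      ω x * (((h x : ℝ) ^ (1 / p.toReal) : ℝ) : 𝕜) * V (f : Ω →ₘ[μ] 𝕜) x}

/-- `P` is the operator of multiplication by some function in `L^∞(μ)`. -/
def IsMultiplicationOp {𝕜 : Type*} [RCLike 𝕜] {p : ℝ≥0∞} [Fact (1 ≤ p)] {μ : Measure Ω}
    (P : Lp 𝕜 p μ →L[𝕜] Lp 𝕜 p μ) : Prop :=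
  ∃ g : Lp 𝕜 ∞ μ, ∀ f : Lp 𝕜 p μ, P f =ᵐ[μ] fun x => g x * f x

end Spatial

end SpatialPI

end

noncomputable section

namespace SpatialPI

/-! ### The ring of measurable functions modulo null functions -/

section Ring

variable {Ω : Type*} [MeasurableSpace Ω] {μ : Measure Ω} {𝕜 : Type*} [RCLike 𝕜]

/-! Every class of operators in the theorem is shown to equal one set: the contractions T that have
a contractive generalized inverse S such that TS and ST are multiplications by indicator functions
of sets D and D' (`IsChiPair`).

A spatial partial isometry belongs to this set by change of variables: the weighted composition
operator is isometric on functions supported in `dom`, and dividing by the weight and composing with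
Φ* inverts it (`exists_isChiPair_of_mem_SPIso`). Conversely, such a T preserves disjointness of
supports (`IsChiPair.map_mul_map`). For finite p ≠ 2 this is the equality case of Clarkson's
inequality, which detects disjointness by norms; for p = ∞ it follows because T carries unimodular
functions on D' to unimodular functions on D. Sending A to the support of the image of the functions
living on A then gives a partial set automorphism Φ (`IsChiPair.toPartialSetAut`), and T turns
multiplication by k into multiplication by T_Φ k. Hence the quotient T f / T_Φ f does not depend on
f where two such quotients are both defined, and these quotients glue to a weight w
(`Intertwines.exists_weight`). Isometry on D' forces |w|^p to be the Radon–Nikodym derivative of μ ∘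
Φ*, or |w| = 1 on D if p = ∞ (`IsChiPair.mem_SPIso`).

For the other two classes, the idempotents TS and ST must be recognized as multiplications. If P is
an L^p-projection, P f and g - P g are disjoint, by Clarkson or by a unimodularity argument. If e is
a hermitian idempotent, exp(ite) = 1 + (e^{it} - 1)e is an invertible isometry and so preserves
disjointness; comparing two values of t shows that e does not enlarge supports. Both cases end with
`isMultiplicationOp_of_disjoint`. The inverse semigroup property holds because all idempotents of
the set are multiplication operators and therefore commute.

Localizability enters twice: Dedekind completeness permits gluing of uncountable compatible families
(`exists_glue`) and supplies supports of families (`IsLocalizable.exists_support`), while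
semi-finiteness makes L^p large enough to detect non-null sets. Almost everywhere identities are
calculated in the commutative ring of classes of measurable functions, where `ring` and
`linear_combination` apply. -/

instance instCommRingAEEqFun : CommRing (Ω →ₘ[μ] 𝕜) :=
  { (inferInstance : AddCommGroup (Ω →ₘ[μ] 𝕜)), (inferInstance : CommMonoid (Ω →ₘ[μ] 𝕜)) with
    left_distrib := fun a b c => by
      refine AEEqFun.induction_on₃ a b c fun f hf g hg h hh => ?_
      simp only [AEEqFun.mk_add_mk, AEEqFun.mk_mul_mk, mul_add]
    right_distrib := fun a b c => by
      refine AEEqFun.induction_on₃ a b c fun f hf g hg h hh => ?_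
      simp only [AEEqFun.mk_add_mk, AEEqFun.mk_mul_mk, add_mul]
    zero_mul := fun a => by
      refine AEEqFun.induction_on a fun f hf => ?_
      simp only [AEEqFun.zero_def, AEEqFun.mk_mul_mk]
      congr 1; ext x; simp
    mul_zero := fun a => by
      refine AEEqFun.induction_on a fun f hf => ?_
      simp only [AEEqFun.zero_def, AEEqFun.mk_mul_mk]
      congr 1; ext x; simp }

theorem smul_mul_aeeqFun (c : 𝕜) (f g : Ω →ₘ[μ] 𝕜) : (c • f) * g = c • (f * g) := by
  refine AEEqFun.induction_on₂ f g fun f hf g hg => ?_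
  simp only [AEEqFun.smul_mk, AEEqFun.mk_mul_mk, smul_mul_assoc]

theorem mul_smul_aeeqFun (c : 𝕜) (f g : Ω →ₘ[μ] 𝕜) : f * (c • g) = c • (f * g) := by
  rw [mul_comm, smul_mul_aeeqFun, mul_comm]

theorem coeFn_mul_apply (f g : Ω →ₘ[μ] 𝕜) : ∀ᵐ x ∂μ, (f * g) x = f x * g x :=
  AEEqFun.coeFn_mul f g

theorem coeFn_sub_apply (f g : Ω →ₘ[μ] 𝕜) : ∀ᵐ x ∂μ, (f - g) x = f x - g x :=
  AEEqFun.coeFn_sub f g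

theorem coeFn_smul_apply (c : 𝕜) (f : Ω →ₘ[μ] 𝕜) : ∀ᵐ x ∂μ, (c • f) x = c * f x :=
  AEEqFun.coeFn_smul c f

theorem coeFn_zero_apply : ∀ᵐ x ∂μ, (0 : Ω →ₘ[μ] 𝕜) x = 0 :=
  AEEqFun.coeFn_zero

theorem coeFn_one_apply : ∀ᵐ x ∂μ, (1 : Ω →ₘ[μ] 𝕜) x = 1 :=
  AEEqFun.coeFn_one

theorem mul_eq_zero_iff_ae {f g : Ω →ₘ[μ] 𝕜} : f * g = 0 ↔ ∀ᵐ x ∂μ, f x = 0 ∨ g x = 0 := by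
  constructor
  · intro h
    filter_upwards [coeFn_mul_apply f g, h ▸ coeFn_zero_apply (μ := μ) (𝕜 := 𝕜)] with x h1 h2
    rwa [h1, mul_eq_zero] at h2
  · intro h
    apply AEEqFun.ext
    filter_upwards [coeFn_mul_apply f g, coeFn_zero_apply (μ := μ) (𝕜 := 𝕜), h] with x h1 h2 h3
    rw [h1, h2, mul_eq_zero]; exact h3

theorem eq_zero_of_mul_self_eq_zero {f : Ω →ₘ[μ] 𝕜} (h : f * f = 0) : f = 0 := by
  rw [mul_eq_zero_iff_ae] at h
  apply AEEqFun.ext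
  filter_upwards [coeFn_zero_apply (μ := μ) (𝕜 := 𝕜), h] with x h1 h2
  rw [h1]; tauto

/-- The class of the indicator function of a measurable set. -/
def chi (μ : Measure Ω) (𝕜 : Type*) [RCLike 𝕜] (A : Set Ω) : Ω →ₘ[μ] 𝕜 :=
  open Classical in
  -- The value 0 at non-measurable sets makes `chi` total in the set, so that bands can later be
  -- formed for an arbitrary set.
  if h : MeasurableSet A then
    AEEqFun.mk (A.indicator fun _ => (1 : 𝕜)) (aestronglyMeasurable_const.indicator h)
  else 0

theorem coeFn_chi {A : Set Ω} (hA : MeasurableSet A) :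
    chi μ 𝕜 A =ᵐ[μ] A.indicator fun _ => (1 : 𝕜) := by
  rw [chi, dif_pos hA]
  exact AEEqFun.coeFn_mk _ _

theorem coeFn_chi_of_mem {A : Set Ω} (hA : MeasurableSet A) :
    ∀ᵐ x ∂μ, x ∈ A → chi μ 𝕜 A x = 1 := by
  filter_upwards [coeFn_chi (𝕜 := 𝕜) (μ := μ) hA] with x hx h
  rw [hx, Set.indicator_of_mem h]

theorem coeFn_chi_of_notMem {A : Set Ω} (hA : MeasurableSet A) :
    ∀ᵐ x ∂μ, x ∉ A → chi μ 𝕜 A x = 0 := by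
  filter_upwards [coeFn_chi (𝕜 := 𝕜) (μ := μ) hA] with x hx h
  rw [hx, Set.indicator_of_notMem h]

theorem eq_chi_iff {A : Set Ω} (hA : MeasurableSet A) {f : Ω →ₘ[μ] 𝕜} :
    f = chi μ 𝕜 A ↔ f =ᵐ[μ] A.indicator fun _ => (1 : 𝕜) :=
  ⟨fun h => h ▸ coeFn_chi hA, fun h => AEEqFun.ext (h.trans (coeFn_chi hA).symm)⟩

theorem coeFn_chi_mul {A : Set Ω} (hA : MeasurableSet A) (f : Ω →ₘ[μ] 𝕜) :
    (chi μ 𝕜 A * f : Ω →ₘ[μ] 𝕜) =ᵐ[μ] A.indicator f := by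
  filter_upwards [coeFn_chi (𝕜 := 𝕜) (μ := μ) hA, coeFn_mul_apply (chi μ 𝕜 A) f] with x h1 h2
  rw [h2, h1]
  by_cases hx : x ∈ A <;> simp [hx]

theorem chi_mul_eq_self_iff {A : Set Ω} (hA : MeasurableSet A) {f : Ω →ₘ[μ] 𝕜} :
    chi μ 𝕜 A * f = f ↔ ∀ᵐ x ∂μ, x ∉ A → f x = 0 := by
  constructor
  · intro h
    filter_upwards [coeFn_chi_mul hA f] with x hx hxA
    rw [h] at hx
    rw [hx, Set.indicator_of_notMem hxA]
  · intro h
    apply AEEqFun.ext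
    filter_upwards [coeFn_chi_mul hA f, h] with x h1 h2
    rw [h1]
    by_cases hx : x ∈ A
    · simp [hx]
    · simp [hx, h2 hx]

theorem chi_mul_eq_zero_iff {A : Set Ω} (hA : MeasurableSet A) {f : Ω →ₘ[μ] 𝕜} :
    chi μ 𝕜 A * f = 0 ↔ ∀ᵐ x ∂μ, x ∈ A → f x = 0 := by
  rw [mul_eq_zero_iff_ae]
  constructor
  · intro h
    filter_upwards [coeFn_chi_of_mem (𝕜 := 𝕜) (μ := μ) hA, h] with x h1 h2 h3
    have := h1 h3
    simp_all
  · intro h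
    filter_upwards [coeFn_chi_of_notMem (𝕜 := 𝕜) (μ := μ) hA, h] with x h1 h2
    tauto

theorem chi_mul_chi {A B : Set Ω} (hA : MeasurableSet A) (hB : MeasurableSet B) :
    chi μ 𝕜 A * chi μ 𝕜 B = chi μ 𝕜 (A ∩ B) := by
  apply AEEqFun.ext
  filter_upwards [coeFn_chi_mul (𝕜 := 𝕜) (μ := μ) hA (chi μ 𝕜 B), coeFn_chi (𝕜 := 𝕜) (μ := μ) hB,
    coeFn_chi (𝕜 := 𝕜) (μ := μ) (hA.inter hB)] with x h1 h2 h3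
  rw [h1, h3]
  by_cases hx : x ∈ A <;> by_cases hx' : x ∈ B <;> simp [hx, hx', h2]

theorem chi_congr {A B : Set Ω} (hA : MeasurableSet A) (hB : MeasurableSet B) (h : A =ᵐ[μ] B) :
    chi μ 𝕜 A = chi μ 𝕜 B := by
  apply AEEqFun.ext
  exact ((coeFn_chi hA).trans (indicator_ae_eq_of_ae_eq_set h)).trans (coeFn_chi hB).symm

theorem chi_univ : chi μ 𝕜 Set.univ = 1 := by
  symm
  rw [eq_chi_iff MeasurableSet.univ]
  filter_upwards [coeFn_one_apply (𝕜 := 𝕜) (μ := μ)] with x hx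
  simp [hx]

theorem chi_compl {A : Set Ω} (hA : MeasurableSet A) : chi μ 𝕜 Aᶜ = 1 - chi μ 𝕜 A := by
  symm
  rw [eq_chi_iff hA.compl]
  filter_upwards [coeFn_one_apply (𝕜 := 𝕜) (μ := μ), coeFn_sub_apply 1 (chi μ 𝕜 A),
    coeFn_chi (𝕜 := 𝕜) (μ := μ) hA] with x h1 h2 h3
  rw [h2, h1, h3]
  by_cases hx : x ∈ A <;> simp [hx]

theorem chi_mul_self {A : Set Ω} (hA : MeasurableSet A) :
    chi μ 𝕜 A * chi μ 𝕜 A = chi μ 𝕜 A := by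
  rw [chi_mul_chi hA hA, Set.inter_self]

theorem chi_mul_chi_of_subset {A B : Set Ω} (hA : MeasurableSet A) (hB : MeasurableSet B)
    (h : A ⊆ B) : chi μ 𝕜 B * chi μ 𝕜 A = chi μ 𝕜 A := by
  rw [chi_mul_chi hB hA, Set.inter_eq_right.2 h]

theorem norm_chi_le {A : Set Ω} (hA : MeasurableSet A) : ∀ᵐ x ∂μ, ‖chi μ 𝕜 A x‖ ≤ 1 := by
  filter_upwards [coeFn_chi (𝕜 := 𝕜) (μ := μ) hA] with x h
  rw [h]
  by_cases hx : x ∈ A <;> simp [hx]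

/-- The support of the chosen representative. -/
def suppSet (f : Ω →ₘ[μ] 𝕜) : Set Ω := {x | f x ≠ 0}

theorem measurableSet_suppSet (f : Ω →ₘ[μ] 𝕜) : MeasurableSet (suppSet f) :=
  (f.measurable (measurableSet_singleton 0)).compl

theorem chi_suppSet_mul (f : Ω →ₘ[μ] 𝕜) : chi μ 𝕜 (suppSet f) * f = f := by
  rw [chi_mul_eq_self_iff (measurableSet_suppSet f)]
  exact Eventually.of_forall fun x hx => by simpa [suppSet] using hx

theorem measure_suppSet_diff_eq_zero_iff {A : Set Ω} (hA : MeasurableSet A) {f : Ω →ₘ[μ] 𝕜} :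
    μ (suppSet f \ A) = 0 ↔ chi μ 𝕜 A * f = f := by
  rw [chi_mul_eq_self_iff hA, ae_iff]
  congr! 3 with x
  ext x
  simp [suppSet, and_comm]

end Ring

/-! ### Multiplication of elements of `L^p` by bounded functions -/

section Multiplication

variable {Ω : Type*} [MeasurableSpace Ω] {μ : Measure Ω} {𝕜 : Type*} [RCLike 𝕜]
  {p : ℝ≥0∞}

theorem mul_mem_Lp {k : Ω →ₘ[μ] 𝕜} {C : ℝ} (hk : ∀ᵐ x ∂μ, ‖k x‖ ≤ C) (f : Lp 𝕜 p μ) :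
    k * (f : Ω →ₘ[μ] 𝕜) ∈ Lp 𝕜 p μ := by
  refine Lp.mem_Lp_of_ae_le_mul (c := C) (g := f) ?_
  filter_upwards [hk, coeFn_mul_apply k (f : Ω →ₘ[μ] 𝕜)] with x h1 h2
  rw [h2, norm_mul]
  exact mul_le_mul_of_nonneg_right h1 (norm_nonneg _)

/-- The product of an element of `L^p` with an essentially bounded function. -/
def mulLp (k : Ω →ₘ[μ] 𝕜) {C : ℝ} (hk : ∀ᵐ x ∂μ, ‖k x‖ ≤ C) (f : Lp 𝕜 p μ) : Lp 𝕜 p μ :=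
  ⟨k * (f : Ω →ₘ[μ] 𝕜), mul_mem_Lp hk f⟩

theorem coe_mulLp {k : Ω →ₘ[μ] 𝕜} {C : ℝ} (hk : ∀ᵐ x ∂μ, ‖k x‖ ≤ C) (f : Lp 𝕜 p μ) :
    (mulLp k hk f : Ω →ₘ[μ] 𝕜) = k * f := rfl

theorem coe_smul_Lp (c : 𝕜) (f : Lp 𝕜 p μ) :
    ((c • f : Lp 𝕜 p μ) : Ω →ₘ[μ] 𝕜) = c • (f : Ω →ₘ[μ] 𝕜) := rfl

theorem coe_add_Lp (f g : Lp 𝕜 p μ) :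
    ((f + g : Lp 𝕜 p μ) : Ω →ₘ[μ] 𝕜) = f + g := rfl

theorem coe_sub_Lp (f g : Lp 𝕜 p μ) :
    ((f - g : Lp 𝕜 p μ) : Ω →ₘ[μ] 𝕜) = f - g := rfl

theorem coe_zero_Lp : ((0 : Lp 𝕜 p μ) : Ω →ₘ[μ] 𝕜) = 0 := rfl

theorem norm_mulLp_le {k : Ω →ₘ[μ] 𝕜} {C : ℝ} (hk : ∀ᵐ x ∂μ, ‖k x‖ ≤ C) (f : Lp 𝕜 p μ) :
    ‖mulLp k hk f‖ ≤ C * ‖f‖ := by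
  refine Lp.norm_le_mul_norm_of_ae_le_mul ?_
  filter_upwards [hk, coeFn_mul_apply k (f : Ω →ₘ[μ] 𝕜)] with x h1 h2
  change ‖(k * (f : Ω →ₘ[μ] 𝕜)) x‖ ≤ _
  rw [h2, norm_mul]
  exact mul_le_mul_of_nonneg_right h1 (norm_nonneg _)

variable [Fact (1 ≤ p)]

/-- Multiplication by an essentially bounded function as an operator on `L^p`. -/
def mulCLM (p : ℝ≥0∞) [Fact (1 ≤ p)] (k : Ω →ₘ[μ] 𝕜) {C : ℝ} (hk : ∀ᵐ x ∂μ, ‖k x‖ ≤ C) :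
    Lp 𝕜 p μ →L[𝕜] Lp 𝕜 p μ :=
  LinearMap.mkContinuous
    { toFun := mulLp k hk
      map_add' := fun f g => Subtype.ext (mul_add k (f : Ω →ₘ[μ] 𝕜) g)
      map_smul' := fun c f => Subtype.ext (mul_smul_aeeqFun c k (f : Ω →ₘ[μ] 𝕜)) }
    C (norm_mulLp_le hk)

/-- Multiplication by the indicator function of a set. -/
def chiOp (p : ℝ≥0∞) [Fact (1 ≤ p)] (μ : Measure Ω) (𝕜 : Type*) [RCLike 𝕜] {D : Set Ω}
    (hD : MeasurableSet D) : Lp 𝕜 p μ →L[𝕜] Lp 𝕜 p μ :=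
  mulCLM p (chi μ 𝕜 D) (norm_chi_le hD)

theorem coe_chiOp {D : Set Ω} (hD : MeasurableSet D) (f : Lp 𝕜 p μ) :
    (chiOp p μ 𝕜 hD f : Ω →ₘ[μ] 𝕜) = chi μ 𝕜 D * f := rfl

theorem norm_chiOp_apply_le {D : Set Ω} (hD : MeasurableSet D) (f : Lp 𝕜 p μ) :
    ‖chiOp p μ 𝕜 hD f‖ ≤ ‖f‖ :=
  (norm_mulLp_le (norm_chi_le hD) f).trans_eq (one_mul _)

theorem isMultiplicationOp_chiOp {D : Set Ω} (hD : MeasurableSet D) :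
    IsMultiplicationOp (chiOp p μ 𝕜 hD) := by
  refine ⟨⟨chi μ 𝕜 D, ?_⟩, fun f => coeFn_mul_apply _ _⟩
  rw [Lp.mem_Lp_iff_memLp]
  exact memLp_top_of_bound (AEEqFun.aestronglyMeasurable _) 1 (norm_chi_le hD)

theorem isMultiplicationOp_iff {P : Lp 𝕜 p μ →L[𝕜] Lp 𝕜 p μ} :
    IsMultiplicationOp P ↔ ∃ g : Lp 𝕜 ∞ μ, ∀ f : Lp 𝕜 p μ,
      (P f : Ω →ₘ[μ] 𝕜) = (g : Ω →ₘ[μ] 𝕜) * f := by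
  constructor
  · rintro ⟨g, hg⟩
    exact ⟨g, fun f => AEEqFun.ext ((hg f).trans (AEEqFun.coeFn_mul _ _).symm)⟩
  · rintro ⟨g, hg⟩
    refine ⟨g, fun f => ?_⟩
    rw [hg f]
    exact coeFn_mul_apply _ _

theorem IsMultiplicationOp.commute {P Q : Lp 𝕜 p μ →L[𝕜] Lp 𝕜 p μ}
    (hP : IsMultiplicationOp P) (hQ : IsMultiplicationOp Q) : P * Q = Q * P := by
  obtain ⟨g, hg⟩ := isMultiplicationOp_iff.1 hP
  obtain ⟨k, hk⟩ := isMultiplicationOp_iff.1 hQ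
  ext1 f
  apply Subtype.ext
  change (P (Q f) : Ω →ₘ[μ] 𝕜) = Q (P f)
  rw [hg, hk, hk, hg]
  ring

/-- Idempotence says g(gf) = gf, and cancelling g where it is non-zero gives gf = f there; so P cuts
down to the support of g. The cancellation is done against each f separately, since the constant 1
need not be in L^p. -/
theorem IsMultiplicationOp.exists_eq_chiOp {P : Lp 𝕜 p μ →L[𝕜] Lp 𝕜 p μ}
    (hP : IsMultiplicationOp P) (h : P * P = P) :
    ∃ (D : Set Ω) (hD : MeasurableSet D), P = chiOp p μ 𝕜 hD := by
  obtain ⟨g, hg⟩ := isMultiplicationOp_iff.1 hP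
  refine ⟨suppSet (g : Ω →ₘ[μ] 𝕜), measurableSet_suppSet _, ?_⟩
  ext1 f
  apply Subtype.ext
  rw [coe_chiOp, hg]
  have h1 : (g : Ω →ₘ[μ] 𝕜) * (g * f) = g * f := by
    rw [← hg f, ← hg (P f)]
    exact congrArg Subtype.val (DFunLike.congr_fun h f)
  apply AEEqFun.ext
  filter_upwards [coeFn_chi_mul (measurableSet_suppSet (g : Ω →ₘ[μ] 𝕜)) (f : Ω →ₘ[μ] 𝕜),
    coeFn_mul_apply (g : Ω →ₘ[μ] 𝕜) f, coeFn_mul_apply (g : Ω →ₘ[μ] 𝕜) (g * f)] with x h2 h3 h4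
  rw [h1, h3] at h4
  rw [h2, h3]
  by_cases hx : (g : Ω →ₘ[μ] 𝕜) x = 0
  · rw [hx, zero_mul, Set.indicator_of_notMem (by simpa [suppSet] using hx)]
  · rw [Set.indicator_of_mem (show x ∈ suppSet (g : Ω →ₘ[μ] 𝕜) from hx)]
    exact (mul_left_cancel₀ hx h4).symm

end Multiplication

/-! ### Partial set automorphisms -/

namespace PartialSetAut

variable {Ω : Type*} [MeasurableSpace Ω] {μ : Measure Ω} (Φ : PartialSetAut μ)

theorem measurableSet_toFun {C : Set Ω} (hC : MeasurableSet C) (h : C ⊆ Φ.dom) :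
    MeasurableSet (Φ.toFun C) := (Φ.toFun_mem C hC h).1

theorem toFun_subset {C : Set Ω} (hC : MeasurableSet C) (h : C ⊆ Φ.dom) :
    Φ.toFun C ⊆ Φ.cod := (Φ.toFun_mem C hC h).2

theorem toFun_le_iff {C C' : Set Ω} (hC : MeasurableSet C) (h : C ⊆ Φ.dom)
    (hC' : MeasurableSet C') (h' : C' ⊆ Φ.dom) :
    Φ.toFun C ≤ᵐ[μ] Φ.toFun C' ↔ C ≤ᵐ[μ] C' := by
  rw [ae_le_set, ae_le_set]
  exact (Φ.null_diff_iff C C' hC h hC' h').symm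

theorem toFun_congr {C C' : Set Ω} (hC : MeasurableSet C) (h : C ⊆ Φ.dom)
    (hC' : MeasurableSet C') (h' : C' ⊆ Φ.dom) (hCC' : C =ᵐ[μ] C') :
    Φ.toFun C =ᵐ[μ] Φ.toFun C' :=
  ((Φ.toFun_le_iff hC h hC' h').2 hCC'.le).antisymm ((Φ.toFun_le_iff hC' h' hC h).2 hCC'.symm.le)

/-- A right inverse of a map that reflects inclusion modulo null sets is also a left inverse. -/
theorem invFun_toFun {C : Set Ω} (hC : MeasurableSet C) (h : C ⊆ Φ.dom) :
    Φ.invFun (Φ.toFun C) =ᵐ[μ] C := by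
  have h1 := Φ.toFun_mem C hC h
  have h2 := Φ.invFun_mem _ h1.1 h1.2
  have h3 := Φ.toFun_invFun _ h1.1 h1.2
  exact ((Φ.toFun_le_iff h2.1 h2.2 hC h).1 h3.le).antisymm
    ((Φ.toFun_le_iff hC h h2.1 h2.2).1 h3.symm.le)

/-- The inverse partial set automorphism. -/
def symm : PartialSetAut μ where
  dom := Φ.cod
  cod := Φ.dom
  measurableSet_dom := Φ.measurableSet_cod
  measurableSet_cod := Φ.measurableSet_dom
  toFun := Φ.invFun
  invFun := Φ.toFun
  toFun_mem := Φ.invFun_mem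
  invFun_mem := Φ.toFun_mem
  null_diff_iff := by
    intro C C' hC h hC' h'
    have h1 := Φ.invFun_mem C hC h
    have h2 := Φ.invFun_mem C' hC' h'
    have h3 := Φ.toFun_invFun C hC h
    have h4 := Φ.toFun_invFun C' hC' h'
    rw [Φ.null_diff_iff _ _ h1.1 h1.2 h2.1 h2.2, measure_congr (h3.diff h4)]
  toFun_invFun := fun _ hC h => Φ.invFun_toFun hC h

@[simp] theorem symm_dom : Φ.symm.dom = Φ.cod := rfl
@[simp] theorem symm_cod : Φ.symm.cod = Φ.dom := rfl
@[simp] theorem symm_toFun : Φ.symm.toFun = Φ.invFun := rfl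

theorem toFun_dom : Φ.toFun Φ.dom =ᵐ[μ] Φ.cod := by
  have h1 := Φ.toFun_mem _ Φ.measurableSet_dom le_rfl
  have h2 := Φ.invFun_mem _ Φ.measurableSet_cod le_rfl
  refine EventuallyLE.antisymm (LE.le.eventuallyLE h1.2) ?_
  refine (Φ.toFun_invFun _ Φ.measurableSet_cod le_rfl).symm.le.trans ?_
  exact (Φ.toFun_le_iff h2.1 h2.2 Φ.measurableSet_dom le_rfl).2
    (LE.le.eventuallyLE h2.2)

/-- An order isomorphism preserves the least element; surjectivity supplies a set that is mapped to
the null class, and C lies below it. -/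
theorem toFun_null {C : Set Ω} (hC : MeasurableSet C) (h : C ⊆ Φ.dom) (h0 : μ C = 0) :
    μ (Φ.toFun C) = 0 := by
  have he : (∅ : Set Ω) ⊆ Φ.cod := Set.empty_subset _
  have h1 := Φ.invFun_mem ∅ MeasurableSet.empty he
  have h2 : C ≤ᵐ[μ] Φ.invFun ∅ :=
    ae_le_set.2 (measure_mono_null Set.sdiff_subset h0)
  have h3 := ((Φ.toFun_le_iff hC h h1.1 h1.2).2 h2).trans
    (Φ.toFun_invFun ∅ MeasurableSet.empty he).le
  simpa using ae_le_set.1 h3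

theorem toFun_null_iff {C : Set Ω} (hC : MeasurableSet C) (h : C ⊆ Φ.dom) :
    μ (Φ.toFun C) = 0 ↔ μ C = 0 := by
  refine ⟨fun h0 => ?_, Φ.toFun_null hC h⟩
  have h1 := Φ.toFun_mem C hC h
  rw [← measure_congr (Φ.invFun_toFun hC h)]
  exact Φ.symm.toFun_null h1.1 h1.2 h0

/-- Countable unions are suprema modulo null sets, and order isomorphisms preserve suprema. -/
theorem toFun_iUnion {C : ℕ → Set Ω} (hC : ∀ n, MeasurableSet (C n)) (h : ∀ n, C n ⊆ Φ.dom) :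
    Φ.toFun (⋃ n, C n) =ᵐ[μ] ⋃ n, Φ.toFun (C n) := by
  have hU := MeasurableSet.iUnion hC
  have hU' : ⋃ n, C n ⊆ Φ.dom := Set.iUnion_subset h
  have hV : MeasurableSet (⋃ n, Φ.toFun (C n)) :=
    MeasurableSet.iUnion fun n => Φ.measurableSet_toFun (hC n) (h n)
  have hV' : ⋃ n, Φ.toFun (C n) ⊆ Φ.cod := Set.iUnion_subset fun n => Φ.toFun_subset (hC n) (h n)
  have h1 := Φ.invFun_mem _ hV hV'
  apply EventuallyLE.antisymm
  · refine EventuallyLE.trans ?_ (Φ.toFun_invFun _ hV hV').le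
    rw [Φ.toFun_le_iff hU hU' h1.1 h1.2]
    have h2 : ∀ n, C n ≤ᵐ[μ] Φ.invFun (⋃ n, Φ.toFun (C n)) := fun n => by
      rw [← Φ.toFun_le_iff (hC n) (h n) h1.1 h1.2]
      refine EventuallyLE.trans ?_ (Φ.toFun_invFun _ hV hV').symm.le
      exact LE.le.eventuallyLE (Set.subset_iUnion (fun n => Φ.toFun (C n)) n)
    filter_upwards [ae_all_iff.2 h2] with x hx hx'
    obtain ⟨n, hn⟩ := Set.mem_iUnion.1 hx'
    exact hx n hn
  · have h2 : ∀ n, Φ.toFun (C n) ≤ᵐ[μ] Φ.toFun (⋃ n, C n) := fun n => by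
      rw [Φ.toFun_le_iff (hC n) (h n) hU hU']
      exact LE.le.eventuallyLE (Set.subset_iUnion C n)
    filter_upwards [ae_all_iff.2 h2] with x hx hx'
    obtain ⟨n, hn⟩ := Set.mem_iUnion.1 hx'
    exact hx n hn

theorem toFun_union {C C' : Set Ω} (hC : MeasurableSet C) (h : C ⊆ Φ.dom)
    (hC' : MeasurableSet C') (h' : C' ⊆ Φ.dom) :
    Φ.toFun (C ∪ C') =ᵐ[μ] (Φ.toFun C ∪ Φ.toFun C' : Set Ω) := by
  have := Φ.toFun_iUnion (C := fun n => if n = 0 then C else C')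
    (fun n => by split_ifs <;> assumption) (fun n => by split_ifs <;> assumption)
  have h1 : ∀ D D' : Set Ω, (⋃ n : ℕ, if n = 0 then D else D') = D ∪ D' := by
    intro D D'
    ext x
    simp only [Set.mem_iUnion, Set.mem_union]
    constructor
    · rintro ⟨n, hn⟩
      split_ifs at hn <;> tauto
    · rintro (hx | hx)
      · exact ⟨0, by simpa using hx⟩
      · exact ⟨1, by simpa using hx⟩
  simp only [apply_ite Φ.toFun] at this
  rwa [h1, h1] at this

/-- The image of the intersection under Φ* lies below both C and its complement, hence is null. -/
theorem measure_toFun_inter_diff {C : Set Ω} (hC : MeasurableSet C) (h : C ⊆ Φ.dom) :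
    μ (Φ.toFun C ∩ Φ.toFun (Φ.dom \ C)) = 0 := by
  have hd : MeasurableSet (Φ.dom \ C) := Φ.measurableSet_dom.diff hC
  have h1 := Φ.toFun_mem C hC h
  have h2 := Φ.toFun_mem _ hd Set.sdiff_subset
  have hE : MeasurableSet (Φ.toFun C ∩ Φ.toFun (Φ.dom \ C)) := h1.1.inter h2.1
  have hE' : Φ.toFun C ∩ Φ.toFun (Φ.dom \ C) ⊆ Φ.cod := Set.inter_subset_left.trans h1.2
  rw [← Φ.symm.toFun_null_iff hE hE']
  have h3 : Φ.invFun (Φ.toFun C ∩ Φ.toFun (Φ.dom \ C)) ≤ᵐ[μ] C :=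
    ((Φ.symm.toFun_le_iff hE hE' h1.1 h1.2).2
      (LE.le.eventuallyLE Set.inter_subset_left)).trans (Φ.invFun_toFun hC h).le
  have h4 : Φ.invFun (Φ.toFun C ∩ Φ.toFun (Φ.dom \ C)) ≤ᵐ[μ] (Φ.dom \ C : Set Ω) :=
    ((Φ.symm.toFun_le_iff hE hE' h2.1 h2.2).2
      (LE.le.eventuallyLE Set.inter_subset_right)).trans
      (Φ.invFun_toFun hd Set.sdiff_subset).le
  rw [measure_eq_zero_iff_ae_notMem]
  filter_upwards [h3, h4] with x h3 h4 hx
  exact (h4 hx).2 (h3 hx)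

theorem toFun_diff {C : Set Ω} (hC : MeasurableSet C) (h : C ⊆ Φ.dom) :
    Φ.toFun (Φ.dom \ C) =ᵐ[μ] (Φ.cod \ Φ.toFun C : Set Ω) := by
  have hd : MeasurableSet (Φ.dom \ C) := Φ.measurableSet_dom.diff hC
  have h1 := Φ.toFun_union hC h hd Set.sdiff_subset
  rw [Set.union_sdiff_cancel h] at h1
  have h2 := measure_eq_zero_iff_ae_notMem.1 (Φ.measure_toFun_inter_diff hC h)
  filter_upwards [h1.symm.trans Φ.toFun_dom, h2] with x h1 h2
  have h1 : (x ∈ Φ.toFun C ∨ x ∈ Φ.toFun (Φ.dom \ C)) = (x ∈ Φ.cod) := h1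
  have h2 : ¬ (x ∈ Φ.toFun C ∧ x ∈ Φ.toFun (Φ.dom \ C)) := h2
  change (x ∈ Φ.toFun (Φ.dom \ C)) = (x ∈ Φ.cod ∧ x ∉ Φ.toFun C)
  rw [← h1]
  by_cases hx : x ∈ Φ.toFun C <;> by_cases hx' : x ∈ Φ.toFun (Φ.dom \ C) <;> simp_all

end PartialSetAut

/-! ### Standard Borel spaces inside the Cantor space -/

/-- With this coding a measurable function becomes a sequence of measurable sets, one for each bit.
Functions can then be transported along Φ, compared or glued one set at a time, and `d` decodes the
result. -/
theorem exists_natBool_coding (Y : Type*) [MeasurableSpace Y] [StandardBorelSpace Y]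
    [Nonempty Y] : ∃ (e : Y → ℕ → Bool) (d : (ℕ → Bool) → Y),
      MeasurableEmbedding e ∧ Measurable d ∧ ∀ y, d (e y) = y := by
  have he : MeasurableEmbedding (MeasurableSpace.mapNatBool Y) :=
    (MeasurableSpace.measurable_mapNatBool Y).measurableEmbedding
      (MeasurableSpace.injective_mapNatBool Y)
  obtain ⟨d, hd, hde⟩ := he.exists_measurable_extend measurable_id fun _ => inferInstance
  exact ⟨_, d, he, hd, fun y => congrFun hde y⟩

/-! ### Lifting functions along a partial set automorphism -/

section Lift

variable {Ω : Type*} [MeasurableSpace Ω] {μ : Measure Ω} (Φ : PartialSetAut μ)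
  {Y Z : Type*} [MeasurableSpace Y] [MeasurableSpace Z]

/-- `g` is a lift of `f` along `Φ`: on the level of preimages, `g` is `Φ` applied to `f`. -/
structure IsLift (f g : Ω → Y) : Prop where
  measurable_left : Measurable f
  measurable_right : Measurable g
  preimage_ae_eq : ∀ B, MeasurableSet B →
    (g ⁻¹' B ∩ Φ.cod : Set Ω) =ᵐ[μ] Φ.toFun (f ⁻¹' B ∩ Φ.dom)

variable {Φ}

theorem IsLift.comp {f g : Ω → Y} (h : IsLift Φ f g) {ψ : Y → Z} (hψ : Measurable ψ) :
    IsLift Φ (ψ ∘ f) (ψ ∘ g) :=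
  ⟨hψ.comp h.measurable_left, hψ.comp h.measurable_right,
    fun _ hB => h.preimage_ae_eq _ (hψ hB)⟩

theorem IsLift.congr {f g f' g' : Ω → Y} (h : IsLift Φ f g) (hf : Measurable f')
    (hg : Measurable g') (hff' : f =ᵐ[μ.restrict Φ.dom] f') (hgg' : g =ᵐ[μ.restrict Φ.cod] g') :
    IsLift Φ f' g' := by
  refine ⟨hf, hg, fun B hB => ?_⟩
  rw [EventuallyEq, ae_restrict_iff' Φ.measurableSet_dom] at hff'
  rw [EventuallyEq, ae_restrict_iff' Φ.measurableSet_cod] at hgg'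
  have h1 : (f ⁻¹' B ∩ Φ.dom : Set Ω) =ᵐ[μ] (f' ⁻¹' B ∩ Φ.dom : Set Ω) := by
    filter_upwards [hff'] with x hx
    change (f x ∈ B ∧ x ∈ Φ.dom) = (f' x ∈ B ∧ x ∈ Φ.dom)
    by_cases hxd : x ∈ Φ.dom
    · rw [hx hxd]
    · simp [hxd]
  have h2 : (g ⁻¹' B ∩ Φ.cod : Set Ω) =ᵐ[μ] (g' ⁻¹' B ∩ Φ.cod : Set Ω) := by
    filter_upwards [hgg'] with x hx
    change (g x ∈ B ∧ x ∈ Φ.cod) = (g' x ∈ B ∧ x ∈ Φ.cod)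
    by_cases hxd : x ∈ Φ.cod
    · rw [hx hxd]
    · simp [hxd]
  refine h2.symm.trans ((h.preimage_ae_eq B hB).trans ?_)
  exact Φ.toFun_congr ((h.measurable_left hB).inter Φ.measurableSet_dom) Set.inter_subset_right
    ((hf hB).inter Φ.measurableSet_dom) Set.inter_subset_right h1

theorem IsLift.symm {f g : Ω → Y} (h : IsLift Φ f g) : IsLift Φ.symm g f := by
  refine ⟨h.measurable_right, h.measurable_left, fun B hB => ?_⟩
  have hf : MeasurableSet (f ⁻¹' B ∩ Φ.dom) := (h.measurable_left hB).inter Φ.measurableSet_dom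
  have hg : MeasurableSet (g ⁻¹' B ∩ Φ.cod) := (h.measurable_right hB).inter Φ.measurableSet_cod
  have hm := Φ.toFun_mem _ hf Set.inter_subset_right
  exact (Φ.invFun_toFun hf Set.inter_subset_right).symm.trans
    (Φ.symm.toFun_congr hm.1 hm.2 hg Set.inter_subset_right (h.preimage_ae_eq B hB).symm)

/-- The sets where the condition fails correspond under Φ, and Φ preserves and reflects null sets.
Applied to lifts of tuples or sequences, this transfers any measurable pointwise relation. -/
theorem IsLift.ae_restrict_iff {f g : Ω → Y} (h : IsLift Φ f g) {q : Y → Prop}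
    (hq : MeasurableSet {y | q y}) :
    (∀ᵐ x ∂μ.restrict Φ.dom, q (f x)) ↔ ∀ᵐ x ∂μ.restrict Φ.cod, q (g x) := by
  have h1 := h.preimage_ae_eq _ hq.compl
  have hf : MeasurableSet (f ⁻¹' {y | q y}ᶜ ∩ Φ.dom) :=
    (h.measurable_left hq.compl).inter Φ.measurableSet_dom
  rw [ae_iff, ae_iff, Measure.restrict_apply' Φ.measurableSet_dom,
    Measure.restrict_apply' Φ.measurableSet_cod]
  change μ (f ⁻¹' {y | q y}ᶜ ∩ Φ.dom) = 0 ↔ μ (g ⁻¹' {y | q y}ᶜ ∩ Φ.cod) = 0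
  rw [measure_congr h1, Φ.toFun_null_iff hf Set.inter_subset_right]

/-- This is the change of variables formula, stated for image measures. -/
theorem IsLift.map_eq {f g : Ω → Y} (h : IsLift Φ f g) {w : Ω → ℝ≥0∞}
    (hw : ∀ C, MeasurableSet C → C ⊆ Φ.cod → μ (Φ.invFun C) = ∫⁻ x in C, w x ∂μ) :
    ((μ.restrict Φ.cod).withDensity w).map g = (μ.restrict Φ.dom).map f := by
  ext B hB
  have hf : MeasurableSet (f ⁻¹' B ∩ Φ.dom) := (h.measurable_left hB).inter Φ.measurableSet_dom
  have hg : MeasurableSet (g ⁻¹' B ∩ Φ.cod) := (h.measurable_right hB).inter Φ.measurableSet_cod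
  rw [Measure.map_apply h.measurable_right hB, Measure.map_apply h.measurable_left hB,
    withDensity_apply _ (h.measurable_right hB), Measure.restrict_restrict (h.measurable_right hB),
    ← hw _ hg Set.inter_subset_right, Measure.restrict_apply (h.measurable_left hB)]
  exact measure_congr (h.symm.preimage_ae_eq B hB).symm

/-- Each bit of the coded lift is determined off a null set, and there are only countably many bits.
-/
theorem IsLift.ae_eq [StandardBorelSpace Y] [Nonempty Y] {f g g' : Ω → Y}
    (h : IsLift Φ f g) (h' : IsLift Φ f g') : g =ᵐ[μ.restrict Φ.cod] g' := by
  obtain ⟨e, d, he, hd, hde⟩ := exists_natBool_coding Y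
  have h1 : ∀ n : ℕ, ∀ᵐ x ∂μ, x ∈ Φ.cod → (e (g x) n = true ↔ e (g' x) n = true) := fun n => by
    have hB : MeasurableSet {y | e y n = true} :=
      (measurable_pi_apply n).comp he.measurable (measurableSet_singleton true)
    filter_upwards [(h.preimage_ae_eq _ hB).trans (h'.preimage_ae_eq _ hB).symm] with x hx hxc
    have hx : (e (g x) n = true ∧ x ∈ Φ.cod) = (e (g' x) n = true ∧ x ∈ Φ.cod) := hx
    simpa [hxc] using hx
  rw [EventuallyEq, ae_restrict_iff' Φ.measurableSet_cod]
  filter_upwards [ae_all_iff.2 h1] with x hx hxc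
  apply he.injective
  funext n
  exact Bool.eq_iff_iff.2 (hx n hxc)

/-- The n-th bit of the lift is the indicator of the Φ-image of the set where the n-th bit of f is
true. -/
theorem exists_isLift_natBool (Φ : PartialSetAut μ) {f : Ω → ℕ → Bool} (hf : Measurable f) :
    ∃ g : Ω → ℕ → Bool, IsLift Φ f g := by
  classical
  have hs : ∀ n, MeasurableSet ({x | f x n = true} ∩ Φ.dom) := fun n =>
    ((measurable_pi_apply n).comp hf (measurableSet_singleton true)).inter Φ.measurableSet_dom
  have hs' : ∀ n, MeasurableSet (Φ.toFun ({x | f x n = true} ∩ Φ.dom)) := fun n =>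
    Φ.measurableSet_toFun (hs n) Set.inter_subset_right
  let g : Ω → ℕ → Bool := fun x n => decide (x ∈ Φ.toFun ({x | f x n = true} ∩ Φ.dom))
  have hg : Measurable g := by
    refine measurable_pi_iff.2 fun n => measurable_to_bool ?_
    convert hs' n using 1
    ext x; simp [g]
  suffices hmain : ∀ B, MeasurableSet B →
      (g ⁻¹' B ∩ Φ.cod : Set Ω) =ᵐ[μ] Φ.toFun (f ⁻¹' B ∩ Φ.dom) from ⟨g, hf, hg, hmain⟩
  have hev : ∀ n, MeasurableSet ((fun b : ℕ → Bool => b n) ⁻¹' {true}) := fun n =>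
    measurable_pi_apply n (measurableSet_singleton true)
  -- The sets whose preimages correspond under Φ form a σ-algebra; it remains to see that it
  -- contains the coordinate sets, for which the relation holds by construction.
  let m : MeasurableSpace (ℕ → Bool) :=
    { MeasurableSet' := fun B => MeasurableSet B ∧
        (g ⁻¹' B ∩ Φ.cod : Set Ω) =ᵐ[μ] Φ.toFun (f ⁻¹' B ∩ Φ.dom)
      measurableSet_empty := by
        refine ⟨MeasurableSet.empty, ?_⟩
        have := Φ.toFun_null MeasurableSet.empty (Set.empty_subset _) measure_empty
        simpa using (ae_eq_empty.2 this).symm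
      measurableSet_compl := by
        rintro B ⟨hB, hB'⟩
        refine ⟨hB.compl, ?_⟩
        have h1 : f ⁻¹' Bᶜ ∩ Φ.dom = Φ.dom \ (f ⁻¹' B ∩ Φ.dom) := by ext x; simp; tauto
        have h2 : g ⁻¹' Bᶜ ∩ Φ.cod = Φ.cod \ (g ⁻¹' B ∩ Φ.cod) := by ext x; simp; tauto
        rw [h1, h2]
        exact ((ae_eq_refl _).diff hB').trans
          (Φ.toFun_diff ((hf hB).inter Φ.measurableSet_dom) Set.inter_subset_right).symm
      measurableSet_iUnion := by
        intro B hB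
        refine ⟨MeasurableSet.iUnion fun n => (hB n).1, ?_⟩
        rw [Set.preimage_iUnion, Set.preimage_iUnion, Set.iUnion_inter, Set.iUnion_inter]
        exact (Filter.EventuallyEq.countable_iUnion fun n => (hB n).2).trans
          (Φ.toFun_iUnion (fun n => (hf (hB n).1).inter Φ.measurableSet_dom)
            fun n => Set.inter_subset_right).symm }
  have hm : (MeasurableSpace.pi : MeasurableSpace (ℕ → Bool)) ≤ m := by
    refine iSup_le fun n => ?_
    refine (@measurable_iff_comap_le _ _ m _ _).1 (@measurable_to_bool _ m _ ?_)
    refine ⟨hev n, ?_⟩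
    have h1 : g ⁻¹' ((fun b : ℕ → Bool => b n) ⁻¹' {true}) ∩ Φ.cod =
        Φ.toFun ({x | f x n = true} ∩ Φ.dom) := by
      have := Φ.toFun_subset (hs n) Set.inter_subset_right
      ext x
      simpa [g] using fun hx => this hx
    rw [h1]
    rfl
  exact fun B hB => (hm B hB).2

theorem exists_isLift [StandardBorelSpace Y] [Nonempty Y] (Φ : PartialSetAut μ) {f : Ω → Y}
    (hf : Measurable f) : ∃ g : Ω → Y, IsLift Φ f g := by
  obtain ⟨e, d, he, hd, hde⟩ := exists_natBool_coding Y
  obtain ⟨g, hg⟩ := exists_isLift_natBool Φ (he.measurable.comp hf)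
  refine ⟨d ∘ g, ?_⟩
  have := hg.comp hd
  have h1 : d ∘ e ∘ f = f := funext fun x => hde (f x)
  rwa [h1] at this

end Lift

/-! ### Joint lifts of pairs and sequences -/

section LiftProducts

variable {Ω : Type*} [MeasurableSpace Ω] {μ : Measure Ω} {Φ : PartialSetAut μ}
  {Y Z : Type*} [MeasurableSpace Y] [MeasurableSpace Z] [StandardBorelSpace Y] [Nonempty Y]
  [StandardBorelSpace Z] [Nonempty Z]

/-- A lift of the pair exists, and uniqueness of lifts identifies its two coordinates. Sums and
products are then lifted by composing with a measurable operation. -/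
theorem IsLift.prodMk {f g : Ω → Y} {f' g' : Ω → Z} (h : IsLift Φ f g) (h' : IsLift Φ f' g') :
    IsLift Φ (fun x => (f x, f' x)) (fun x => (g x, g' x)) := by
  obtain ⟨G, hG⟩ := exists_isLift Φ (h.measurable_left.prodMk h'.measurable_left)
  refine hG.congr hG.measurable_left (h.measurable_right.prodMk h'.measurable_right)
    (ae_eq_refl _) ?_
  filter_upwards [(hG.comp measurable_fst).ae_eq h, (hG.comp measurable_snd).ae_eq h']
    with x h1 h2
  exact Prod.ext h1 h2

theorem IsLift.pi {f g : ℕ → Ω → Y} (h : ∀ n, IsLift Φ (f n) (g n)) :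
    IsLift Φ (fun x n => f n x) (fun x n => g n x) := by
  obtain ⟨G, hG⟩ := exists_isLift Φ (measurable_pi_iff.2 fun n => (h n).measurable_left)
  refine hG.congr hG.measurable_left (measurable_pi_iff.2 fun n => (h n).measurable_right)
    (ae_eq_refl _) ?_
  have h1 : ∀ n, (fun x => G x n) =ᵐ[μ.restrict Φ.cod] g n := fun n =>
    (hG.comp (measurable_pi_apply n)).ae_eq (h n)
  filter_upwards [ae_all_iff.2 h1] with x hx
  funext n
  exact hx n

end LiftProducts

/-! ### Composition operators -/

section CompOp

variable {Ω : Type*} [MeasurableSpace Ω] {μ : Measure Ω} {𝕜 : Type*} [RCLike 𝕜]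

/-- The underlying function of the composition operator. -/
def compFun (Φ : PartialSetAut μ) (f : Ω →ₘ[μ] 𝕜) : Ω →ₘ[μ] 𝕜 :=
  AEEqFun.mk (Φ.cod.indicator (exists_isLift Φ f.measurable).choose)
    ((exists_isLift Φ f.measurable).choose_spec.measurable_right.indicator
      Φ.measurableSet_cod).aestronglyMeasurable

theorem isLift_compFun (Φ : PartialSetAut μ) (f : Ω →ₘ[μ] 𝕜) : IsLift Φ f (compFun Φ f) := by
  refine (exists_isLift Φ f.measurable).choose_spec.congr f.measurable (AEEqFun.measurable _)
    (ae_eq_refl _) ?_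
  rw [EventuallyEq, ae_restrict_iff' Φ.measurableSet_cod]
  filter_upwards [AEEqFun.coeFn_mk (Φ.cod.indicator (exists_isLift Φ f.measurable).choose)
    ((exists_isLift Φ f.measurable).choose_spec.measurable_right.indicator
      Φ.measurableSet_cod).aestronglyMeasurable] with x hx hxc
  rw [compFun, hx, Set.indicator_of_mem hxc]

theorem chi_cod_mul_compFun (Φ : PartialSetAut μ) (f : Ω →ₘ[μ] 𝕜) :
    chi μ 𝕜 Φ.cod * compFun Φ f = compFun Φ f := by
  rw [chi_mul_eq_self_iff Φ.measurableSet_cod]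
  filter_upwards [AEEqFun.coeFn_mk (Φ.cod.indicator (exists_isLift Φ f.measurable).choose)
    ((exists_isLift Φ f.measurable).choose_spec.measurable_right.indicator
      Φ.measurableSet_cod).aestronglyMeasurable] with x hx hxc
  rw [compFun, hx, Set.indicator_of_notMem hxc]

/-- By uniqueness of lifts, any lift computes the composition operator. The indicator is needed
because a lift is unconstrained outside `cod`. -/
theorem compFun_eq {Φ : PartialSetAut μ} {f g : Ω →ₘ[μ] 𝕜} (h : IsLift Φ f g) :
    compFun Φ f = chi μ 𝕜 Φ.cod * g := by
  have h1 := (isLift_compFun Φ f).ae_eq h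
  rw [EventuallyEq, ae_restrict_iff' Φ.measurableSet_cod] at h1
  apply AEEqFun.ext
  filter_upwards [h1, coeFn_chi_mul Φ.measurableSet_cod g,
    (chi_mul_eq_self_iff Φ.measurableSet_cod).1 (chi_cod_mul_compFun Φ f)] with x h1 h2 h3
  rw [h2]
  by_cases hx : x ∈ Φ.cod
  · rw [Set.indicator_of_mem hx, h1 hx]
  · rw [Set.indicator_of_notMem hx, h3 hx]

theorem IsLift.coeFn_congr {Φ : PartialSetAut μ} {f g : Ω →ₘ[μ] 𝕜} {f' g' : Ω → 𝕜}
    (h : IsLift Φ f' g') (hf : f =ᵐ[μ] f') (hg : g =ᵐ[μ] g') : IsLift Φ f g :=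
  h.congr f.measurable g.measurable (ae_restrict_of_ae hf.symm) (ae_restrict_of_ae hg.symm)

theorem compFun_add (Φ : PartialSetAut μ) (f g : Ω →ₘ[μ] 𝕜) :
    compFun Φ (f + g) = compFun Φ f + compFun Φ g := by
  have h := ((isLift_compFun Φ f).prodMk (isLift_compFun Φ g)).comp
    (measurable_fst.add measurable_snd)
  rw [compFun_eq (h.coeFn_congr (AEEqFun.coeFn_add f g) (AEEqFun.coeFn_add _ _)), mul_add,
    chi_cod_mul_compFun, chi_cod_mul_compFun]

theorem compFun_mul (Φ : PartialSetAut μ) (f g : Ω →ₘ[μ] 𝕜) :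
    compFun Φ (f * g) = compFun Φ f * compFun Φ g := by
  have h := ((isLift_compFun Φ f).prodMk (isLift_compFun Φ g)).comp
    (measurable_fst.mul measurable_snd)
  rw [compFun_eq (h.coeFn_congr (AEEqFun.coeFn_mul f g) (AEEqFun.coeFn_mul _ _)), ← mul_assoc,
    chi_cod_mul_compFun]

theorem compFun_smul (Φ : PartialSetAut μ) (c : 𝕜) (f : Ω →ₘ[μ] 𝕜) :
    compFun Φ (c • f) = c • compFun Φ f := by
  have h := (isLift_compFun Φ f).comp (measurable_const_mul c)
  rw [compFun_eq (h.coeFn_congr (AEEqFun.coeFn_smul c f) (AEEqFun.coeFn_smul c (compFun Φ f))),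
    mul_smul_aeeqFun, chi_cod_mul_compFun]

/-- The composition operator of a partial set automorphism. -/
def compOp (𝕜 : Type*) [RCLike 𝕜] (Φ : PartialSetAut μ) :
    (Ω →ₘ[μ] 𝕜) →ₗ[𝕜] (Ω →ₘ[μ] 𝕜) where
  toFun := compFun Φ
  map_add' := compFun_add Φ
  map_smul' := compFun_smul Φ

variable (Φ : PartialSetAut μ)

theorem isLift_compOp (f : Ω →ₘ[μ] 𝕜) : IsLift Φ f (compOp 𝕜 Φ f) := isLift_compFun Φ f

theorem chi_cod_mul_compOp (f : Ω →ₘ[μ] 𝕜) :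
    chi μ 𝕜 Φ.cod * compOp 𝕜 Φ f = compOp 𝕜 Φ f := chi_cod_mul_compFun Φ f

theorem compOp_mul (f g : Ω →ₘ[μ] 𝕜) :
    compOp 𝕜 Φ (f * g) = compOp 𝕜 Φ f * compOp 𝕜 Φ g := compFun_mul Φ f g

variable {Φ} in
theorem compOp_eq {f g : Ω →ₘ[μ] 𝕜} (h : IsLift Φ f g) :
    compOp 𝕜 Φ f = chi μ 𝕜 Φ.cod * g := compFun_eq h

theorem compOp_symm_compOp (f : Ω →ₘ[μ] 𝕜) :
    compOp 𝕜 Φ.symm (compOp 𝕜 Φ f) = chi μ 𝕜 Φ.dom * f :=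
  compOp_eq (isLift_compOp Φ f).symm

theorem compOp_compOp_symm (f : Ω →ₘ[μ] 𝕜) :
    compOp 𝕜 Φ (compOp 𝕜 Φ.symm f) = chi μ 𝕜 Φ.cod * f :=
  compOp_symm_compOp Φ.symm f

theorem compOp_chi {C : Set Ω} (hC : MeasurableSet C) :
    compOp 𝕜 Φ (chi μ 𝕜 C) = chi μ 𝕜 (Φ.toFun (C ∩ Φ.dom)) := by
  have hD : MeasurableSet (C ∩ Φ.dom) := hC.inter Φ.measurableSet_dom
  have hm := Φ.toFun_mem _ hD Set.inter_subset_right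
  have hL := (isLift_compOp Φ (chi μ 𝕜 C)).congr (f' := C.indicator fun _ => (1 : 𝕜))
    (measurable_const.indicator hC) (AEEqFun.measurable _) (ae_restrict_of_ae (coeFn_chi hC))
    (ae_eq_refl _)
  have h1 := hL.preimage_ae_eq {1} (measurableSet_singleton 1)
  have h0 := hL.preimage_ae_eq {0} (measurableSet_singleton 0)
  have e1 : (C.indicator fun _ => (1 : 𝕜)) ⁻¹' {1} ∩ Φ.dom = C ∩ Φ.dom := by
    ext x
    by_cases hx : x ∈ C <;> simp [hx]
  have e0 : (C.indicator fun _ => (1 : 𝕜)) ⁻¹' {0} ∩ Φ.dom = Φ.dom \ (C ∩ Φ.dom) := by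
    ext x
    by_cases hx : x ∈ C <;> simp [hx]
  rw [e1] at h1
  rw [e0] at h0
  rw [eq_chi_iff hm.1]
  filter_upwards [h1, h0.trans (Φ.toFun_diff hD Set.inter_subset_right),
    (chi_mul_eq_self_iff Φ.measurableSet_cod).1 (chi_cod_mul_compOp Φ (chi μ 𝕜 C))]
    with x h1 h2 h3
  have h1 : (compOp 𝕜 Φ (chi μ 𝕜 C) x = 1 ∧ x ∈ Φ.cod) = (x ∈ Φ.toFun (C ∩ Φ.dom)) := h1
  have h2 : (compOp 𝕜 Φ (chi μ 𝕜 C) x = 0 ∧ x ∈ Φ.cod) =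
    (x ∈ Φ.cod ∧ x ∉ Φ.toFun (C ∩ Φ.dom)) := h2
  by_cases hx : x ∈ Φ.toFun (C ∩ Φ.dom)
  · rw [Set.indicator_of_mem hx]
    rw [eq_true hx] at h1
    exact (of_eq_true h1).1
  · rw [Set.indicator_of_notMem hx]
    by_cases hxc : x ∈ Φ.cod
    · exact (h2.mpr ⟨hxc, hx⟩).1
    · exact h3 hxc

theorem norm_compOp_le {f : Ω →ₘ[μ] 𝕜} {C : ℝ} (hC : 0 ≤ C) (hf : ∀ᵐ x ∂μ, ‖f x‖ ≤ C) :
    ∀ᵐ x ∂μ, ‖compOp 𝕜 Φ f x‖ ≤ C := by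
  have h1 := ((isLift_compOp Φ f).ae_restrict_iff (q := fun y => ‖y‖ ≤ C)
    (measurableSet_le measurable_norm measurable_const)).1 (ae_restrict_of_ae hf)
  rw [ae_restrict_iff' Φ.measurableSet_cod] at h1
  filter_upwards [h1,
    (chi_mul_eq_self_iff Φ.measurableSet_cod).1 (chi_cod_mul_compOp Φ f)] with x h1 h2
  by_cases hx : x ∈ Φ.cod
  · exact h1 hx
  · rw [h2 hx, norm_zero]
    exact hC

theorem isCompositionOp_compOp : IsCompositionOp Φ (compOp 𝕜 Φ) where
  map_indicator := by
    intro C hC f hf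
    rw [(eq_chi_iff hC).2 hf, compOp_chi Φ hC]
    exact coeFn_chi (Φ.measurableSet_toFun (hC.inter Φ.measurableSet_dom) Set.inter_subset_right)
  map_lim := by
    intro f g h
    -- Convergence of a sequence to a limit is one measurable condition on the sequence and limit
    -- together, so it transfers along their joint lift.
    have hL := (IsLift.pi fun n => isLift_compOp Φ (f n)).prodMk (isLift_compOp Φ g)
    have hm : MeasurableSet {y : (ℕ → 𝕜) × 𝕜 | Tendsto y.1 atTop (𝓝 y.2)} :=
      measurableSet_tendsto_fun (fun n => (measurable_pi_apply n).comp measurable_fst)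
        measurable_snd
    have h1 := (hL.ae_restrict_iff hm).1 (ae_restrict_of_ae h)
    rw [ae_restrict_iff' Φ.measurableSet_cod] at h1
    have h2 : ∀ n, ∀ᵐ x ∂μ, x ∉ Φ.cod → compOp 𝕜 Φ (f n) x = 0 := fun n =>
      (chi_mul_eq_self_iff Φ.measurableSet_cod).1 (chi_cod_mul_compOp Φ (f n))
    filter_upwards [h1, ae_all_iff.2 h2,
      (chi_mul_eq_self_iff Φ.measurableSet_cod).1 (chi_cod_mul_compOp Φ g)] with x h1 h2 h3
    by_cases hx : x ∈ Φ.cod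
    · exact h1 hx
    · simp only [h2 _ hx, h3 hx, tendsto_const_nhds_iff]

variable {Φ} in
-- Indicators and linearity determine the operator on simple functions, and every measurable
-- function is a limit of simple functions.
theorem IsCompositionOp.eq_compOp {V : (Ω →ₘ[μ] 𝕜) →ₗ[𝕜] (Ω →ₘ[μ] 𝕜)}
    (hV : IsCompositionOp Φ V) : V = compOp 𝕜 Φ := by
  have hW : IsCompositionOp Φ (compOp 𝕜 Φ) := isCompositionOp_compOp Φ
  have key : ∀ s : SimpleFunc Ω 𝕜,
      V (AEEqFun.mk s s.aestronglyMeasurable) = compOp 𝕜 Φ (AEEqFun.mk s s.aestronglyMeasurable) := by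
    intro s
    induction s using SimpleFunc.induction with
    | const c hs =>
      rename_i A
      have h1 : AEEqFun.mk (SimpleFunc.piecewise A hs (SimpleFunc.const Ω c)
          (SimpleFunc.const Ω 0)) (SimpleFunc.aestronglyMeasurable _) = c • chi μ 𝕜 A := by
        apply AEEqFun.ext
        filter_upwards [AEEqFun.coeFn_mk (SimpleFunc.piecewise A hs (SimpleFunc.const Ω c)
          (SimpleFunc.const Ω 0)) (SimpleFunc.aestronglyMeasurable _ (μ := μ)),
          coeFn_smul_apply c (chi μ 𝕜 A), coeFn_chi (𝕜 := 𝕜) (μ := μ) hs] with x h1 h2 h3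
        rw [h1, h2, h3]
        by_cases hx : x ∈ A <;> simp [hx]
      rw [h1, map_smul, map_smul]
      congr 1
      exact AEEqFun.ext ((hV.map_indicator A hs _ (coeFn_chi hs)).trans
        (hW.map_indicator A hs _ (coeFn_chi hs)).symm)
    | add hd hf hg =>
      rename_i f g
      have h1 : AEEqFun.mk (f + g : SimpleFunc Ω 𝕜) (SimpleFunc.aestronglyMeasurable _ (μ := μ)) =
          AEEqFun.mk f f.aestronglyMeasurable + AEEqFun.mk g g.aestronglyMeasurable := rfl
      rw [h1, map_add, map_add, hf, hg]
  refine LinearMap.ext fun f => ?_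
  let F : ℕ → Ω →ₘ[μ] 𝕜 := fun n => AEEqFun.mk (f.stronglyMeasurable.approx n)
    (f.stronglyMeasurable.approx n).aestronglyMeasurable
  have hlim : ∀ᵐ x ∂μ, Tendsto (fun n => F n x) atTop (𝓝 (f x)) := by
    have h1 : ∀ n, ∀ᵐ x ∂μ, F n x = f.stronglyMeasurable.approx n x :=
      fun n => AEEqFun.coeFn_mk _ _
    filter_upwards [ae_all_iff.2 h1] with x hx
    simp only [hx]
    exact f.stronglyMeasurable.tendsto_approx x
  have h1 := hV.map_lim F f hlim
  have h2 := hW.map_lim F f hlim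
  have h3 : ∀ n, V (F n) = compOp 𝕜 Φ (F n) := fun n => key _
  simp only [h3] at h1
  exact AEEqFun.ext (AEEqFun.tendsto_ae_unique h1 h2)

end CompOp

/-! ### Gluing measurable functions over a localizable measure space -/

section Glue

variable {Ω : Type*} [MeasurableSpace Ω] {μ : Measure Ω}

theorem IsLocalizable.exists_lt_measure (hμ : IsLocalizable μ) {A : Set Ω} (hA : MeasurableSet A)
    {c : ℝ≥0∞} (hc : c < μ A) : ∃ B, MeasurableSet B ∧ B ⊆ A ∧ μ B < ∞ ∧ c < μ B := by
  rw [hμ.semifinite A hA] at hc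
  simp only [lt_iSup_iff] at hc
  obtain ⟨B, hB, hBA, hfin, hlt⟩ := hc
  exact ⟨B, hB, hBA, hfin, hlt⟩

/-- The family may be uncountable, but its values are coded by countably many bits. For each bit,
the essential supremum of the sets where some f_i has that bit true is the required set. -/
theorem exists_glue (hμ : IsLocalizable μ) {Y : Type*} [MeasurableSpace Y] [StandardBorelSpace Y]
    [Nonempty Y] {ι : Type*} {A : ι → Set Ω} (hA : ∀ i, MeasurableSet (A i)) {f : ι → Ω → Y}
    (hf : ∀ i, Measurable (f i))
    (hfA : ∀ i j, ∀ᵐ x ∂μ, x ∈ A i → x ∈ A j → f i x = f j x) :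
    ∃ g : Ω → Y, Measurable g ∧ ∀ i, ∀ᵐ x ∂μ, x ∈ A i → g x = f i x := by
  classical
  obtain ⟨e, d, he, hd, hde⟩ := exists_natBool_coding Y
  have hB : ∀ i n, MeasurableSet {x | e (f i x) n = true} := fun i n =>
    (measurable_pi_apply n).comp (he.measurable.comp (hf i)) (measurableSet_singleton true)
  have hS : ∀ n, ∃ S : Set Ω, MeasurableSet S ∧
      ∀ i, ∀ᵐ x ∂μ, x ∈ A i → (x ∈ S ↔ e (f i x) n = true) := by
    intro n
    obtain ⟨S, hS, hS1, hS2⟩ := hμ.exists_essSup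
      (Set.range fun i => A i ∩ {x | e (f i x) n = true})
      (by rintro _ ⟨i, rfl⟩; exact (hA i).inter (hB i n))
    refine ⟨S, hS, fun i => ?_⟩
    have h1 := ae_le_set.2 (hS1 _ ⟨i, rfl⟩)
    -- By compatibility this set is an essential upper bound of the whole family, so minimality of S
    -- prevents S from being too large on A i.
    have h2 : S ≤ᵐ[μ] ((A i)ᶜ ∪ {x | e (f i x) n = true} : Set Ω) := by
      refine ae_le_set.2 (hS2 _ ((hA i).compl.union (hB i n)) ?_)
      rintro _ ⟨j, rfl⟩
      refine ae_le_set.1 ?_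
      filter_upwards [hfA j i] with x hx hxj
      by_cases hxi : x ∈ A i
      · right
        change e (f i x) n = true
        rw [← hx hxj.1 hxi]
        exact hxj.2
      · exact Or.inl hxi
    filter_upwards [h1, h2] with x h1 h2 hx
    refine ⟨fun hxS => ?_, fun hxe => h1 ⟨hx, hxe⟩⟩
    rcases h2 hxS with h | h
    · exact absurd hx h
    · exact h
  choose S hS hSA using hS
  have hm : Measurable fun x n => decide (x ∈ S n) := by
    refine measurable_pi_iff.2 fun n => measurable_to_bool ?_
    convert hS n using 1
    ext x; simp
  refine ⟨fun x => d fun n => decide (x ∈ S n), hd.comp hm, fun i => ?_⟩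
  filter_upwards [ae_all_iff.2 fun n => hSA n i] with x hx hxi
  rw [← hde (f i x)]
  congr 1
  funext n
  exact Bool.eq_iff_iff.2 (by simpa using hx n hxi)

end Glue

/-! ### Radon–Nikodym derivatives of partial set automorphisms -/

section RadonNikodym

variable {Ω : Type*} [MeasurableSpace Ω] {μ : Measure Ω} (Φ : PartialSetAut μ)

theorem PartialSetAut.aedisjoint_toFun {C C' : Set Ω} (hC : MeasurableSet C) (h : C ⊆ Φ.dom)
    (hC' : MeasurableSet C') (h' : C' ⊆ Φ.dom) (hd : Disjoint C C') :
    AEDisjoint μ (Φ.toFun C) (Φ.toFun C') := by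
  have h1 : Φ.toFun C' ≤ᵐ[μ] Φ.toFun (Φ.dom \ C) :=
    (Φ.toFun_le_iff hC' h' (Φ.measurableSet_dom.diff hC) Set.sdiff_subset).2
      (LE.le.eventuallyLE fun x hx => ⟨h' hx, fun hx' => Set.disjoint_left.1 hd hx' hx⟩)
  refine measure_eq_zero_iff_ae_notMem.2 ?_
  filter_upwards [h1, measure_eq_zero_iff_ae_notMem.1 (Φ.measure_toFun_inter_diff hC h)]
    with x h1 h2 hx
  exact h2 ⟨hx.1, h1 hx.2⟩

/-- The measure `C ↦ μ (Φ (C ∩ dom))`. -/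
def PartialSetAut.pushMeasure : Measure Ω :=
  Measure.ofMeasurable (fun C _ => μ (Φ.toFun (C ∩ Φ.dom)))
    (Φ.toFun_null (MeasurableSet.empty.inter Φ.measurableSet_dom) Set.inter_subset_right (by simp))
    (by
      intro C hC hd
      have h1 : ∀ n, MeasurableSet (C n ∩ Φ.dom) := fun n => (hC n).inter Φ.measurableSet_dom
      have h2 : ∀ n, C n ∩ Φ.dom ⊆ Φ.dom := fun n => Set.inter_subset_right
      rw [Set.iUnion_inter, measure_congr (Φ.toFun_iUnion h1 h2), measure_iUnion₀ ?_ ?_]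
      · intro i j hij
        exact Φ.aedisjoint_toFun (h1 i) (h2 i) (h1 j) (h2 j)
          ((hd hij).mono Set.inter_subset_left Set.inter_subset_left)
      · exact fun i => (Φ.measurableSet_toFun (h1 i) (h2 i)).nullMeasurableSet)

theorem PartialSetAut.pushMeasure_apply {C : Set Ω} (hC : MeasurableSet C) :
    Φ.pushMeasure C = μ (Φ.toFun (C ∩ Φ.dom)) :=
  Measure.ofMeasurable_apply C hC

theorem PartialSetAut.pushMeasure_apply_of_subset {C : Set Ω} (hC : MeasurableSet C)
    (h : C ⊆ Φ.dom) : Φ.pushMeasure C = μ (Φ.toFun C) := by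
  rw [Φ.pushMeasure_apply hC, Set.inter_eq_left.2 h]

/-- Outside the maximal σ-finite part, every set that is non-null for the finite pushed measure has
infinite μ-measure. Semi-finiteness would give a subset there of finite positive measure, and Φ
preserves non-nullity, so that part is null. -/
theorem sigmaFinite_restrict_of_measure_toFun_lt_top (hμ : IsLocalizable μ) {D : Set Ω}
    (hD : MeasurableSet D) (h : D ⊆ Φ.dom) (hfin : μ (Φ.toFun D) < ∞) :
    SigmaFinite (μ.restrict D) := by
  have hν : IsFiniteMeasure (Φ.pushMeasure.restrict D) :=
    ⟨by rwa [Measure.restrict_apply_univ, Φ.pushMeasure_apply_of_subset hD h]⟩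
  set s := (μ.restrict D).sigmaFiniteSetWRT (Φ.pushMeasure.restrict D) with hs
  have hsm : MeasurableSet s := measurableSet_sigmaFiniteSetWRT
  have h0 : (μ.restrict D) sᶜ = 0 := by
    by_contra hne
    rw [Measure.restrict_apply hsm.compl] at hne
    obtain ⟨B, hB, hBs, hBfin, hBpos⟩ := hμ.exists_lt_measure (hsm.compl.inter hD)
      (pos_iff_ne_zero.2 hne)
    have hBD : B ⊆ D := hBs.trans Set.inter_subset_right
    have h1 := measure_eq_top_of_subset_compl_sigmaFiniteSetWRT (μ := μ.restrict D)
      (ν := Φ.pushMeasure.restrict D) (hBs.trans Set.inter_subset_left) (by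
        rw [Measure.restrict_eq_self _ hBD, Φ.pushMeasure_apply_of_subset hB (hBD.trans h), Ne,
          Φ.toFun_null_iff hB (hBD.trans h)]
        exact hBpos.ne')
    rw [Measure.restrict_eq_self _ hBD] at h1
    exact hBfin.ne h1
  rw [← Measure.restrict_eq_self_of_ae_mem (μ := μ.restrict D) (s := s)
    (by simpa using measure_eq_zero_iff_ae_notMem.1 h0)]
  rw [hs]
  infer_instance

theorem exists_density_of_measure_toFun_lt_top (hμ : IsLocalizable μ) {D : Set Ω}
    (hD : MeasurableSet D) (h : D ⊆ Φ.dom) (hfin : μ (Φ.toFun D) < ∞) :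
    ∃ f : Ω → ℝ≥0, Measurable f ∧ ∀ C, MeasurableSet C → C ⊆ D →
      μ (Φ.toFun C) = ∫⁻ x in C, (f x : ℝ≥0∞) ∂μ := by
  have hν : IsFiniteMeasure (Φ.pushMeasure.restrict D) :=
    ⟨by rwa [Measure.restrict_apply_univ, Φ.pushMeasure_apply_of_subset hD h]⟩
  have hσ := sigmaFinite_restrict_of_measure_toFun_lt_top Φ hμ hD h hfin
  have hac : Φ.pushMeasure.restrict D ≪ μ.restrict D := by
    refine Measure.AbsolutelyContinuous.mk fun C hC h0 => ?_
    rw [Measure.restrict_apply hC] at h0 ⊢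
    rw [Φ.pushMeasure_apply_of_subset (hC.inter hD) (Set.inter_subset_right.trans h)]
    exact Φ.toFun_null (hC.inter hD) (Set.inter_subset_right.trans h) h0
  refine ⟨fun x => ((Φ.pushMeasure.restrict D).rnDeriv (μ.restrict D) x).toNNReal,
    (Measure.measurable_rnDeriv _ _).ennreal_toNNReal, fun C hC hCD => ?_⟩
  have h1 := DFunLike.congr_fun (Measure.withDensity_rnDeriv_eq _ _ hac) C
  rw [withDensity_apply _ hC, Measure.restrict_eq_self _ hCD,
    Φ.pushMeasure_apply_of_subset hC (hCD.trans h), Measure.restrict_restrict hC,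
    Set.inter_eq_left.2 hCD] at h1
  rw [← h1]
  refine lintegral_congr_ae ?_
  have h2 := Measure.rnDeriv_lt_top (Φ.pushMeasure.restrict D) (μ.restrict D)
  filter_upwards [ae_restrict_of_ae_restrict_of_subset hCD h2] with x hx
  exact (ENNReal.coe_toNNReal hx.ne).symm

/-- If Φ(C) has infinite measure, it contains sets of finite and arbitrarily large measure by
semi-finiteness. Pulling these back under Φ* makes the integral exceed every bound. -/
theorem measure_toFun_eq_of_finite (hμ : IsLocalizable μ) {g : Ω → ℝ≥0}
    (hfinite : ∀ C, MeasurableSet C → C ⊆ Φ.dom → μ (Φ.toFun C) < ∞ →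
      μ (Φ.toFun C) = ∫⁻ x in C, (g x : ℝ≥0∞) ∂μ) (C : Set Ω) (hC : MeasurableSet C)
    (hCd : C ⊆ Φ.dom) : μ (Φ.toFun C) = ∫⁻ x in C, (g x : ℝ≥0∞) ∂μ := by
  by_cases hfin : μ (Φ.toFun C) < ∞
  · exact hfinite C hC hCd hfin
  · rw [not_lt_top_iff] at hfin
    rw [hfin]
    symm
    refine ENNReal.eq_top_of_forall_nnreal_le fun r => ?_
    have hmC := Φ.toFun_mem C hC hCd
    obtain ⟨B, hB, hBC, hBfin, hBr⟩ := hμ.exists_lt_measure hmC.1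
      (c := r) (by rw [hfin]; exact ENNReal.coe_lt_top)
    have hBcod := hBC.trans hmC.2
    have hmB := Φ.invFun_mem B hB hBcod
    have h1 := Φ.toFun_invFun B hB hBcod
    have h2 : Φ.invFun B ≤ᵐ[μ] C :=
      ((Φ.symm.toFun_le_iff hB hBcod hmC.1 hmC.2).2 (LE.le.eventuallyLE hBC)).trans
        (Φ.invFun_toFun hC hCd).le
    calc (r : ℝ≥0∞) ≤ μ B := hBr.le
      _ = μ (Φ.toFun (Φ.invFun B)) := (measure_congr h1).symm
      _ = ∫⁻ x in Φ.invFun B, (g x : ℝ≥0∞) ∂μ :=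
        hfinite _ hmB.1 hmB.2 (by rw [measure_congr h1]; exact hBfin)
      _ ≤ ∫⁻ x in C, (g x : ℝ≥0∞) ∂μ := lintegral_mono' (Measure.restrict_mono' h2 le_rfl) le_rfl

/-- The Radon–Nikodym theorem applies on each set with image of finite measure; uniqueness of
densities makes these local densities compatible, and they are glued. -/
theorem exists_density (hμ : IsLocalizable μ) : ∃ f : Ω → ℝ≥0, Measurable f ∧
    ∀ C, MeasurableSet C → C ⊆ Φ.dom → μ (Φ.toFun C) = ∫⁻ x in C, (f x : ℝ≥0∞) ∂μ := by
  let ι := {D : Set Ω // MeasurableSet D ∧ D ⊆ Φ.dom ∧ μ (Φ.toFun D) < ∞}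
  have hex : ∀ D : ι, _ := fun D =>
    exists_density_of_measure_toFun_lt_top Φ hμ D.2.1 D.2.2.1 D.2.2.2
  choose f hf hfD using hex
  obtain ⟨g, hg, hgD⟩ := exists_glue hμ (A := fun D : ι => D.1) (fun D => D.2.1) hf (by
    intro D D'
    have hm : MeasurableSet (D.1 ∩ D'.1) := D.2.1.inter D'.2.1
    have hsub : D.1 ∩ D'.1 ⊆ Φ.dom := Set.inter_subset_left.trans D.2.2.1
    have hfin : μ (Φ.toFun (D.1 ∩ D'.1)) < ∞ :=
      (measure_mono_ae ((Φ.toFun_le_iff hm hsub D.2.1 D.2.2.1).2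
        (LE.le.eventuallyLE Set.inter_subset_left))).trans_lt D.2.2.2
    have hσ := sigmaFinite_restrict_of_measure_toFun_lt_top Φ hμ hm hsub hfin
    have h1 := ae_eq_of_forall_setLIntegral_eq_of_sigmaFinite
      (μ := μ.restrict (D.1 ∩ D'.1)) (hf D).coe_nnreal_ennreal (hf D').coe_nnreal_ennreal (by
        intro s hs _
        rw [Measure.restrict_restrict hs,
          ← hfD D _ (hs.inter hm) (Set.inter_subset_right.trans Set.inter_subset_left),
          ← hfD D' _ (hs.inter hm) (Set.inter_subset_right.trans Set.inter_subset_right)])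
    rw [EventuallyEq, ae_restrict_iff' hm] at h1
    filter_upwards [h1] with x hx h2 h3
    exact ENNReal.coe_injective (hx ⟨h2, h3⟩))
  have hfinite : ∀ C, MeasurableSet C → C ⊆ Φ.dom → μ (Φ.toFun C) < ∞ →
      μ (Φ.toFun C) = ∫⁻ x in C, (g x : ℝ≥0∞) ∂μ := by
    intro C hC hCd hfin
    rw [hfD ⟨C, hC, hCd, hfin⟩ C hC le_rfl]
    refine lintegral_congr_ae ?_
    rw [EventuallyEq, ae_restrict_iff' hC]
    filter_upwards [hgD ⟨C, hC, hCd, hfin⟩] with x hx hxC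
    rw [hx hxC]
  exact ⟨g, hg, measure_toFun_eq_of_finite Φ hμ hfinite⟩

theorem exists_isRNDeriv (hμ : IsLocalizable μ) : ∃ h : Ω → ℝ≥0, IsRNDeriv Φ h := by
  obtain ⟨f, hf, hfC⟩ := exists_density Φ.symm hμ
  refine ⟨Φ.cod.indicator f, hf.indicator Φ.measurableSet_cod,
    fun x hx => Set.indicator_of_notMem hx f, fun C hC hCd => (hfC C hC hCd).trans ?_⟩
  refine setLIntegral_congr_fun hC fun x hx => ?_
  simp only [Set.indicator_of_mem (hCd hx)]

end RadonNikodym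

/-! ### Spatial partial isometries have contractive generalized inverses -/

section Spatial

variable {Ω : Type*} [MeasurableSpace Ω] {μ : Measure Ω} {𝕜 : Type*} [RCLike 𝕜] {p : ℝ≥0∞}

/-- `T` and `S` are contractive generalized inverses of each other, `T * S` is multiplication by
the indicator function of `D` and `S * T` is multiplication by the indicator function of `D'`. -/
structure IsChiPair [Fact (1 ≤ p)] (T S : Lp 𝕜 p μ →L[𝕜] Lp 𝕜 p μ) (D D' : Set Ω) : Prop where
  measurableSet_left : MeasurableSet D
  measurableSet_right : MeasurableSet D'
  norm_left : ‖T‖ ≤ 1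
  norm_right : ‖S‖ ≤ 1
  left_right : ∀ f, (T (S f) : Ω →ₘ[μ] 𝕜) = chi μ 𝕜 D * f
  right_left : ∀ f, (S (T f) : Ω →ₘ[μ] 𝕜) = chi μ 𝕜 D' * f
  isGenInverse : IsGenInverse T S

/-- The zero set of h in `cod` has a null image under Φ*, hence is null itself. -/
theorem IsRNDeriv.ae_ne_zero {Φ : PartialSetAut μ} {h : Ω → ℝ≥0} (hh : IsRNDeriv Φ h) :
    ∀ᵐ x ∂μ, x ∈ Φ.cod → h x ≠ 0 := by
  have hC : MeasurableSet ({x | h x = 0} ∩ Φ.cod) :=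
    (hh.measurable (measurableSet_singleton 0)).inter Φ.measurableSet_cod
  have h1 := hh.lintegral_eq _ hC Set.inter_subset_right
  rw [setLIntegral_congr_fun (g := fun _ => 0) hC (fun x hx => by
    simpa using hx.1), lintegral_zero, ← Φ.symm_toFun,
    Φ.symm.toFun_null_iff hC Set.inter_subset_right] at h1
  filter_upwards [measure_eq_zero_iff_ae_notMem.1 h1] with x hx hxc h0
  exact hx ⟨h0, hxc⟩

/-- For finite p this is change of variables, the p-th power of |a| being the density. For p = ∞ the
weight is unimodular on `cod` and lifting preserves essential bounds. -/
theorem eLpNorm_mul_compOp (hp : 1 ≤ p) {Φ : PartialSetAut μ} {h : Ω → ℝ≥0} (hh : IsRNDeriv Φ h)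
    {a : Ω →ₘ[μ] 𝕜} (ha : ∀ᵐ x ∂μ, x ∈ Φ.cod → ‖a x‖ = (h x : ℝ) ^ (1 / p.toReal))
    (f : Ω →ₘ[μ] 𝕜) :
    eLpNorm (a * compOp 𝕜 Φ f : Ω →ₘ[μ] 𝕜) p μ = eLpNorm (chi μ 𝕜 Φ.dom * f : Ω →ₘ[μ] 𝕜) p μ := by
  have hL := isLift_compOp Φ f
  have hz := (chi_mul_eq_self_iff Φ.measurableSet_cod).1 (chi_cod_mul_compOp Φ f)
  by_cases hpt : p = ∞
  · subst hpt
    have h1 : ∀ c : ℝ≥0∞, (∀ᵐ x ∂μ, ‖(a * compOp 𝕜 Φ f : Ω →ₘ[μ] 𝕜) x‖ₑ ≤ c) ↔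
        ∀ᵐ x ∂μ, ‖(chi μ 𝕜 Φ.dom * f : Ω →ₘ[μ] 𝕜) x‖ₑ ≤ c := by
      intro c
      have h2 := hL.ae_restrict_iff (q := fun y => ‖y‖ₑ ≤ c)
        (measurableSet_le measurable_enorm measurable_const)
      rw [ae_restrict_iff' Φ.measurableSet_cod, ae_restrict_iff' Φ.measurableSet_dom] at h2
      have h3 : (∀ᵐ x ∂μ, ‖(a * compOp 𝕜 Φ f : Ω →ₘ[μ] 𝕜) x‖ₑ ≤ c) ↔
          ∀ᵐ x ∂μ, x ∈ Φ.cod → ‖compOp 𝕜 Φ f x‖ₑ ≤ c := by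
        refine eventually_congr ?_
        filter_upwards [ha, hz, coeFn_mul_apply a (compOp 𝕜 Φ f)] with x h4 h5 h6
        rw [h6]
        by_cases hx : x ∈ Φ.cod
        · have h7 := h4 hx
          simp only [ENNReal.toReal_top, div_zero, Real.rpow_zero] at h7
          have h8 : ‖a x‖ₑ = 1 := by rw [← ofReal_norm, h7, ENNReal.ofReal_one]
          simp [hx, enorm_mul, h8]
        · simp [hx, h5 hx]
      have h4 : (∀ᵐ x ∂μ, ‖(chi μ 𝕜 Φ.dom * f : Ω →ₘ[μ] 𝕜) x‖ₑ ≤ c) ↔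
          ∀ᵐ x ∂μ, x ∈ Φ.dom → ‖f x‖ₑ ≤ c := by
        refine eventually_congr ?_
        filter_upwards [coeFn_chi_mul Φ.measurableSet_dom f] with x h5
        rw [h5]
        by_cases hx : x ∈ Φ.dom <;> simp [hx]
      rw [h3, h4, h2]
    simp only [eLpNorm_exponent_top, eLpNormEssSup, essSup_eq_sInf]
    congr 1
    ext c
    have := h1 c
    rw [ae_iff, ae_iff] at this
    simpa only [not_le, Set.mem_ofPred_eq] using this
  · have hp0 : p ≠ 0 := (zero_lt_one.trans_le hp).ne'
    have hpr : 0 < p.toReal := ENNReal.toReal_pos hp0 hpt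
    rw [eLpNorm_eq_lintegral_rpow_enorm_toReal hp0 hpt,
      eLpNorm_eq_lintegral_rpow_enorm_toReal hp0 hpt]
    congr 1
    have hmeas : Measurable fun y : 𝕜 => ‖y‖ₑ ^ p.toReal := measurable_enorm.pow_const _
    calc ∫⁻ x, ‖(a * compOp 𝕜 Φ f : Ω →ₘ[μ] 𝕜) x‖ₑ ^ p.toReal ∂μ
        = ∫⁻ x, Φ.cod.indicator (fun x => (h x : ℝ≥0∞) * ‖compOp 𝕜 Φ f x‖ₑ ^ p.toReal) x ∂μ := by
          refine lintegral_congr_ae ?_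
          filter_upwards [ha, hz, coeFn_mul_apply a (compOp 𝕜 Φ f)] with x h4 h5 h6
          rw [h6]
          by_cases hx : x ∈ Φ.cod
          · rw [Set.indicator_of_mem hx, enorm_mul, ENNReal.mul_rpow_of_nonneg _ _ hpr.le,
              ← ofReal_norm (a x), h4 hx,
              ENNReal.ofReal_rpow_of_nonneg (by positivity) hpr.le, ← Real.rpow_mul (by positivity),
              one_div_mul_cancel hpr.ne', Real.rpow_one, ENNReal.ofReal_coe_nnreal]
          · rw [Set.indicator_of_notMem hx, h5 hx]
            simp [hpr]
      _ = ∫⁻ x in Φ.cod, (h x : ℝ≥0∞) * ‖compOp 𝕜 Φ f x‖ₑ ^ p.toReal ∂μ :=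
          lintegral_indicator Φ.measurableSet_cod _
      _ = ∫⁻ x, ‖compOp 𝕜 Φ f x‖ₑ ^ p.toReal
            ∂((μ.restrict Φ.cod).withDensity fun x => (h x : ℝ≥0∞)) :=
          (lintegral_withDensity_eq_lintegral_mul _ hh.measurable.coe_nnreal_ennreal
            (hmeas.comp hL.measurable_right)).symm
      _ = ∫⁻ y, ‖y‖ₑ ^ p.toReal
            ∂(((μ.restrict Φ.cod).withDensity fun x => (h x : ℝ≥0∞)).map (compOp 𝕜 Φ f)) :=
          (lintegral_map hmeas hL.measurable_right).symm
      _ = ∫⁻ y, ‖y‖ₑ ^ p.toReal ∂((μ.restrict Φ.dom).map f) := by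
          rw [hL.map_eq hh.lintegral_eq]
      _ = ∫⁻ x in Φ.dom, ‖f x‖ₑ ^ p.toReal ∂μ := lintegral_map hmeas hL.measurable_left
      _ = ∫⁻ x, ‖(chi μ 𝕜 Φ.dom * f : Ω →ₘ[μ] 𝕜) x‖ₑ ^ p.toReal ∂μ := by
          rw [← lintegral_indicator Φ.measurableSet_dom]
          refine lintegral_congr_ae ?_
          filter_upwards [coeFn_chi_mul Φ.measurableSet_dom f] with x h5
          rw [h5]
          by_cases hx : x ∈ Φ.dom <;> simp [hx, hpr]

theorem exists_isChiPair_of_mem_SPIso [Fact (1 ≤ p)] {T : Lp 𝕜 p μ →L[𝕜] Lp 𝕜 p μ}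
    (hT : T ∈ SPIso 𝕜 p μ) : ∃ S D D', IsChiPair T S D D' := by
  obtain ⟨Φ, V, h, ω, hV, hh, hω, hω1, hTf⟩ := hT
  obtain rfl := hV.eq_compOp
  have hp : 1 ≤ p := Fact.out
  have hp0 : p ≠ 0 := (zero_lt_one.trans_le hp).ne'
  have hr : Measurable fun x => ((h x : ℝ) ^ (1 / p.toReal) : ℝ) :=
    hh.measurable.coe_nnreal_real.pow_const _
  have ham : Measurable fun x => ω x * (((h x : ℝ) ^ (1 / p.toReal) : ℝ) : 𝕜) :=
    hω.mul (RCLike.measurable_ofReal.comp hr)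
  let a : Ω →ₘ[μ] 𝕜 := AEEqFun.mk _ ham.aestronglyMeasurable
  -- The inverse weight: only its values on `cod` matter, where a is almost everywhere non-zero.
  let b : Ω →ₘ[μ] 𝕜 := AEEqFun.mk _ ham.inv.aestronglyMeasurable
  have ha : ∀ᵐ x ∂μ, a x = ω x * (((h x : ℝ) ^ (1 / p.toReal) : ℝ) : 𝕜) := AEEqFun.coeFn_mk _ _
  have hb : ∀ᵐ x ∂μ, b x = (ω x * (((h x : ℝ) ^ (1 / p.toReal) : ℝ) : 𝕜))⁻¹ :=
    AEEqFun.coeFn_mk _ _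
  have han : ∀ᵐ x ∂μ, x ∈ Φ.cod → ‖a x‖ = (h x : ℝ) ^ (1 / p.toReal) := by
    filter_upwards [ha] with x hx hxc
    rw [hx, norm_mul, hω1 x hxc, one_mul, RCLike.norm_ofReal, abs_of_nonneg (by positivity)]
  have hab : ∀ f : Ω →ₘ[μ] 𝕜, chi μ 𝕜 Φ.cod * (a * b * f) = chi μ 𝕜 Φ.cod * f := by
    intro f
    have h1 : chi μ 𝕜 Φ.cod * (a * b - 1) = 0 := by
      rw [chi_mul_eq_zero_iff Φ.measurableSet_cod]
      filter_upwards [ha, hb, coeFn_mul_apply a b, coeFn_sub_apply (a * b) 1,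
        coeFn_one_apply (μ := μ) (𝕜 := 𝕜), hh.ae_ne_zero] with x h1 h2 h3 h4 h5 h6 hx
      rw [h4, h3, h5, h1, h2, mul_inv_cancel₀, sub_self]
      refine mul_ne_zero (norm_ne_zero_iff.1 (by rw [hω1 x hx]; exact one_ne_zero)) ?_
      have h7 : (0 : ℝ) < h x := by exact_mod_cast pos_iff_ne_zero.2 (h6 hx)
      exact RCLike.ofReal_ne_zero.2 (Real.rpow_pos_of_pos h7 _).ne'
    linear_combination f * h1
  have hTV : ∀ f : Lp 𝕜 p μ, (T f : Ω →ₘ[μ] 𝕜) = a * compOp 𝕜 Φ f := by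
    intro f
    apply AEEqFun.ext
    filter_upwards [hTf f, ha, coeFn_mul_apply a (compOp 𝕜 Φ f)] with x h1 h2 h3
    rw [h3, h2, h1]
  have hnorm : ∀ f : Ω →ₘ[μ] 𝕜, _ := eLpNorm_mul_compOp hp hh han
  have hS0 : ∀ f : Ω →ₘ[μ] 𝕜, a * compOp 𝕜 Φ (compOp 𝕜 Φ.symm (b * f)) = chi μ 𝕜 Φ.cod * f := by
    intro f
    rw [compOp_compOp_symm, ← hab f]
    ring
  -- The norm of the inverse needs no second change of variables: a function supported in `dom` has
  -- the same norm as its image under T, and here that image is known.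
  have hSn : ∀ f : Ω →ₘ[μ] 𝕜, eLpNorm (compOp 𝕜 Φ.symm (b * f)) p μ =
      eLpNorm (chi μ 𝕜 Φ.cod * f : Ω →ₘ[μ] 𝕜) p μ := by
    intro f
    rw [← hS0 f, hnorm, ← Φ.symm_cod, chi_cod_mul_compOp]
  have hmem : ∀ f : Lp 𝕜 p μ, compOp 𝕜 Φ.symm (b * f) ∈ Lp 𝕜 p μ := by
    intro f
    rw [Lp.mem_Lp_iff_eLpNorm_lt_top, hSn]
    exact (chiOp p μ 𝕜 Φ.measurableSet_cod f).2
  let S : Lp 𝕜 p μ →L[𝕜] Lp 𝕜 p μ := LinearMap.mkContinuous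
    { toFun := fun f => ⟨compOp 𝕜 Φ.symm (b * f), hmem f⟩
      map_add' := fun f g => Subtype.ext (by
        change compOp 𝕜 Φ.symm (b * (f + g)) = compOp 𝕜 Φ.symm (b * f) + compOp 𝕜 Φ.symm (b * g)
        rw [mul_add, map_add])
      map_smul' := fun c f => Subtype.ext (by
        change compOp 𝕜 Φ.symm (b * (c • (f : Ω →ₘ[μ] 𝕜))) = c • compOp 𝕜 Φ.symm (b * f)
        rw [mul_smul_aeeqFun, map_smul]) } 1 (fun f => by
      rw [one_mul]
      refine le_trans (le_of_eq ?_) (norm_chiOp_apply_le Φ.measurableSet_cod f)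
      rw [Lp.norm_def, Lp.norm_def]
      exact congrArg ENNReal.toReal (hSn f))
  have hSf : ∀ f : Lp 𝕜 p μ, (S f : Ω →ₘ[μ] 𝕜) = compOp 𝕜 Φ.symm (b * f) := fun f => rfl
  have hTS : ∀ f, (T (S f) : Ω →ₘ[μ] 𝕜) = chi μ 𝕜 Φ.cod * f := fun f => by
    rw [hTV, hSf, hS0]
  have hST : ∀ f, (S (T f) : Ω →ₘ[μ] 𝕜) = chi μ 𝕜 Φ.dom * f := fun f => by
    rw [hSf, hTV, ← compOp_symm_compOp Φ (f : Ω →ₘ[μ] 𝕜)]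
    congr 1
    linear_combination hab (compOp 𝕜 Φ f) - (a * b - 1) * chi_cod_mul_compOp Φ (f : Ω →ₘ[μ] 𝕜)
  refine ⟨S, Φ.cod, Φ.dom, Φ.measurableSet_cod, Φ.measurableSet_dom, ?_, ?_, hTS, hST, ?_, ?_⟩
  · refine T.opNorm_le_bound zero_le_one fun f => ?_
    rw [one_mul]
    refine le_trans (le_of_eq ?_) (norm_chiOp_apply_le Φ.measurableSet_dom f)
    rw [Lp.norm_def, Lp.norm_def, hTV]
    exact congrArg ENNReal.toReal (hnorm f)
  · exact LinearMap.mkContinuous_norm_le _ zero_le_one _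
  · ext1 f
    apply Subtype.ext
    change (T f : Ω →ₘ[μ] 𝕜) = T (S (T f))
    rw [hTS, hTV, mul_left_comm, chi_cod_mul_compOp]
  · ext1 f
    apply Subtype.ext
    change (S f : Ω →ₘ[μ] 𝕜) = S (T (S f))
    rw [hST, hSf, ← Φ.symm_cod, chi_cod_mul_compOp]

end Spatial

/-! ### Clarkson's inequalities with their equality case -/

section Clarkson

variable {𝕜 : Type*} [RCLike 𝕜]

/-- Write x^s = x · x^(s-1), where the second factor is strictly decreasing. -/
theorem add_rpow_lt_rpow_add_rpow {a b s : ℝ} (ha : 0 < a) (hb : 0 < b) (hs : s < 1) :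
    (a + b) ^ s < a ^ s + b ^ s := by
  have key : ∀ x : ℝ, 0 < x → x ^ s = x * x ^ (s - 1) := fun x hx => by
    rw [Real.rpow_sub_one hx.ne']; field_simp
  have h1 : (a + b) ^ (s - 1) < a ^ (s - 1) :=
    Real.rpow_lt_rpow_of_neg ha (by linarith) (by linarith)
  have h2 : (a + b) ^ (s - 1) < b ^ (s - 1) :=
    Real.rpow_lt_rpow_of_neg hb (by linarith) (by linarith)
  rw [key _ (add_pos ha hb), key a ha, key b hb, add_mul]
  exact add_lt_add (mul_lt_mul_of_pos_left h1 ha) (mul_lt_mul_of_pos_left h2 hb)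

theorem rpow_add_rpow_lt_add_rpow {a b s : ℝ} (ha : 0 < a) (hb : 0 < b) (hs : 1 < s) :
    a ^ s + b ^ s < (a + b) ^ s := by
  have key : ∀ x : ℝ, 0 < x → x ^ s = x * x ^ (s - 1) := fun x hx => by
    rw [Real.rpow_sub_one hx.ne']; field_simp
  have h1 : a ^ (s - 1) < (a + b) ^ (s - 1) :=
    Real.rpow_lt_rpow ha.le (by linarith) (by linarith)
  have h2 : b ^ (s - 1) < (a + b) ^ (s - 1) :=
    Real.rpow_lt_rpow hb.le (by linarith) (by linarith)
  rw [key _ (add_pos ha hb), key a ha, key b hb, add_mul]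
  exact add_lt_add (mul_lt_mul_of_pos_left h1 ha) (mul_lt_mul_of_pos_left h2 hb)

theorem norm_add_sq_add_norm_sub_sq (z w : 𝕜) :
    ‖z + w‖ ^ 2 + ‖z - w‖ ^ 2 = 2 * (‖z‖ ^ 2 + ‖w‖ ^ 2) := by
  have := parallelogram_law_with_norm_mul 𝕜 z w
  linarith

theorem norm_rpow_eq_sq_rpow (z : 𝕜) (r : ℝ) : ‖z‖ ^ r = (‖z‖ ^ 2) ^ (r / 2) := by
  rw [← Real.rpow_natCast, ← Real.rpow_mul (norm_nonneg z)]
  congr 1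
  push_cast
  ring

theorem clarkson_of_zero {r : ℝ} (hr : 0 < r) {z w : 𝕜} (h : z = 0 ∨ w = 0) :
    ‖z + w‖ ^ r + ‖z - w‖ ^ r = 2 * (‖z‖ ^ r + ‖w‖ ^ r) := by
  rcases h with rfl | rfl
  · simp [Real.zero_rpow hr.ne']; ring
  · simp [Real.zero_rpow hr.ne']; ring

/-- Concavity of t ↦ t^(r/2) and the parallelogram law bound the left side by 2(|z|² + |w|²)^(r/2).
Strict subadditivity of the same power does the rest. -/
theorem clarkson_lt {r : ℝ} (hr : 0 < r) (hr2 : r < 2) {z w : 𝕜} (hz : z ≠ 0) (hw : w ≠ 0) :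
    ‖z + w‖ ^ r + ‖z - w‖ ^ r < 2 * (‖z‖ ^ r + ‖w‖ ^ r) := by
  have hc := (Real.concaveOn_rpow (p := r / 2) (by linarith) (by linarith)).2
    (Set.mem_Ici.2 (sq_nonneg ‖z + w‖)) (Set.mem_Ici.2 (sq_nonneg ‖z - w‖))
    (by norm_num : (0 : ℝ) ≤ 1 / 2) (by norm_num : (0 : ℝ) ≤ 1 / 2) (by norm_num)
  simp only [smul_eq_mul] at hc
  have h1 := norm_add_sq_add_norm_sub_sq z w
  rw [show 1 / 2 * ‖z + w‖ ^ 2 + 1 / 2 * ‖z - w‖ ^ 2 = ‖z‖ ^ 2 + ‖w‖ ^ 2 by linarith] at hc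
  have h2 := add_rpow_lt_rpow_add_rpow (s := r / 2) (pow_pos (norm_pos_iff.2 hz) 2)
    (pow_pos (norm_pos_iff.2 hw) 2) (by linarith)
  simp only [norm_rpow_eq_sq_rpow _ r]
  linarith

theorem lt_clarkson {r : ℝ} (hr2 : 2 < r) {z w : 𝕜} (hz : z ≠ 0) (hw : w ≠ 0) :
    2 * (‖z‖ ^ r + ‖w‖ ^ r) < ‖z + w‖ ^ r + ‖z - w‖ ^ r := by
  have hc := (convexOn_rpow (p := r / 2) (by linarith)).2
    (Set.mem_Ici.2 (sq_nonneg ‖z + w‖)) (Set.mem_Ici.2 (sq_nonneg ‖z - w‖))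
    (by norm_num : (0 : ℝ) ≤ 1 / 2) (by norm_num : (0 : ℝ) ≤ 1 / 2) (by norm_num)
  simp only [smul_eq_mul] at hc
  have h1 := norm_add_sq_add_norm_sub_sq z w
  rw [show 1 / 2 * ‖z + w‖ ^ 2 + 1 / 2 * ‖z - w‖ ^ 2 = ‖z‖ ^ 2 + ‖w‖ ^ 2 by linarith] at hc
  have h2 := rpow_add_rpow_lt_add_rpow (s := r / 2) (pow_pos (norm_pos_iff.2 hz) 2)
    (pow_pos (norm_pos_iff.2 hw) 2) (by linarith)
  simp only [norm_rpow_eq_sq_rpow _ r]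
  linarith

variable {Ω : Type*} [MeasurableSpace Ω] {μ : Measure Ω} {p : ℝ≥0∞}

theorem norm_rpow_eq_integral [Fact (1 ≤ p)] (hpt : p ≠ ∞) (f : Lp 𝕜 p μ) :
    ‖f‖ ^ p.toReal = ∫ x, ‖f x‖ ^ p.toReal ∂μ := by
  have hp0 : p ≠ 0 := (zero_lt_one.trans_le (Fact.out : 1 ≤ p)).ne'
  have hpr : 0 < p.toReal := ENNReal.toReal_pos hp0 hpt
  have hi : 0 ≤ ∫ x, ‖f x‖ ^ p.toReal ∂μ := integral_nonneg fun x => by positivity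
  rw [Lp.norm_def, (Lp.memLp f).eLpNorm_eq_integral_rpow_norm hp0 hpt,
    ENNReal.toReal_ofReal (by positivity), ← Real.rpow_mul hi, inv_mul_cancel₀ hpr.ne',
    Real.rpow_one]

/-- Disjointness in `L^p` is characterised by the norm. -/
theorem mul_eq_zero_iff_norm [Fact (1 ≤ p)] (hp2 : p ≠ 2) (hpt : p ≠ ∞) (f g : Lp 𝕜 p μ) :
    (f : Ω →ₘ[μ] 𝕜) * g = 0 ↔ ‖f + g‖ ^ p.toReal + ‖f - g‖ ^ p.toReal =
      2 * (‖f‖ ^ p.toReal + ‖g‖ ^ p.toReal) := by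
  have hp0 : p ≠ 0 := (zero_lt_one.trans_le (Fact.out : 1 ≤ p)).ne'
  have hpr : 0 < p.toReal := ENNReal.toReal_pos hp0 hpt
  have hpr2 : p.toReal ≠ 2 := fun h => hp2 (by
    rw [← ENNReal.ofReal_toReal hpt, h]; norm_num)
  have hi : ∀ f : Lp 𝕜 p μ, Integrable (fun x => ‖f x‖ ^ p.toReal) μ := fun f =>
    (Lp.memLp f).integrable_norm_rpow hp0 hpt
  -- The pointwise defect in Clarkson's inequality has constant sign for p ≠ 2 and vanishes only if
  -- one argument does. Hence its integral vanishes exactly when f and g are disjoint.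
  let F : 𝕜 → 𝕜 → ℝ := fun z w =>
    2 * (‖z‖ ^ p.toReal + ‖w‖ ^ p.toReal) - (‖z + w‖ ^ p.toReal + ‖z - w‖ ^ p.toReal)
  have hFz : ∀ z w : 𝕜, z = 0 ∨ w = 0 → F z w = 0 := fun z w h =>
    sub_eq_zero.2 (clarkson_of_zero hpr h).symm
  have hae : (fun x => 2 * (‖f x‖ ^ p.toReal + ‖g x‖ ^ p.toReal) -
      (‖(f + g) x‖ ^ p.toReal + ‖(f - g) x‖ ^ p.toReal)) =ᵐ[μ] fun x => F (f x) (g x) := by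
    filter_upwards [Lp.coeFn_add f g, Lp.coeFn_sub f g] with x h1 h2
    rw [h1, h2]; rfl
  have h_int : Integrable (fun x => 2 * (‖f x‖ ^ p.toReal + ‖g x‖ ^ p.toReal) -
      (‖(f + g) x‖ ^ p.toReal + ‖(f - g) x‖ ^ p.toReal)) μ :=
    (((hi f).add (hi g)).const_mul 2).sub ((hi (f + g)).add (hi (f - g)))
  have hFi : Integrable (fun x => F (f x) (g x)) μ := h_int.congr hae
  have hF : 2 * (‖f‖ ^ p.toReal + ‖g‖ ^ p.toReal) - (‖f + g‖ ^ p.toReal + ‖f - g‖ ^ p.toReal) =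
      ∫ x, F (f x) (g x) ∂μ := by
    rw [← integral_congr_ae hae, integral_sub, integral_const_mul, integral_add (hi f) (hi g),
      integral_add (hi _) (hi _)]
    · simp only [norm_rpow_eq_integral hpt]
    · exact ((hi f).add (hi g)).const_mul 2
    · exact (hi (f + g)).add (hi (f - g))
  rw [mul_eq_zero_iff_ae]
  constructor
  · intro h
    have h0 : ∫ x, F (f x) (g x) ∂μ = 0 := by
      rw [integral_congr_ae (g := fun _ => (0 : ℝ))]
      · simp
      · filter_upwards [h] with x hx using hFz _ _ hx
    linarith
  · intro h
    have h0 : ∫ x, F (f x) (g x) ∂μ = 0 := by linarith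
    have hFne : ∀ z w : 𝕜, F z w = 0 → z = 0 ∨ w = 0 := by
      intro z w hzw
      by_contra hne
      push Not at hne
      rcases lt_or_gt_of_ne hpr2 with hlt | hgt
      · have := clarkson_lt hpr hlt hne.1 hne.2
        exact absurd hzw (sub_pos.2 this).ne'
      · have := lt_clarkson hgt hne.1 hne.2
        exact absurd hzw (sub_neg.2 this).ne
    have hzero : ∀ᵐ x ∂μ, F (f x) (g x) = 0 := by
      rcases lt_or_gt_of_ne hpr2 with hlt | hgt
      · have hnn : ∀ z w : 𝕜, 0 ≤ F z w := by
          intro z w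
          by_cases hz : z = 0 ∨ w = 0
          · exact (hFz z w hz).ge
          · push Not at hz
            exact (sub_pos.2 (clarkson_lt hpr hlt hz.1 hz.2)).le
        exact (integral_eq_zero_iff_of_nonneg (fun x => hnn _ _) hFi).1 h0
      · have hnn : ∀ z w : 𝕜, F z w ≤ 0 := by
          intro z w
          by_cases hz : z = 0 ∨ w = 0
          · exact (hFz z w hz).le
          · push Not at hz
            exact (sub_neg.2 (lt_clarkson hgt hz.1 hz.2)).le
        have h1 : ∫ x, -F (f x) (g x) ∂μ = 0 := by rw [integral_neg, h0, neg_zero]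
        have h2 := (integral_eq_zero_iff_of_nonneg
          (fun x => neg_nonneg.2 (hnn (f x) (g x))) hFi.neg).1 h1
        filter_upwards [h2] with x hx
        exact neg_eq_zero.1 hx
    filter_upwards [hzero] with x hx using hFne _ _ hx

end Clarkson

/-! ### Elementary facts on scalars of modulus one -/

section Scalars

variable {𝕜 : Type*} [RCLike 𝕜]

theorem eq_of_norm_add_eq_two {a b : 𝕜} (ha : ‖a‖ ≤ 1) (hb : ‖b‖ ≤ 1) (h : ‖a + b‖ = 2) :
    a = b := by
  have h1 := norm_add_sq_add_norm_sub_sq a b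
  have h2 : ‖a - b‖ ^ 2 ≤ 0 := by
    rw [h] at h1
    nlinarith [norm_nonneg a, norm_nonneg b]
  have h3 : ‖a - b‖ = 0 := by
    have := sq_nonneg ‖a - b‖
    exact pow_eq_zero_iff (two_ne_zero) |>.1 (le_antisymm h2 this)
  exact sub_eq_zero.1 (norm_eq_zero.1 h3)

theorem eq_zero_of_norm_add_le_of_norm_sub_le {x y : 𝕜} (h1 : ‖x + y‖ ≤ ‖y‖)
    (h2 : ‖x - y‖ ≤ ‖y‖) : x = 0 := by
  have h3 := norm_add_sq_add_norm_sub_sq x y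
  have h4 : ‖x + y‖ ^ 2 ≤ ‖y‖ ^ 2 := pow_le_pow_left₀ (norm_nonneg _) h1 2
  have h5 : ‖x - y‖ ^ 2 ≤ ‖y‖ ^ 2 := pow_le_pow_left₀ (norm_nonneg _) h2 2
  have h6 : ‖x‖ ^ 2 ≤ 0 := by linarith
  exact norm_eq_zero.1 (pow_eq_zero_iff two_ne_zero |>.1 (le_antisymm h6 (sq_nonneg _)))

/-- The hypotheses have the shape in which the L^∞ arguments supply them: t and w are the values of
two complementary functions with unimodular sum. -/
theorem eq_zero_of_norm_add_unimodular_le {q w t : 𝕜} {c : ℝ} (ht : t = 0) (hw : ‖t + w‖ = 1)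
    (hc : 0 ≤ c) (h1 : ‖q + 1 * c * w‖ ≤ c) (h2 : ‖q + -1 * c * w‖ ≤ c) : q = 0 := by
  rw [ht, zero_add] at hw
  have hn : ‖(c : 𝕜) * w‖ = c := by
    rw [norm_mul, hw, RCLike.norm_ofReal, abs_of_nonneg hc, mul_one]
  refine eq_zero_of_norm_add_le_of_norm_sub_le (y := (c : 𝕜) * w) ?_ ?_
  · rw [hn]; convert h1 using 2; ring
  · rw [hn]; convert h2 using 2; ring

/-- The first two conditions annihilate the real part of b·ā and the third its imaginary part. The
guard on `RCLike.I` lets one statement serve both fields, since the imaginary part is absent over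
the reals. -/
theorem eq_zero_or_eq_zero_of_norm_add_eq_one {a b : 𝕜} (h1 : ‖a + b‖ = 1) (h2 : ‖a - b‖ = 1)
    (h3 : (RCLike.I : 𝕜) ≠ 0 → ‖a + RCLike.I * b‖ = 1) : a = 0 ∨ b = 0 := by
  have hre : ∀ c : 𝕜, ‖a + c‖ ^ 2 = ‖a‖ ^ 2 + 2 * RCLike.re (c * star a) + ‖c‖ ^ 2 := fun c => by
    have := norm_add_sq (𝕜 := 𝕜) a c
    simpa [RCLike.inner_apply] using this
  have e1 := hre b
  have e2 := hre (-b)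
  rw [← sub_eq_add_neg, norm_neg, neg_mul, map_neg] at e2
  rw [h1] at e1
  rw [h2] at e2
  have hr : RCLike.re (b * star a) = 0 := by linarith
  have hi : RCLike.im (b * star a) = 0 := by
    by_cases hI : (RCLike.I : 𝕜) = 0
    · have := RCLike.re_add_im (b * star a)
      have h4 : b * star a = ((RCLike.re (b * star a) : ℝ) : 𝕜) := by
        rw [← this, hI]; simp
      rw [h4, RCLike.ofReal_im]
    · have e3 := hre (RCLike.I * b)
      have hn : ‖(RCLike.I : 𝕜)‖ = 1 := RCLike.norm_I_of_ne_zero hI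
      rw [h3 hI, norm_mul, hn, one_mul, mul_assoc, RCLike.I_mul_re] at e3
      linarith
  have h0 : b * star a = 0 := by
    rw [← RCLike.re_add_im (b * star a), hr, hi]; simp
  rcases mul_eq_zero.1 h0 with h | h
  · exact Or.inr h
  · exact Or.inl (star_eq_zero.1 h)

end Scalars

/-! ### Isometries preserve disjointness -/

section Disjointness

variable {Ω : Type*} [MeasurableSpace Ω] {μ : Measure Ω} {𝕜 : Type*} [RCLike 𝕜] {p : ℝ≥0∞}

/-! ### Norm identities for pairs, and disjointness for finite exponents -/

section Basic

variable [Fact (1 ≤ p)] {T S : Lp 𝕜 p μ →L[𝕜] Lp 𝕜 p μ} {D D' : Set Ω}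

theorem IsChiPair.symm (h : IsChiPair T S D D') : IsChiPair S T D' D :=
  ⟨h.measurableSet_right, h.measurableSet_left, h.norm_right, h.norm_left, h.right_left,
    h.left_right, h.isGenInverse.2, h.isGenInverse.1⟩

theorem IsChiPair.map_map_map (h : IsChiPair T S D D') (f : Lp 𝕜 p μ) : T (S (T f)) = T f :=
  (DFunLike.congr_fun h.isGenInverse.1 f).symm

theorem IsChiPair.chi_mul_map (h : IsChiPair T S D D') (f : Lp 𝕜 p μ) :
    chi μ 𝕜 D * (T f : Ω →ₘ[μ] 𝕜) = T f := by
  rw [← h.left_right, h.map_map_map]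

theorem norm_apply_le_of_norm_le_one (hT : ‖T‖ ≤ 1) (f : Lp 𝕜 p μ) : ‖T f‖ ≤ ‖f‖ :=
  (T.le_of_opNorm_le hT f).trans_eq (one_mul _)

/-- S is isometric on the range of T, because T brings S(T f) back to T f and both are contractions.
-/
theorem IsChiPair.norm_map_map (h : IsChiPair T S D D') (f : Lp 𝕜 p μ) : ‖S (T f)‖ = ‖T f‖ := by
  refine le_antisymm (norm_apply_le_of_norm_le_one h.norm_right _) ?_
  conv_lhs => rw [← h.map_map_map f]
  exact norm_apply_le_of_norm_le_one h.norm_left _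

theorem IsChiPair.map_eq_zero (h : IsChiPair T S D D') {f : Lp 𝕜 p μ}
    (hf : chi μ 𝕜 D' * (f : Ω →ₘ[μ] 𝕜) = f) (h0 : T f = 0) : f = 0 := by
  apply Subtype.ext
  rw [← hf, ← h.right_left, h0, map_zero]

/-- The functions S(T f) and S(T g) are restrictions of f and g, hence disjoint. The norm criterion
passes this to T f and T g, as S preserves all norms involved. -/
theorem IsChiPair.map_mul_map_of_ne_top (h : IsChiPair T S D D') (hp2 : p ≠ 2) (hpt : p ≠ ∞)
    {f g : Lp 𝕜 p μ} (hfg : (f : Ω →ₘ[μ] 𝕜) * g = 0) : (T f : Ω →ₘ[μ] 𝕜) * T g = 0 := by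
  have h1 : (S (T f) : Ω →ₘ[μ] 𝕜) * S (T g) = 0 := by
    rw [h.right_left, h.right_left]
    linear_combination chi μ 𝕜 D' * chi μ 𝕜 D' * hfg
  rw [mul_eq_zero_iff_norm hp2 hpt] at h1 ⊢
  rwa [← map_add, ← map_add, ← map_sub, ← map_sub, h.norm_map_map, h.norm_map_map, h.norm_map_map,
    h.norm_map_map, map_add, map_sub] at h1

end Basic

/-! ### Disjointness for p = ∞ -/

section Top

theorem ae_norm_le_norm (f : Lp 𝕜 ∞ μ) : ∀ᵐ x ∂μ, ‖f x‖ ≤ ‖f‖ := by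
  filter_upwards [ae_le_eLpNormEssSup (f := f) (μ := μ)] with x hx
  have h1 : eLpNormEssSup f μ = ENNReal.ofReal ‖f‖ := by
    rw [Lp.norm_def, ENNReal.ofReal_toReal (Lp.eLpNorm_ne_top f), eLpNorm_exponent_top]
  rw [h1, ← ofReal_norm, ENNReal.ofReal_le_ofReal_iff (norm_nonneg f)] at hx
  exact hx

theorem norm_le_of_ae_norm_le {f : Lp 𝕜 ∞ μ} {C : ℝ} (hC : 0 ≤ C) (h : ∀ᵐ x ∂μ, ‖f x‖ ≤ C) :
    ‖f‖ ≤ C := by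
  rw [Lp.norm_def, eLpNorm_exponent_top]
  exact ENNReal.toReal_le_of_le_ofReal hC (eLpNormEssSup_le_of_ae_bound h)

/-- An essentially bounded function as an element of `L^∞`. -/
def toLinf (k : Ω →ₘ[μ] 𝕜) {C : ℝ} (hk : ∀ᵐ x ∂μ, ‖k x‖ ≤ C) : Lp 𝕜 ∞ μ :=
  ⟨k, Lp.mem_Lp_iff_memLp.2 (memLp_top_of_bound k.aestronglyMeasurable C hk)⟩

theorem coe_toLinf (k : Ω →ₘ[μ] 𝕜) {C : ℝ} (hk : ∀ᵐ x ∂μ, ‖k x‖ ≤ C) :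
    (toLinf k hk : Ω →ₘ[μ] 𝕜) = k := rfl

variable {T S : Lp 𝕜 ∞ μ →L[𝕜] Lp 𝕜 ∞ μ} {D D' : Set Ω}

/-- Surjective isometries map unimodular functions to unimodular functions. -/
theorem IsChiPair.norm_map_eq_one (h : IsChiPair T S D D') {f : Lp 𝕜 ∞ μ} (hf : ‖f‖ ≤ 1)
    (hf1 : ∀ᵐ x ∂μ, x ∈ D' → ‖f x‖ = 1) : ∀ᵐ x ∂μ, x ∈ D → ‖T f x‖ = 1 := by
  have hTf : ‖T f‖ ≤ 1 := (norm_apply_le_of_norm_le_one h.norm_left f).trans hf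
  have hTfx : ∀ᵐ x ∂μ, ‖T f x‖ ≤ 1 := (ae_norm_le_norm (T f)).mono fun x hx => hx.trans hTf
  have hkm : Measurable fun x => (((1 - ‖T f x‖ : ℝ)) : 𝕜) :=
    RCLike.measurable_ofReal.comp (measurable_const.sub (Lp.stronglyMeasurable (T f)).measurable.norm)
  -- With k = 1 - |T f|, both T f + k and T f - k stay in the unit ball. After applying S,
  -- unimodularity of f on D' forces S k = 0, because unimodular scalars are extreme points of the
  -- disc; hence k vanishes on D.
  let k0 : Ω →ₘ[μ] 𝕜 := AEEqFun.mk _ hkm.aestronglyMeasurable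
  have hk0 : ∀ᵐ x ∂μ, k0 x = (((1 - ‖T f x‖ : ℝ)) : 𝕜) := AEEqFun.coeFn_mk _ _
  have hkn : ∀ᵐ x ∂μ, ‖k0 x‖ = 1 - ‖T f x‖ := by
    filter_upwards [hk0, hTfx] with x h1 h2
    rw [h1, RCLike.norm_ofReal, abs_of_nonneg (by linarith)]
  have hkb : ∀ᵐ x ∂μ, ‖k0 x‖ ≤ 1 := by
    filter_upwards [hkn] with x hx
    rw [hx]; linarith [norm_nonneg (T f x)]
  let k : Lp 𝕜 ∞ μ := toLinf k0 hkb
  have hadd : ‖T f + k‖ ≤ 1 := by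
    refine norm_le_of_ae_norm_le zero_le_one ?_
    filter_upwards [Lp.coeFn_add (T f) k, hkn] with x h1 h2
    rw [h1]
    refine (norm_add_le _ _).trans ?_
    change ‖T f x‖ + ‖k0 x‖ ≤ 1
    rw [h2]; linarith
  have hsub : ‖T f - k‖ ≤ 1 := by
    refine norm_le_of_ae_norm_le zero_le_one ?_
    filter_upwards [Lp.coeFn_sub (T f) k, hkn] with x h1 h2
    rw [h1]
    refine (norm_sub_le _ _).trans ?_
    change ‖T f x‖ + ‖k0 x‖ ≤ 1
    rw [h2]; linarith
  have hSadd := (norm_apply_le_of_norm_le_one h.norm_right (T f + k)).trans hadd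
  have hSsub := (norm_apply_le_of_norm_le_one h.norm_right (T f - k)).trans hsub
  rw [map_add] at hSadd
  rw [map_sub] at hSsub
  have hSk : (S k : Ω →ₘ[μ] 𝕜) = 0 := by
    rw [← h.symm.chi_mul_map k, chi_mul_eq_zero_iff h.measurableSet_right]
    have hSTf : ∀ᵐ x ∂μ, x ∈ D' → S (T f) x = f x := by
      filter_upwards [coeFn_chi_mul h.measurableSet_right (f : Ω →ₘ[μ] 𝕜)] with x hx hxD
      rw [h.right_left, hx, Set.indicator_of_mem hxD]
    filter_upwards [ae_norm_le_norm (S (T f) + S k), ae_norm_le_norm (S (T f) - S k),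
      Lp.coeFn_add (S (T f)) (S k), Lp.coeFn_sub (S (T f)) (S k), hf1, hSTf]
      with x h1 h2 h3 h4 h5 h6 hx
    rw [h3] at h1
    rw [h4] at h2
    have h7 : ‖((S (T f) : Ω → 𝕜) + (S k : Ω → 𝕜)) x + ((S (T f) : Ω → 𝕜) - (S k : Ω → 𝕜)) x‖ = 2 := by
      have e : ((S (T f) : Ω → 𝕜) + (S k : Ω → 𝕜)) x + ((S (T f) : Ω → 𝕜) - (S k : Ω → 𝕜)) x =
          2 * f x := by
        simp only [Pi.add_apply, Pi.sub_apply, h6 hx]; ring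
      rw [e, norm_mul, h5 hx, RCLike.norm_ofNat, mul_one]
    have h8 := eq_of_norm_add_eq_two (h1.trans hSadd) (h2.trans hSsub) h7
    simp only [Pi.add_apply, Pi.sub_apply] at h8
    have h9 : (2 : 𝕜) * S k x = 0 := by linear_combination h8
    exact (mul_eq_zero.1 h9).resolve_left two_ne_zero
  have hk1 : chi μ 𝕜 D * k0 = 0 := by
    have h1 := h.left_right k
    have h2 : S k = 0 := Subtype.ext hSk
    rw [h2, map_zero, coe_toLinf] at h1
    exact h1.symm
  rw [chi_mul_eq_zero_iff h.measurableSet_left] at hk1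
  filter_upwards [hk1, hkn] with x h1 h2 hx
  rw [h1 hx, norm_zero] at h2
  linarith

/-- Let u and v be the indicators of the support of f and of its complement. Since u + cv is
unimodular for |c| = 1, so is T u + c T v on D, and c = ±1, i show that at each point one of T u, T
v vanishes and the other is unimodular. As f ± ‖f‖v has norm at most ‖f‖, T f vanishes where T v is
unimodular; likewise T g vanishes where T u is. -/
theorem IsChiPair.map_mul_map_top (h : IsChiPair T S D D') {f g : Lp 𝕜 ∞ μ}
    (hfg : (f : Ω →ₘ[μ] 𝕜) * g = 0) : (T f : Ω →ₘ[μ] 𝕜) * T g = 0 := by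
  set A := suppSet (f : Ω →ₘ[μ] 𝕜) with hA
  have hAm : MeasurableSet A := measurableSet_suppSet _
  let u : Lp 𝕜 ∞ μ := toLinf (chi μ 𝕜 A) (norm_chi_le hAm)
  let v : Lp 𝕜 ∞ μ := toLinf (chi μ 𝕜 Aᶜ) (norm_chi_le hAm.compl)
  have hu : ∀ᵐ x ∂μ, u x = A.indicator (fun _ => (1 : 𝕜)) x := coeFn_chi hAm
  have hv : ∀ᵐ x ∂μ, v x = Aᶜ.indicator (fun _ => (1 : 𝕜)) x := coeFn_chi hAm.compl
  have huni : ∀ c : 𝕜, ‖c‖ = 1 → ∀ᵐ x ∂μ, x ∈ D → ‖T u x + c * T v x‖ = 1 := by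
    intro c hc
    have h1 : ∀ᵐ x ∂μ, ‖(u + c • v) x‖ = 1 := by
      filter_upwards [hu, hv, Lp.coeFn_add u (c • v), Lp.coeFn_smul c v] with x h1 h2 h3 h4
      rw [h3, Pi.add_apply, h4, Pi.smul_apply, h1, h2]
      by_cases hx : x ∈ A <;> simp [hx, hc]
    have h2 := h.norm_map_eq_one
      (norm_le_of_ae_norm_le zero_le_one (h1.mono fun x hx => hx.le)) (h1.mono fun x hx _ => hx)
    rw [map_add, map_smul] at h2
    filter_upwards [h2, Lp.coeFn_add (T u) (c • T v), Lp.coeFn_smul c (T v)] with x h3 h4 h5 hx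
    have h6 := h3 hx
    rwa [h4, Pi.add_apply, h5, Pi.smul_apply, smul_eq_mul] at h6
  have hbound : ∀ (w q : Lp 𝕜 ∞ μ) (c : 𝕜), ‖c‖ = 1 →
      (∀ᵐ x ∂μ, (q x = 0 ∧ w x = 1) ∨ w x = 0) →
      ∀ᵐ x ∂μ, ‖T q x + c * ‖q‖ * T w x‖ ≤ ‖q‖ := by
    intro w q c hc hq
    have h1 : ‖q + (c * ‖q‖) • w‖ ≤ ‖q‖ := by
      refine norm_le_of_ae_norm_le (norm_nonneg _) ?_
      filter_upwards [hq, ae_norm_le_norm q, Lp.coeFn_add q ((c * ‖q‖) • w),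
        Lp.coeFn_smul (c * ‖q‖) w] with x h1 h2 h3 h4
      rw [h3, Pi.add_apply, h4, Pi.smul_apply]
      rcases h1 with ⟨h1, h5⟩ | h1
      · simp [h1, h5, norm_mul, hc]
      · simpa [h1] using h2
    have h2 := (norm_apply_le_of_norm_le_one h.norm_left _).trans h1
    rw [map_add, map_smul] at h2
    filter_upwards [ae_norm_le_norm (T q + (c * (‖q‖ : 𝕜)) • T w),
      Lp.coeFn_add (T q) ((c * (‖q‖ : 𝕜)) • T w), Lp.coeFn_smul (c * (‖q‖ : 𝕜)) (T w)]
      with x h3 h4 h5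
    rw [h4, Pi.add_apply, h5, Pi.smul_apply, smul_eq_mul] at h3
    exact h3.trans h2
  have hfv : ∀ᵐ x ∂μ, (f x = 0 ∧ v x = 1) ∨ v x = 0 := by
    filter_upwards [hv] with x hx
    by_cases hxA : x ∈ A
    · right; simp [hx, hxA]
    · left
      exact ⟨by simpa [hA, suppSet] using hxA, by simp [hx, hxA]⟩
  have hgu : ∀ᵐ x ∂μ, (g x = 0 ∧ u x = 1) ∨ u x = 0 := by
    filter_upwards [hu, mul_eq_zero_iff_ae.1 hfg] with x hx h0
    by_cases hxA : x ∈ A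
    · left
      exact ⟨h0.resolve_left hxA, by simp [hx, hxA]⟩
    · right; simp [hx, hxA]
  have hI : ∀ᵐ x ∂μ, x ∈ D → (RCLike.I : 𝕜) ≠ 0 → ‖T u x + RCLike.I * T v x‖ = 1 := by
    by_cases hI0 : (RCLike.I : 𝕜) = 0
    · exact Eventually.of_forall fun x _ h => absurd hI0 h
    · filter_upwards [huni RCLike.I (RCLike.norm_I_of_ne_zero hI0)] with x hx hxD _ using hx hxD
  rw [mul_eq_zero_iff_ae]
  filter_upwards [huni 1 norm_one, huni (-1) (by simp), hI,
    hbound v f 1 norm_one hfv, hbound v f (-1) (by simp) hfv,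
    hbound u g 1 norm_one hgu, hbound u g (-1) (by simp) hgu,
    (chi_mul_eq_self_iff h.measurableSet_left).1 (h.chi_mul_map f)]
    with x h1 h2 h3 h4 h5 h6 h7 h8
  by_cases hx : x ∈ D
  · have h1 := h1 hx
    have h2 := h2 hx
    rw [one_mul] at h1
    rcases eq_zero_or_eq_zero_of_norm_add_eq_one h1
      (by rw [sub_eq_add_neg, ← neg_one_mul]; exact h2) (h3 hx) with h0 | h0
    · left
      exact eq_zero_of_norm_add_unimodular_le h0 h1 (norm_nonneg f) h4 h5
    · right
      rw [add_comm] at h1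
      exact eq_zero_of_norm_add_unimodular_le h0 h1 (norm_nonneg g) h6 h7
  · exact Or.inl (h8 hx)

end Top

theorem IsChiPair.map_mul_map [Fact (1 ≤ p)] {T S : Lp 𝕜 p μ →L[𝕜] Lp 𝕜 p μ} {D D' : Set Ω}
    (h : IsChiPair T S D D') (hp2 : p ≠ 2) {f g : Lp 𝕜 p μ} (hfg : (f : Ω →ₘ[μ] 𝕜) * g = 0) :
    (T f : Ω →ₘ[μ] 𝕜) * T g = 0 := by
  by_cases hpt : p = ∞
  · subst hpt
    exact h.map_mul_map_top hfg
  · exact h.map_mul_map_of_ne_top hp2 hpt hfg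

end Disjointness

/-! ### The partial set automorphism of a disjointness preserving pair -/

section Automorphism

variable {Ω : Type*} [MeasurableSpace Ω] {μ : Measure Ω} {𝕜 : Type*} [RCLike 𝕜] {p : ℝ≥0∞}

theorem chi_mul_chi_compl_eq_zero_iff {A B : Set Ω} (hA : MeasurableSet A)
    (hB : MeasurableSet B) : chi μ 𝕜 A * chi μ 𝕜 Bᶜ = 0 ↔ μ (A \ B) = 0 := by
  rw [chi_mul_eq_zero_iff hA, measure_eq_zero_iff_ae_notMem]
  refine eventually_congr ?_
  filter_upwards [coeFn_chi (𝕜 := 𝕜) (μ := μ) hB.compl] with x hx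
  rw [hx]
  by_cases hxB : x ∈ B <;> by_cases hxA : x ∈ A <;> simp [hxA, hxB]

theorem chi_mul_chi_of_measure_diff {A B : Set Ω} (hA : MeasurableSet A) (hB : MeasurableSet B)
    (h : μ (A \ B) = 0) : chi μ 𝕜 B * chi μ 𝕜 A = chi μ 𝕜 A := by
  have h1 := (chi_mul_chi_compl_eq_zero_iff (𝕜 := 𝕜) hA hB).2 h
  rw [chi_compl hB] at h1
  linear_combination -h1

/-- By semi-finiteness a non-null set contains one of finite positive measure, whose indicator
belongs to L^p. -/
theorem measure_eq_zero_of_forall_chi_mul (𝕜 : Type*) [RCLike 𝕜] (p : ℝ≥0∞)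
    (hμ : IsLocalizable μ) {C : Set Ω} (hC : MeasurableSet C)
    (h : ∀ f : Lp 𝕜 p μ, chi μ 𝕜 C * (f : Ω →ₘ[μ] 𝕜) = 0) : μ C = 0 := by
  by_contra hne
  obtain ⟨B, hB, hBC, hBfin, hBpos⟩ := hμ.exists_lt_measure hC (pos_iff_ne_zero.2 hne)
  have h1 := (chi_mul_eq_zero_iff hC).1 (h (indicatorConstLp p hB hBfin.ne 1))
  refine hBpos.ne' (measure_eq_zero_iff_ae_notMem.2 ?_)
  filter_upwards [h1, indicatorConstLp_coeFn_mem (p := p) (hs := hB) (hμs := hBfin.ne)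
    (c := (1 : 𝕜))] with x h1 h2 hx
  exact one_ne_zero ((h2 hx).symm.trans (h1 (hBC hx)))

variable [Fact (1 ≤ p)] {T S : Lp 𝕜 p μ →L[𝕜] Lp 𝕜 p μ} {D D' : Set Ω}

theorem IsChiPair.map_congr (h : IsChiPair T S D D') {f g : Lp 𝕜 p μ}
    (hfg : chi μ 𝕜 D' * (f : Ω →ₘ[μ] 𝕜) = chi μ 𝕜 D' * g) : T f = T g := by
  rw [← h.map_map_map f, ← h.map_map_map g]
  congr 1
  apply Subtype.ext
  rw [h.right_left, h.right_left, hfg]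

/-- Essential suprema of supports. -/
theorem IsLocalizable.exists_support (hμ : IsLocalizable μ) (F : Set (Ω →ₘ[μ] 𝕜)) :
    ∃ E : Set Ω, MeasurableSet E ∧ (∀ f ∈ F, chi μ 𝕜 E * f = f) ∧
      ∀ g : Ω →ₘ[μ] 𝕜, (∀ f ∈ F, f * g = 0) → chi μ 𝕜 E * g = 0 := by
  obtain ⟨E, hE, h1, h2⟩ := hμ.exists_essSup (suppSet '' F)
    (by rintro _ ⟨f, -, rfl⟩; exact measurableSet_suppSet f)
  refine ⟨E, hE, fun f hf => (measure_suppSet_diff_eq_zero_iff hE).1 (h1 _ ⟨f, hf, rfl⟩),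
    fun g hg => ?_⟩
  -- The complement of the support of g is an essential upper bound of all supports in the family.
  have h3 := h2 (suppSet g)ᶜ (measurableSet_suppSet g).compl (by
    rintro _ ⟨f, hf, rfl⟩
    rw [measure_suppSet_diff_eq_zero_iff (measurableSet_suppSet g).compl,
      chi_compl (measurableSet_suppSet g)]
    have h4 : chi μ 𝕜 (suppSet g) * f = 0 := by
      rw [chi_mul_eq_zero_iff (measurableSet_suppSet g)]
      filter_upwards [mul_eq_zero_iff_ae.1 (hg f hf)] with x hx hxg
      exact hx.resolve_right hxg
    linear_combination -h4)
  rw [Set.sdiff_compl] at h3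
  rw [chi_mul_eq_zero_iff hE]
  filter_upwards [measure_eq_zero_iff_ae_notMem.1 h3] with x hx hxE
  by_contra hne
  exact hx ⟨hxE, hne⟩

/-- Minimality of the band is expressed by disjointness: whatever is disjoint from all the images is
disjoint from E. -/
theorem IsChiPair.exists_band (h : IsChiPair T S D D') (hμ : IsLocalizable μ) (A : Set Ω) :
    ∃ E : Set Ω, MeasurableSet E ∧ E ⊆ D ∧
      (∀ f : Lp 𝕜 p μ, chi μ 𝕜 A * (f : Ω →ₘ[μ] 𝕜) = f → chi μ 𝕜 E * (T f : Ω →ₘ[μ] 𝕜) = T f) ∧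
      ∀ g : Ω →ₘ[μ] 𝕜, (∀ f : Lp 𝕜 p μ, chi μ 𝕜 A * (f : Ω →ₘ[μ] 𝕜) = f →
        (T f : Ω →ₘ[μ] 𝕜) * g = 0) → chi μ 𝕜 E * g = 0 := by
  obtain ⟨E, hE, h1, h2⟩ := hμ.exists_support
    {k : Ω →ₘ[μ] 𝕜 | ∃ f : Lp 𝕜 p μ, chi μ 𝕜 A * (f : Ω →ₘ[μ] 𝕜) = f ∧ (T f : Ω →ₘ[μ] 𝕜) = k}
  refine ⟨E ∩ D, hE.inter h.measurableSet_left, Set.inter_subset_right, fun f hf => ?_,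
    fun g hg => ?_⟩
  · rw [← chi_mul_chi hE h.measurableSet_left, mul_assoc, h.chi_mul_map]
    exact h1 _ ⟨f, hf, rfl⟩
  · rw [← chi_mul_chi hE h.measurableSet_left]
    have h3 := h2 g (by rintro _ ⟨f, hf, rfl⟩; exact hg f hf)
    linear_combination chi μ 𝕜 D * h3

/-- The band generated by the image under `T` of the functions supported in `A`. -/
def IsChiPair.band (h : IsChiPair T S D D') (hμ : IsLocalizable μ) (A : Set Ω) : Set Ω :=
  (h.exists_band hμ A).choose

/-! ### Bands as a partial set automorphism -/

section Band

variable (h : IsChiPair T S D D') (hμ : IsLocalizable μ)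

theorem IsChiPair.measurableSet_band (A : Set Ω) : MeasurableSet (h.band hμ A) :=
  (h.exists_band hμ A).choose_spec.1

theorem IsChiPair.band_subset (A : Set Ω) : h.band hμ A ⊆ D :=
  (h.exists_band hμ A).choose_spec.2.1

theorem IsChiPair.chi_band_mul {A : Set Ω} {f : Lp 𝕜 p μ}
    (hf : chi μ 𝕜 A * (f : Ω →ₘ[μ] 𝕜) = f) :
    chi μ 𝕜 (h.band hμ A) * (T f : Ω →ₘ[μ] 𝕜) = T f :=
  (h.exists_band hμ A).choose_spec.2.2.1 f hf

theorem IsChiPair.chi_band_mul_eq_zero {A : Set Ω} {g : Ω →ₘ[μ] 𝕜}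
    (hg : ∀ f : Lp 𝕜 p μ, chi μ 𝕜 A * (f : Ω →ₘ[μ] 𝕜) = f → (T f : Ω →ₘ[μ] 𝕜) * g = 0) :
    chi μ 𝕜 (h.band hμ A) * g = 0 :=
  (h.exists_band hμ A).choose_spec.2.2.2 g hg

theorem IsChiPair.band_mono {A A' : Set Ω} (hA : MeasurableSet A) (hA' : MeasurableSet A')
    (hAA' : μ (A \ A') = 0) : μ (h.band hμ A \ h.band hμ A') = 0 := by
  rw [← chi_mul_chi_compl_eq_zero_iff (𝕜 := 𝕜) (h.measurableSet_band hμ A)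
    (h.measurableSet_band hμ A')]
  refine h.chi_band_mul_eq_zero hμ fun f hf => ?_
  have h1 : chi μ 𝕜 A' * (f : Ω →ₘ[μ] 𝕜) = f := by
    rw [← hf, ← mul_assoc, chi_mul_chi_of_measure_diff hA hA' hAA']
  have h2 := h.chi_band_mul hμ h1
  rw [chi_compl (h.measurableSet_band hμ A')]
  linear_combination -h2

/-- Split T f = y + z along the complement of B and B. Then S y is disjoint from S z and from the
band of B, while S y + S z is the restriction of f to D' and lies in that band. So S y is disjoint
from itself, and y = 0. -/
theorem IsChiPair.chi_mul_map_of_band (hp2 : p ≠ 2) {B : Set Ω} (hB : MeasurableSet B)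
    {f : Lp 𝕜 p μ} (hf : chi μ 𝕜 (h.symm.band hμ B) * (f : Ω →ₘ[μ] 𝕜) = f) :
    chi μ 𝕜 Bᶜ * (T f : Ω →ₘ[μ] 𝕜) = 0 := by
  let y : Lp 𝕜 p μ := chiOp p μ 𝕜 hB.compl (T f)
  let z : Lp 𝕜 p μ := chiOp p μ 𝕜 hB (T f)
  have hy : (y : Ω →ₘ[μ] 𝕜) = chi μ 𝕜 Bᶜ * T f := rfl
  have hz : (z : Ω →ₘ[μ] 𝕜) = chi μ 𝕜 B * T f := rfl
  have hBB : chi μ 𝕜 B * chi μ 𝕜 B = chi μ 𝕜 B := chi_mul_self hB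
  have hyz : T f = y + z := Subtype.ext (by
    rw [coe_add_Lp, hy, hz, chi_compl hB]; ring)
  have h1 : (S y : Ω →ₘ[μ] 𝕜) * S z = 0 := h.symm.map_mul_map hp2 (by
    rw [hy, hz, chi_compl hB]
    linear_combination -(T f : Ω →ₘ[μ] 𝕜) * T f * hBB)
  have h2 : chi μ 𝕜 (h.symm.band hμ B) * (S y : Ω →ₘ[μ] 𝕜) = 0 := by
    refine h.symm.chi_band_mul_eq_zero hμ fun g hg => h.symm.map_mul_map hp2 ?_
    rw [hy, ← hg, chi_compl hB]
    linear_combination -(g : Ω →ₘ[μ] 𝕜) * T f * hBB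
  have h3 : (S y : Ω →ₘ[μ] 𝕜) + S z = chi μ 𝕜 D' * f := by
    rw [← coe_add_Lp, ← map_add, ← hyz, h.right_left]
  have h4 : S y = 0 := Subtype.ext (eq_zero_of_mul_self_eq_zero (by
    rw [← hf] at h3
    linear_combination (S y : Ω →ₘ[μ] 𝕜) * h3 - h1 + chi μ 𝕜 D' * f * h2))
  have h5 : y = 0 := h.symm.map_eq_zero (by
    rw [hy, mul_left_comm, h.chi_mul_map]) h4
  rw [← hy, h5]
  rfl

/-- One inclusion is the preceding lemma. For the other, a function g supported in B ⊆ D satisfies g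
= T(S g) and so lives in the band of the band; nothing is left on the difference, which is null by
semi-finiteness. -/
theorem IsChiPair.band_band (hp2 : p ≠ 2) {B : Set Ω} (hB : MeasurableSet B) (hBD : B ⊆ D) :
    h.band hμ (h.symm.band hμ B) =ᵐ[μ] B := by
  have hm := h.measurableSet_band hμ (h.symm.band hμ B)
  refine EventuallyLE.antisymm (ae_le_set.2 ?_) (ae_le_set.2 ?_)
  · rw [← chi_mul_chi_compl_eq_zero_iff (𝕜 := 𝕜) hm hB]
    refine h.chi_band_mul_eq_zero hμ fun f hf => ?_
    rw [mul_comm]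
    exact h.chi_mul_map_of_band hμ hp2 hB hf
  · have hC := hB.diff hm
    refine measure_eq_zero_of_forall_chi_mul 𝕜 p hμ hC fun g => ?_
    let g' : Lp 𝕜 p μ := chiOp p μ 𝕜 hC g
    have hg' : (g' : Ω →ₘ[μ] 𝕜) = chi μ 𝕜 (B \ h.band hμ (h.symm.band hμ B)) * g := rfl
    have h1 : chi μ 𝕜 B * (g' : Ω →ₘ[μ] 𝕜) = g' := by
      rw [hg', ← mul_assoc, chi_mul_chi_of_subset hC hB Set.sdiff_subset]
    have h2 := h.chi_band_mul hμ (h.symm.chi_band_mul hμ h1)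
    have h3 : chi μ 𝕜 D * chi μ 𝕜 (B \ h.band hμ (h.symm.band hμ B)) =
        chi μ 𝕜 (B \ h.band hμ (h.symm.band hμ B)) :=
      chi_mul_chi_of_subset hC h.measurableSet_left (Set.sdiff_subset.trans hBD)
    have h4 : chi μ 𝕜 (h.band hμ (h.symm.band hμ B)) *
        chi μ 𝕜 (B \ h.band hμ (h.symm.band hμ B)) = 0 := by
      rw [chi_mul_eq_zero_iff hm]
      filter_upwards [coeFn_chi_of_notMem (𝕜 := 𝕜) (μ := μ) hC] with x hx hxm
      exact hx fun hx' => hx'.2 hxm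
    rw [h.left_right, hg'] at h2
    linear_combination -h2 + chi μ 𝕜 D * (g : Ω →ₘ[μ] 𝕜) * h4 - (g : Ω →ₘ[μ] 𝕜) * h3

/-- The partial set automorphism induced by a pair of mutually inverse partial isometries. -/
def IsChiPair.toPartialSetAut (hp2 : p ≠ 2) : PartialSetAut μ where
  dom := D'
  cod := D
  measurableSet_dom := h.measurableSet_right
  measurableSet_cod := h.measurableSet_left
  toFun := h.band hμ
  invFun := h.symm.band hμ
  toFun_mem := fun C _ _ => ⟨h.measurableSet_band hμ C, h.band_subset hμ C⟩
  invFun_mem := fun C _ _ => ⟨h.symm.measurableSet_band hμ C, h.symm.band_subset hμ C⟩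
  null_diff_iff := by
    intro C C' hC hCd hC' hCd'
    refine ⟨h.band_mono hμ hC hC', fun h0 => ?_⟩
    have h1 := h.symm.band_mono hμ (h.measurableSet_band hμ C) (h.measurableSet_band hμ C') h0
    rwa [measure_congr ((h.symm.band_band hμ hp2 hC hCd).diff
      (h.symm.band_band hμ hp2 hC' hCd'))] at h1
  toFun_invFun := fun C hC hCd => h.band_band hμ hp2 hC hCd

/-- Only f on D' matters. The parts of f on C and off C have images in Φ of the two pieces of D',
which are disjoint, so multiplying T f by the indicator of the first keeps exactly the first image.
-/
theorem IsChiPair.map_chiOp (hp2 : p ≠ 2) {C : Set Ω} (hC : MeasurableSet C) (f : Lp 𝕜 p μ) :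
    (T (chiOp p μ 𝕜 hC f) : Ω →ₘ[μ] 𝕜) =
      compOp 𝕜 (h.toPartialSetAut hμ hp2) (chi μ 𝕜 C) * T f := by
  set Φ := h.toPartialSetAut hμ hp2 with hΦ
  have hA : MeasurableSet (C ∩ Φ.dom) := hC.inter Φ.measurableSet_dom
  have hB : MeasurableSet (Φ.dom \ (C ∩ Φ.dom)) := Φ.measurableSet_dom.diff hA
  have hD' : Φ.dom = D' := rfl
  have hsub : Φ.dom \ (C ∩ Φ.dom) ⊆ Φ.dom := Set.sdiff_subset
  have hmA := Φ.measurableSet_toFun hA Set.inter_subset_right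
  have hmB := Φ.measurableSet_toFun hB hsub
  have e1 : T (chiOp p μ 𝕜 hC f) = T (chiOp p μ 𝕜 hA f) := by
    refine h.map_congr ?_
    rw [coe_chiOp, coe_chiOp, ← chi_mul_chi hC Φ.measurableSet_dom, hD']
    linear_combination -(chi μ 𝕜 C * (f : Ω →ₘ[μ] 𝕜)) *
      chi_mul_self (μ := μ) (𝕜 := 𝕜) h.measurableSet_right
  have e2 : T f = T (chiOp p μ 𝕜 hA f) + T (chiOp p μ 𝕜 hB f) := by
    rw [← map_add]
    refine h.map_congr ?_
    rw [coe_add_Lp, coe_chiOp, coe_chiOp]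
    have h1 : chi μ 𝕜 (Φ.dom \ (C ∩ Φ.dom)) = chi μ 𝕜 D' - chi μ 𝕜 (C ∩ Φ.dom) := by
      rw [Set.sdiff_eq, ← chi_mul_chi Φ.measurableSet_dom hA.compl, chi_compl hA, mul_sub, mul_one,
        chi_mul_chi_of_subset hA Φ.measurableSet_dom Set.inter_subset_right, hD']
    rw [h1]
    linear_combination -(f : Ω →ₘ[μ] 𝕜) *
      chi_mul_self (μ := μ) (𝕜 := 𝕜) h.measurableSet_right
  have h1 : chi μ 𝕜 (Φ.toFun (C ∩ Φ.dom)) * (T (chiOp p μ 𝕜 hA f) : Ω →ₘ[μ] 𝕜) =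
      T (chiOp p μ 𝕜 hA f) :=
    h.chi_band_mul hμ (by rw [coe_chiOp, ← mul_assoc, chi_mul_self hA])
  have h2 : chi μ 𝕜 (Φ.toFun (Φ.dom \ (C ∩ Φ.dom))) * (T (chiOp p μ 𝕜 hB f) : Ω →ₘ[μ] 𝕜) =
      T (chiOp p μ 𝕜 hB f) :=
    h.chi_band_mul hμ (by rw [coe_chiOp, ← mul_assoc, chi_mul_self hB])
  have h3 : chi μ 𝕜 (Φ.toFun (C ∩ Φ.dom)) * chi μ 𝕜 (Φ.toFun (Φ.dom \ (C ∩ Φ.dom))) = 0 := by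
    rw [chi_mul_eq_zero_iff hmA]
    filter_upwards [coeFn_chi_of_notMem (𝕜 := 𝕜) (μ := μ) hmB,
      measure_eq_zero_iff_ae_notMem.1 (Φ.measure_toFun_inter_diff hA Set.inter_subset_right)]
      with x hx hx' hxA
    exact hx fun hxB => hx' ⟨hxA, hxB⟩
  rw [compOp_chi Φ hC, e1, e2, coe_add_Lp, mul_add, h1]
  linear_combination chi μ 𝕜 (Φ.toFun (C ∩ Φ.dom)) * h2 -
    (T (chiOp p μ 𝕜 hB f) : Ω →ₘ[μ] 𝕜) * h3

end Band

end Automorphism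

/-! ### Operators that intertwine multiplications -/

section Intertwining

variable {Ω : Type*} [MeasurableSpace Ω] {μ : Measure Ω} {𝕜 : Type*} [RCLike 𝕜] {p : ℝ≥0∞}

/-- Uniform approximation of bounded measurable functions by simple functions. -/
theorem exists_simpleFunc_norm_sub_le {k : Ω → 𝕜} (hk : Measurable k) {C : ℝ} {ε : ℝ}
    (hε : 0 < ε) : ∃ s : SimpleFunc Ω 𝕜, ∀ x, ‖k x‖ ≤ C → ‖k x - s x‖ ≤ ε := by
  let e := TopologicalSpace.denseSeq 𝕜
  have hcover : Metric.closedBall (0 : 𝕜) C ⊆ ⋃ n, Metric.ball (e n) ε := fun y _ => by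
    obtain ⟨n, hn⟩ := (TopologicalSpace.denseRange_denseSeq 𝕜).exists_dist_lt y hε
    exact Set.mem_iUnion.2 ⟨n, hn⟩
  obtain ⟨t, ht⟩ := (isCompact_closedBall (0 : 𝕜) C).elim_finite_subcover _
    (fun n => Metric.isOpen_ball) hcover
  refine ⟨(SimpleFunc.nearestPt e (t.sup id)).comp k hk, fun x hx => ?_⟩
  obtain ⟨n, hn, hxn⟩ := Set.mem_iUnion₂.1 (ht (mem_closedBall_zero_iff.2 hx))
  have h1 := SimpleFunc.edist_nearestPt_le e (k x) (Finset.le_sup (f := id) hn)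
  rw [← dist_eq_norm, dist_comm]
  rw [edist_dist, edist_dist, ENNReal.ofReal_le_ofReal_iff dist_nonneg] at h1
  exact h1.trans (by rw [dist_comm]; exact (Metric.mem_ball.1 hxn).le)

theorem coe_indicatorConstLp {B : Set Ω} (hB : MeasurableSet B) (hBf : μ B ≠ ∞) :
    (indicatorConstLp p hB hBf (1 : 𝕜) : Ω →ₘ[μ] 𝕜) = chi μ 𝕜 B :=
  (eq_chi_iff hB).2 indicatorConstLp_coeFn

variable [Fact (1 ≤ p)]

/-- `T` intertwines multiplication by `k` with multiplication by `V k`, for `k` an indicator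
function; here `V` is multiplicative and does not increase the supremum norm. -/
structure Intertwines (T : Lp 𝕜 p μ →L[𝕜] Lp 𝕜 p μ)
    (V : (Ω →ₘ[μ] 𝕜) →ₗ[𝕜] (Ω →ₘ[μ] 𝕜)) : Prop where
  map_mul : ∀ f g, V (f * g) = V f * V g
  norm_le : ∀ f (C : ℝ), 0 ≤ C → (∀ᵐ x ∂μ, ‖f x‖ ≤ C) → ∀ᵐ x ∂μ, ‖V f x‖ ≤ C
  map_chiOp : ∀ (C : Set Ω) (hC : MeasurableSet C) (f : Lp 𝕜 p μ),
    (T (chiOp p μ 𝕜 hC f) : Ω →ₘ[μ] 𝕜) = V (chi μ 𝕜 C) * T f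

variable {T : Lp 𝕜 p μ →L[𝕜] Lp 𝕜 p μ} {V : (Ω →ₘ[μ] 𝕜) →ₗ[𝕜] (Ω →ₘ[μ] 𝕜)}

/-- The product enters as an arbitrary g with an equation, so that the induction does not have to
carry a bound for the simple function. -/
theorem Intertwines.map_simpleFunc (h : Intertwines T V) (s : SimpleFunc Ω 𝕜) (f : Lp 𝕜 p μ)
    {g : Lp 𝕜 p μ} (hg : (g : Ω →ₘ[μ] 𝕜) =
      (AEEqFun.mk s s.aestronglyMeasurable : Ω →ₘ[μ] 𝕜) * (f : Ω →ₘ[μ] 𝕜)) :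
    (T g : Ω →ₘ[μ] 𝕜) = V (AEEqFun.mk s s.aestronglyMeasurable) * T f := by
  induction s using SimpleFunc.induction generalizing g with
  | const c hs =>
    rename_i A
    have h1 : AEEqFun.mk (SimpleFunc.piecewise A hs (SimpleFunc.const Ω c)
        (SimpleFunc.const Ω 0)) (SimpleFunc.aestronglyMeasurable _) = c • chi μ 𝕜 A := by
      apply AEEqFun.ext
      filter_upwards [AEEqFun.coeFn_mk (SimpleFunc.piecewise A hs (SimpleFunc.const Ω c)
        (SimpleFunc.const Ω 0)) (SimpleFunc.aestronglyMeasurable _ (μ := μ)),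
        coeFn_smul_apply c (chi μ 𝕜 A), coeFn_chi (𝕜 := 𝕜) (μ := μ) hs] with x h1 h2 h3
      rw [h1, h2, h3]
      by_cases hx : x ∈ A <;> simp [hx]
    rw [h1] at hg ⊢
    have h2 : g = c • chiOp p μ 𝕜 hs f := Subtype.ext (by
      rw [hg, coe_smul_Lp, coe_chiOp, smul_mul_aeeqFun])
    rw [h2, _root_.map_smul, _root_.map_smul, coe_smul_Lp, h.map_chiOp, smul_mul_aeeqFun]
  | add hd hs ht =>
    rename_i s t
    have hb : ∀ s : SimpleFunc Ω 𝕜, ∃ C : ℝ, ∀ᵐ x ∂μ,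
        ‖AEEqFun.mk s s.aestronglyMeasurable x‖ ≤ C := fun s => by
      obtain ⟨C, hC⟩ := s.exists_forall_norm_le
      refine ⟨C, ?_⟩
      filter_upwards [AEEqFun.coeFn_mk s (s.aestronglyMeasurable (μ := μ))] with x hx
      rw [hx]; exact hC x
    obtain ⟨Cs, hCs⟩ := hb s
    obtain ⟨Ct, hCt⟩ := hb t
    have h1 : AEEqFun.mk (s + t : SimpleFunc Ω 𝕜) (SimpleFunc.aestronglyMeasurable _ (μ := μ)) =
        AEEqFun.mk s s.aestronglyMeasurable + AEEqFun.mk t t.aestronglyMeasurable := rfl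
    rw [h1] at hg ⊢
    have h2 : g = mulLp _ hCs f + mulLp _ hCt f := Subtype.ext (by
      rw [hg, coe_add_Lp, coe_mulLp, coe_mulLp, add_mul])
    rw [h2, map_add, map_add, coe_add_Lp, hs (coe_mulLp hCs f), ht (coe_mulLp hCt f), add_mul]

/-- Approximate k uniformly by simple functions: T is bounded and V does not increase the essential
bound, so the error on both sides is of order ε. -/
theorem Intertwines.map_mulLp (h : Intertwines T V) {k : Ω →ₘ[μ] 𝕜} {C : ℝ} (hC : 0 ≤ C)
    (hk : ∀ᵐ x ∂μ, ‖k x‖ ≤ C) (f : Lp 𝕜 p μ) :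
    (T (mulLp k hk f) : Ω →ₘ[μ] 𝕜) = V k * T f := by
  have hVk := h.norm_le k C hC hk
  suffices hz : T (mulLp k hk f) - mulLp (V k) hVk (T f) = 0 from
    congrArg Subtype.val (sub_eq_zero.1 hz)
  rw [← norm_le_zero_iff]
  have key : ∀ ε : ℝ, 0 < ε →
      ‖T (mulLp k hk f) - mulLp (V k) hVk (T f)‖ ≤ ε * (‖T‖ * ‖f‖ + ‖T f‖) := by
    intro ε hε
    obtain ⟨s, hs⟩ := exists_simpleFunc_norm_sub_le (C := C) k.measurable hε
    let s' : Ω →ₘ[μ] 𝕜 := AEEqFun.mk s s.aestronglyMeasurable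
    have hks : ∀ᵐ x ∂μ, ‖(k - s') x‖ ≤ ε := by
      filter_upwards [hk, coeFn_sub_apply k s',
        AEEqFun.coeFn_mk s (s.aestronglyMeasurable (μ := μ))] with x h1 h2 h3
      rw [h2, h3]
      exact hs x h1
    have hVks := h.norm_le _ ε hε.le hks
    have hs'b : ∃ C' : ℝ, ∀ᵐ x ∂μ, ‖s' x‖ ≤ C' := by
      obtain ⟨C', hC'⟩ := s.exists_forall_norm_le
      refine ⟨C', ?_⟩
      filter_upwards [AEEqFun.coeFn_mk s (s.aestronglyMeasurable (μ := μ))] with x hx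
      rw [hx]; exact hC' x
    obtain ⟨C', hC'⟩ := hs'b
    have h1 : T (mulLp k hk f) - mulLp (V k) hVk (T f) =
        T (mulLp (k - s') hks f) - mulLp (V (k - s')) hVks (T f) := by
      have e1 : mulLp k hk f = mulLp (k - s') hks f + mulLp s' hC' f := Subtype.ext (by
        rw [coe_add_Lp, coe_mulLp, coe_mulLp, coe_mulLp]; ring)
      apply Subtype.ext
      rw [e1, map_add, coe_sub_Lp, coe_sub_Lp, coe_add_Lp, coe_mulLp, coe_mulLp,
        h.map_simpleFunc s f (coe_mulLp hC' f), map_sub]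
      ring
    rw [h1]
    calc ‖T (mulLp (k - s') hks f) - mulLp (V (k - s')) hVks (T f)‖
        ≤ ‖T (mulLp (k - s') hks f)‖ + ‖mulLp (V (k - s')) hVks (T f)‖ := norm_sub_le _ _
      _ ≤ ‖T‖ * (ε * ‖f‖) + ε * ‖T f‖ :=
        add_le_add ((T.le_opNorm _).trans
          (mul_le_mul_of_nonneg_left (norm_mulLp_le hks f) (norm_nonneg _)))
          (norm_mulLp_le hVks (T f))
      _ = ε * (‖T‖ * ‖f‖ + ‖T f‖) := by ring
  have hlim : Tendsto (fun ε : ℝ => ε * (‖T‖ * ‖f‖ + ‖T f‖)) (𝓝[>] 0) (𝓝 0) := by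
    have : Tendsto (fun ε : ℝ => ε * (‖T‖ * ‖f‖ + ‖T f‖)) (𝓝 0)
        (𝓝 (0 * (‖T‖ * ‖f‖ + ‖T f‖))) := tendsto_id.mul_const _
    rw [zero_mul] at this
    exact this.mono_left nhdsWithin_le_nhds
  exact ge_of_tendsto hlim (eventually_mem_nhdsWithin.mono fun ε hε => key ε hε)

/-- Both f and g are bounded multiples km and lm of m = |f| + |g|, and both sides equal V k · V l ·
V m · T m. Consequently T f / V f does not depend on f. -/
theorem Intertwines.map_mul_comm (h : Intertwines T V) (f g : Lp 𝕜 p μ) :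
    (T f : Ω →ₘ[μ] 𝕜) * V g = V f * T g := by
  have hmem : MemLp (fun x => ((‖f x‖ + ‖g x‖ : ℝ) : 𝕜)) p μ :=
    ((Lp.memLp f).norm.add (Lp.memLp g).norm).ofReal
  let m : Lp 𝕜 p μ := hmem.toLp _
  have hm : ∀ᵐ x ∂μ, m x = ((‖f x‖ + ‖g x‖ : ℝ) : 𝕜) := hmem.coeFn_toLp
  have key : ∀ u : Lp 𝕜 p μ, (∀ x, ‖u x‖ ≤ ‖f x‖ + ‖g x‖) → ∃ k : Ω →ₘ[μ] 𝕜,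
      (u : Ω →ₘ[μ] 𝕜) = k * m ∧ (T u : Ω →ₘ[μ] 𝕜) = V k * T m := by
    intro u hu
    have hkm : Measurable fun x => u x / m x :=
      (Lp.stronglyMeasurable u).measurable.div (Lp.stronglyMeasurable m).measurable
    let k : Ω →ₘ[μ] 𝕜 := AEEqFun.mk _ hkm.aestronglyMeasurable
    have hk : ∀ᵐ x ∂μ, k x = u x / m x := AEEqFun.coeFn_mk _ _
    have hkb : ∀ᵐ x ∂μ, ‖k x‖ ≤ 1 := by
      filter_upwards [hk, hm] with x h1 h2
      rw [h1, norm_div, h2, RCLike.norm_ofReal, abs_of_nonneg (by positivity)]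
      exact div_le_one_of_le₀ (hu x) (by positivity)
    have e : (u : Ω →ₘ[μ] 𝕜) = k * m := by
      apply AEEqFun.ext
      filter_upwards [hk, hm, coeFn_mul_apply k (m : Ω →ₘ[μ] 𝕜)] with x h1 h2 h3
      rw [h3, h1]
      by_cases h0 : m x = 0
      · have h4 : ‖f x‖ + ‖g x‖ = 0 := by
          rw [h2] at h0; exact RCLike.ofReal_eq_zero.1 h0
        have h5 : u x = 0 := norm_le_zero_iff.1 ((hu x).trans h4.le)
        rw [h5, h0, mul_zero]
      · exact (div_mul_cancel₀ _ h0).symm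
    refine ⟨k, e, ?_⟩
    have h4 : u = mulLp k hkb m := Subtype.ext e
    rw [h4]
    exact h.map_mulLp zero_le_one hkb m
  obtain ⟨k, hk1, hk2⟩ := key f fun x => le_add_of_nonneg_right (norm_nonneg _)
  obtain ⟨l, hl1, hl2⟩ := key g fun x => le_add_of_nonneg_left (norm_nonneg _)
  rw [hk2, hl2, hk1, hl1, h.map_mul, h.map_mul]
  ring

/-- The indicator of the support of f is f⁻¹f, hence T f = V(f⁻¹) · V f · T f. -/
theorem Intertwines.map_eq_zero (h : Intertwines T V) (f : Lp 𝕜 p μ) :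
    ∀ᵐ x ∂μ, V f x = 0 → T f x = 0 := by
  have hm : Measurable fun x => (f x)⁻¹ := (Lp.stronglyMeasurable f).measurable.inv
  let k : Ω →ₘ[μ] 𝕜 := AEEqFun.mk _ hm.aestronglyMeasurable
  have hA := measurableSet_suppSet (f : Ω →ₘ[μ] 𝕜)
  have hk : chi μ 𝕜 (suppSet (f : Ω →ₘ[μ] 𝕜)) = k * f := by
    apply AEEqFun.ext
    filter_upwards [coeFn_chi (𝕜 := 𝕜) (μ := μ) hA, coeFn_mul_apply k (f : Ω →ₘ[μ] 𝕜),
      AEEqFun.coeFn_mk _ (hm.aestronglyMeasurable (μ := μ))] with x h1 h2 h3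
    rw [h1, h2, h3]
    by_cases hx : f x = 0
    · rw [Set.indicator_of_notMem (by simpa [suppSet] using hx), hx, mul_zero]
    · rw [Set.indicator_of_mem (show x ∈ suppSet (f : Ω →ₘ[μ] 𝕜) from hx), inv_mul_cancel₀ hx]
  have h1 := h.map_chiOp _ hA f
  have h2 : chiOp p μ 𝕜 hA f = f := Subtype.ext (chi_suppSet_mul _)
  rw [h2, hk, h.map_mul, mul_right_comm] at h1
  filter_upwards [coeFn_mul_apply (V k * (T f : Ω →ₘ[μ] 𝕜)) (V f)] with x hx h0
  rw [h1, hx, h0, mul_zero]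

/-- An intertwining operator is a weighted version of `V`. -/
theorem Intertwines.exists_weight (h : Intertwines T V) (hμ : IsLocalizable μ) :
    ∃ w : Ω → 𝕜, Measurable w ∧ ∀ f : Lp 𝕜 p μ, ∀ᵐ x ∂μ, T f x = w x * V f x := by
  -- Each f contributes the weight T f / V f on the support of V f; `Intertwines.map_mul_comm` is
  -- their compatibility on overlaps.
  obtain ⟨w, hw, hwf⟩ := exists_glue hμ (A := fun f : Lp 𝕜 p μ => suppSet (V f))
    (fun f => measurableSet_suppSet _) (f := fun f x => T f x / V f x)
    (fun f => (Lp.stronglyMeasurable (T f)).measurable.div (AEEqFun.measurable _)) (by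
      intro f g
      filter_upwards [coeFn_mul_apply (T f : Ω →ₘ[μ] 𝕜) (V g),
        coeFn_mul_apply (V f) (T g : Ω →ₘ[μ] 𝕜)] with x h1 h2 hf hg
      rw [h.map_mul_comm, h2] at h1
      rw [div_eq_div_iff hf hg, ← h1, mul_comm])
  refine ⟨w, hw, fun f => ?_⟩
  filter_upwards [hwf f, h.map_eq_zero f] with x h1 h2
  by_cases hx : V f x = 0
  · rw [hx, mul_zero, h2 hx]
  · rw [h1 hx, div_mul_cancel₀ _ hx]

end Intertwining

/-! ### Operators with multiplicative contractive generalized inverses are spatial -/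

section IsSpatial

variable {Ω : Type*} [MeasurableSpace Ω] {μ : Measure Ω} {𝕜 : Type*} [RCLike 𝕜] {p : ℝ≥0∞}
  [Fact (1 ≤ p)] {T S : Lp 𝕜 p μ →L[𝕜] Lp 𝕜 p μ} {D D' : Set Ω}

theorem IsChiPair.intertwines (h : IsChiPair T S D D') (hμ : IsLocalizable μ) (hp2 : p ≠ 2) :
    Intertwines T (compOp 𝕜 (h.toPartialSetAut hμ hp2)) :=
  ⟨compOp_mul _, fun _ _ hC hf => norm_compOp_le _ hC hf,
    fun _ hC f => h.map_chiOp hμ hp2 hC f⟩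

theorem mem_SPIso_of_weight {Φ : PartialSetAut μ} {w : Ω → 𝕜} (hw : Measurable w)
    (hT : ∀ f : Lp 𝕜 p μ, ∀ᵐ x ∂μ, T f x = w x * compOp 𝕜 Φ f x) {h : Ω → ℝ≥0}
    (hh : IsRNDeriv Φ h)
    (hwh : ∀ᵐ x ∂μ, x ∈ Φ.cod → ‖w x‖ = (h x : ℝ) ^ (1 / p.toReal)) : T ∈ SPIso 𝕜 p μ := by
  classical
  -- The phase is w/|w|, with value 1 at zeros of w so that its modulus is one everywhere.
  refine ⟨Φ, compOp 𝕜 Φ, h, fun x => if w x = 0 then 1 else w x / (‖w x‖ : 𝕜),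
    isCompositionOp_compOp Φ, hh, ?_, fun x _ => ?_, fun f => ?_⟩
  · exact Measurable.ite (hw (measurableSet_singleton 0)) measurable_const
      (hw.div (RCLike.measurable_ofReal.comp hw.norm))
  · beta_reduce
    split_ifs with h0
    · exact norm_one
    · rw [norm_div, RCLike.norm_ofReal, abs_norm, div_self (norm_ne_zero_iff.2 h0)]
  · filter_upwards [hT f, hwh,
      (chi_mul_eq_self_iff Φ.measurableSet_cod).1 (chi_cod_mul_compOp Φ (f : Ω →ₘ[μ] 𝕜))]
      with x h1 h2 h3
    rw [h1]
    by_cases hx : x ∈ Φ.cod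
    · rw [← h2 hx]
      congr 1
      split_ifs with h0
      · simp [h0]
      · rw [div_mul_cancel₀]
        exact RCLike.ofReal_ne_zero.2 (norm_ne_zero_iff.2 h0)
    · rw [h3 hx, mul_zero, mul_zero]

theorem IsChiPair.norm_map_of_supported (h : IsChiPair T S D D') {f : Lp 𝕜 p μ}
    (hf : chi μ 𝕜 D' * (f : Ω →ₘ[μ] 𝕜) = f) : ‖T f‖ = ‖f‖ := by
  rw [← h.norm_map_map]
  congr 1
  apply Subtype.ext
  rw [h.right_left, hf]

theorem IsChiPair.mem_SPIso (h : IsChiPair T S D D') (hμ : IsLocalizable μ) (hp2 : p ≠ 2) :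
    T ∈ SPIso 𝕜 p μ := by
  set Φ := h.toPartialSetAut hμ hp2 with hΦ
  obtain ⟨w, hw, hwf⟩ := (h.intertwines hμ hp2).exists_weight hμ
  rw [← hΦ] at hwf
  by_cases hpt : p = ∞
  · subst hpt
    obtain ⟨g, hg⟩ := exists_isRNDeriv Φ hμ
    refine mem_SPIso_of_weight hw hwf hg ?_
    -- The weight on D is the image of the indicator of D', which is unimodular there; the exponent
    -- 1/∞ = 0 makes the derivative irrelevant.
    let u : Lp 𝕜 ∞ μ := toLinf (chi μ 𝕜 D') (norm_chi_le h.measurableSet_right)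
    have hu : ‖u‖ ≤ 1 := norm_le_of_ae_norm_le zero_le_one (norm_chi_le h.measurableSet_right)
    have hVu : compOp 𝕜 Φ u = chi μ 𝕜 D := by
      rw [coe_toLinf, compOp_chi Φ h.measurableSet_right]
      have hdom : D' ∩ Φ.dom = Φ.dom := Set.inter_self D'
      rw [hdom]
      exact chi_congr (Φ.measurableSet_toFun Φ.measurableSet_dom le_rfl) h.measurableSet_left
        Φ.toFun_dom
    filter_upwards [h.norm_map_eq_one hu (by
      filter_upwards [coeFn_chi_of_mem (𝕜 := 𝕜) (μ := μ) h.measurableSet_right] with x hx hxD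
      rw [show u x = 1 from hx hxD, norm_one]), hwf u,
      coeFn_chi_of_mem (𝕜 := 𝕜) (μ := μ) h.measurableSet_left] with x h1 h2 h3 hx
    rw [hVu, h3 hx, mul_one] at h2
    rw [← h2, h1 hx]
    simp
  · have hp0 : p ≠ 0 := (zero_lt_one.trans_le (Fact.out : 1 ≤ p)).ne'
    have hpr : 0 < p.toReal := ENNReal.toReal_pos hp0 hpt
    -- Testing ‖T f‖ = ‖f‖ on the indicator of Φ*(C), of finite measure, identifies |w|^p as the
    -- derivative; semi-finiteness extends this to all C.
    let g : Ω → ℝ≥0 := fun x => ‖w x‖₊ ^ p.toReal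
    have hgm : Measurable g := hw.nnnorm.pow_const _
    have hfin : ∀ C, MeasurableSet C → C ⊆ Φ.symm.dom → μ (Φ.symm.toFun C) < ∞ →
        μ (Φ.symm.toFun C) = ∫⁻ x in C, (g x : ℝ≥0∞) ∂μ := by
      intro C hC hCd hlt
      have hB := Φ.symm.toFun_mem C hC hCd
      set B := Φ.symm.toFun C with hBdef
      let f : Lp 𝕜 p μ := indicatorConstLp p hB.1 hlt.ne 1
      have hf : (f : Ω →ₘ[μ] 𝕜) = chi μ 𝕜 B := coe_indicatorConstLp hB.1 hlt.ne
      have hVf : compOp 𝕜 Φ f = chi μ 𝕜 C := by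
        have hBdom : B ⊆ Φ.dom := hB.2
        rw [hf, compOp_chi Φ hB.1, Set.inter_eq_left.2 hBdom]
        exact chi_congr (Φ.measurableSet_toFun hB.1 hBdom) hC (Φ.toFun_invFun C hC hCd)
      have hnorm : ‖T f‖ = ‖f‖ := h.norm_map_of_supported (by
        rw [hf]
        exact chi_mul_chi_of_subset hB.1 h.measurableSet_right hB.2)
      have h1 : ∫⁻ x, ‖T f x‖ₑ ^ p.toReal ∂μ = ∫⁻ x, ‖f x‖ₑ ^ p.toReal ∂μ := by
        have h2 : eLpNorm (T f) p μ = eLpNorm f p μ := by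
          rw [← Lp.enorm_def, ← Lp.enorm_def, ← ofReal_norm, ← ofReal_norm, hnorm]
        rw [eLpNorm_eq_lintegral_rpow_enorm_toReal hp0 hpt,
          eLpNorm_eq_lintegral_rpow_enorm_toReal hp0 hpt] at h2
        exact ENNReal.rpow_left_injective (one_div_pos.2 hpr).ne' h2
      have h2 : ∫⁻ x, ‖f x‖ₑ ^ p.toReal ∂μ = μ B := by
        rw [← lintegral_indicator_one hB.1]
        refine lintegral_congr_ae ?_
        filter_upwards [hf ▸ coeFn_chi (𝕜 := 𝕜) (μ := μ) hB.1] with x hx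
        rw [hx]
        by_cases hxB : x ∈ B <;> simp [hxB, hpr]
      have h3 : ∫⁻ x, ‖T f x‖ₑ ^ p.toReal ∂μ = ∫⁻ x in C, (g x : ℝ≥0∞) ∂μ := by
        rw [← lintegral_indicator hC]
        refine lintegral_congr_ae ?_
        filter_upwards [hwf f, hVf ▸ coeFn_chi (𝕜 := 𝕜) (μ := μ) hC] with x hx hx'
        rw [hx, hx']
        by_cases hxC : x ∈ C
        · simp only [hxC, Set.indicator_of_mem, mul_one, g]
          rw [enorm_eq_nnnorm, ENNReal.coe_rpow_of_nonneg _ hpr.le]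
        · simp [hxC, hpr]
      rw [← h3, h1, h2]
    have hall := measure_toFun_eq_of_finite Φ.symm hμ hfin
    refine mem_SPIso_of_weight hw hwf (h := Φ.cod.indicator g)
      ⟨hgm.indicator Φ.measurableSet_cod, fun x hx => Set.indicator_of_notMem hx g,
        fun C hC hCd => (hall C hC hCd).trans ?_⟩ (Eventually.of_forall fun x hx => ?_)
    · refine setLIntegral_congr_fun hC fun x hx => ?_
      simp only [Set.indicator_of_mem (hCd hx)]
    · rw [Set.indicator_of_mem hx]
      simp only [g, NNReal.coe_rpow, coe_nnnorm]
      rw [← Real.rpow_mul (norm_nonneg _), mul_one_div_cancel hpr.ne', Real.rpow_one]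

theorem exists_isChiPair_iff_mem_SPIso (hμ : IsLocalizable μ) (hp2 : p ≠ 2) :
    T ∈ SPIso 𝕜 p μ ↔ ∃ S D D', IsChiPair T S D D' :=
  ⟨exists_isChiPair_of_mem_SPIso, fun ⟨_, _, _, h⟩ => h.mem_SPIso hμ hp2⟩

end IsSpatial

section

variable {Ω : Type*} [MeasurableSpace Ω] {μ : Measure Ω} {𝕜 : Type*} [RCLike 𝕜] {p : ℝ≥0∞}

/-! ### Pairs of operators with multiplicative products -/

section Pairs

variable [Fact (1 ≤ p)] {T S : Lp 𝕜 p μ →L[𝕜] Lp 𝕜 p μ} {D D' : Set Ω}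

theorem IsChiPair.mul_eq_chiOp (h : IsChiPair T S D D') :
    T * S = chiOp p μ 𝕜 h.measurableSet_left :=
  ContinuousLinearMap.ext fun f => Subtype.ext (h.left_right f)

theorem isChiPair_of_isMultiplicationOp (hT : ‖T‖ ≤ 1) (hS : ‖S‖ ≤ 1) (hTS : IsGenInverse T S)
    (h1 : IsMultiplicationOp (T * S)) (h2 : IsMultiplicationOp (S * T)) :
    ∃ D D', IsChiPair T S D D' := by
  obtain ⟨D, hD, e1⟩ := h1.exists_eq_chiOp (by rw [← mul_assoc, ← hTS.1])
  obtain ⟨D', hD', e2⟩ := h2.exists_eq_chiOp (by rw [← mul_assoc, ← hTS.2])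
  refine ⟨D, D', hD, hD', hT, hS, fun f => ?_, fun f => ?_, hTS⟩
  · rw [← coe_chiOp hD, ← e1]; rfl
  · rw [← coe_chiOp hD', ← e2]; rfl

theorem exists_isChiPair_iff_isMultiplicationOp :
    (∃ S D D', IsChiPair T S D D') ↔ ‖T‖ ≤ 1 ∧ ∃ S : Lp 𝕜 p μ →L[𝕜] Lp 𝕜 p μ, ‖S‖ ≤ 1 ∧
      IsGenInverse T S ∧ IsMultiplicationOp (T * S) ∧ IsMultiplicationOp (S * T) := by
  constructor
  · rintro ⟨S, D, D', h⟩
    refine ⟨h.norm_left, S, h.norm_right, h.isGenInverse, ?_, ?_⟩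
    · rw [h.mul_eq_chiOp]; exact isMultiplicationOp_chiOp _
    · rw [h.symm.mul_eq_chiOp]; exact isMultiplicationOp_chiOp _
  · rintro ⟨hT, S, hS, hTS, h1, h2⟩
    exact ⟨S, isChiPair_of_isMultiplicationOp hT hS hTS h1 h2⟩

end Pairs

/-! ### `L^p`-projections are multiplication operators -/

section Projections

theorem isLpProjection_chiOp [Fact (1 ≤ p)] {D : Set Ω} (hD : MeasurableSet D) :
    IsLpProjection p (chiOp p μ 𝕜 hD) := by
  have hc : ∀ ξ : Lp 𝕜 p μ, ∀ᵐ x ∂μ, chiOp p μ 𝕜 hD ξ x = D.indicator ξ x := fun ξ =>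
    coeFn_chi_mul hD (ξ : Ω →ₘ[μ] 𝕜)
  refine ⟨?_, fun hpt ξ => ?_, fun hpt ξ => ?_⟩
  · ext1 f
    apply Subtype.ext
    change chi μ 𝕜 D * (chi μ 𝕜 D * (f : Ω →ₘ[μ] 𝕜)) = chi μ 𝕜 D * f
    rw [← mul_assoc, chi_mul_self hD]
  · have hp0 : p ≠ 0 := (zero_lt_one.trans_le (Fact.out : 1 ≤ p)).ne'
    have hpr : 0 < p.toReal := ENNReal.toReal_pos hp0 hpt
    have hi : ∀ f : Lp 𝕜 p μ, Integrable (fun x => ‖f x‖ ^ p.toReal) μ := fun f =>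
      (Lp.memLp f).integrable_norm_rpow hp0 hpt
    rw [norm_rpow_eq_integral hpt, norm_rpow_eq_integral hpt, norm_rpow_eq_integral hpt,
      ← integral_add (hi _) (hi _)]
    refine integral_congr_ae ?_
    filter_upwards [hc ξ, Lp.coeFn_sub ξ (chiOp p μ 𝕜 hD ξ)] with x h1 h2
    rw [h2, Pi.sub_apply, h1]
    by_cases hx : x ∈ D <;> simp [hx, Real.zero_rpow hpr.ne']
  · subst hpt
    refine le_antisymm ?_ (max_le (norm_chiOp_apply_le hD ξ) ?_)
    · refine norm_le_of_ae_norm_le (le_max_of_le_left (norm_nonneg _)) ?_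
      filter_upwards [hc ξ, Lp.coeFn_sub ξ (chiOp ∞ μ 𝕜 hD ξ), ae_norm_le_norm (chiOp ∞ μ 𝕜 hD ξ),
        ae_norm_le_norm (ξ - chiOp ∞ μ 𝕜 hD ξ)] with x h1 h2 h3 h4
      rw [h2, Pi.sub_apply, h1] at h4
      rw [h1] at h3
      by_cases hx : x ∈ D
      · rw [Set.indicator_of_mem hx] at h3
        exact le_max_of_le_left h3
      · rw [Set.indicator_of_notMem hx, sub_zero] at h4
        exact le_max_of_le_right h4
    · refine norm_le_of_ae_norm_le (norm_nonneg _) ?_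
      filter_upwards [hc ξ, Lp.coeFn_sub ξ (chiOp ∞ μ 𝕜 hD ξ), ae_norm_le_norm ξ] with x h1 h2 h3
      rw [h2, Pi.sub_apply, h1]
      by_cases hx : x ∈ D
      · simp [hx]
      · simpa [hx] using h3

/-- Let E be the support of the range. P f lives on E and f - P f vanishes on E, so P f is the
restriction of f to E. -/
theorem isMultiplicationOp_of_disjoint [Fact (1 ≤ p)] (hμ : IsLocalizable μ)
    {P : Lp 𝕜 p μ →L[𝕜] Lp 𝕜 p μ}
    (h : ∀ f g : Lp 𝕜 p μ, (P f : Ω →ₘ[μ] 𝕜) * (g - P g : Lp 𝕜 p μ) = 0) :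
    IsMultiplicationOp P := by
  obtain ⟨E, hE, h1, h2⟩ := hμ.exists_support (Set.range fun f => (P f : Ω →ₘ[μ] 𝕜))
  have h3 : P = chiOp p μ 𝕜 hE := by
    ext1 f
    apply Subtype.ext
    rw [coe_chiOp]
    have h4 := h1 _ ⟨f, rfl⟩
    have h5 := h2 (f - P f : Lp 𝕜 p μ) (by rintro _ ⟨g, rfl⟩; exact h g f)
    rw [coe_sub_Lp] at h5
    linear_combination -h4 - h5
  rw [h3]
  exact isMultiplicationOp_chiOp hE

theorem isChiPair_univ [Fact (1 ≤ p)] {T S : Lp 𝕜 p μ →L[𝕜] Lp 𝕜 p μ} (hT : ‖T‖ ≤ 1)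
    (hS : ‖S‖ ≤ 1) (hTS : T * S = 1) (hST : S * T = 1) :
    IsChiPair T S Set.univ Set.univ := by
  refine ⟨MeasurableSet.univ, MeasurableSet.univ, hT, hS, fun f => ?_, fun f => ?_, ?_, ?_⟩
  · rw [chi_univ, one_mul]
    exact congrArg Subtype.val (DFunLike.congr_fun hTS f)
  · rw [chi_univ, one_mul]
    exact congrArg Subtype.val (DFunLike.congr_fun hST f)
  · rw [hTS, one_mul]
  · rw [hST, one_mul]

/-- For |c| = 1 the operators P + c(1 - P) are invertible isometries, so a + cb is unimodular for a
= P1 and b = 1 - P1, and a, b are disjoint. The maximum norm gives ‖P f ± ‖P f‖b‖ ≤ ‖P f‖, which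
kills P f where a = 0; symmetrically g - P g vanishes where b = 0. -/
theorem IsLpProjection.mul_sub_eq_zero_top {P : Lp 𝕜 ∞ μ →L[𝕜] Lp 𝕜 ∞ μ}
    (hP : IsLpProjection ∞ P) (f g : Lp 𝕜 ∞ μ) :
    (P f : Ω →ₘ[μ] 𝕜) * (g - P g : Lp 𝕜 ∞ μ) = 0 := by
  have hPP : ∀ f, P (P f) = P f := fun f => DFunLike.congr_fun hP.1 f
  have hmax : ∀ ξ η : Lp 𝕜 ∞ μ, P ξ = ξ → P η = 0 → ‖ξ + η‖ = max ‖ξ‖ ‖η‖ := by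
    intro ξ η h1 h2
    have := hP.2.2 rfl (ξ + η)
    rwa [map_add, h1, h2, add_zero, add_sub_cancel_left] at this
  let U : 𝕜 → Lp 𝕜 ∞ μ →L[𝕜] Lp 𝕜 ∞ μ := fun c => P + c • (1 - P)
  have hUf : ∀ c f, U c f = P f + c • (f - P f) := fun c f => rfl
  have hQ : ∀ f, P (f - P f) = 0 := fun f => by rw [map_sub, hPP, sub_self]
  have hUn : ∀ c : 𝕜, ‖c‖ = 1 → ‖U c‖ ≤ 1 := fun c hc => by
    refine ContinuousLinearMap.opNorm_le_bound _ zero_le_one fun f => ?_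
    rw [hUf, hmax _ _ (hPP f) (by rw [map_smul, hQ, smul_zero]), norm_smul, hc, one_mul, one_mul,
      hP.2.2 rfl f]
  have hUU : ∀ c d : 𝕜, c * d = 1 → U c * U d = 1 := fun c d hcd => by
    ext1 f
    change U c (U d f) = f
    rw [hUf, hUf, map_add, map_smul, hQ, hPP, smul_zero, add_zero, add_sub_cancel_left, smul_smul,
      hcd, one_smul, add_sub_cancel]
  have hpair : ∀ c : 𝕜, ‖c‖ = 1 → IsChiPair (U c) (U c⁻¹) Set.univ Set.univ := fun c hc => by
    have hc0 : c ≠ 0 := norm_ne_zero_iff.1 (by rw [hc]; exact one_ne_zero)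
    exact isChiPair_univ (hUn c hc) (hUn c⁻¹ (by rw [norm_inv, hc, inv_one]))
      (hUU _ _ (mul_inv_cancel₀ hc0)) (hUU _ _ (inv_mul_cancel₀ hc0))
  have hone : ∀ᵐ x ∂μ, ‖(1 : Ω →ₘ[μ] 𝕜) x‖ ≤ 1 := by
    filter_upwards [coeFn_one_apply (μ := μ) (𝕜 := 𝕜)] with x hx
    rw [hx, norm_one]
  let o : Lp 𝕜 ∞ μ := toLinf 1 hone
  have ho : ∀ᵐ x ∂μ, o x = 1 := coeFn_one_apply
  have hon : ‖o‖ ≤ 1 := norm_le_of_ae_norm_le zero_le_one hone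
  set a := P o with ha
  set b := o - P o with hb
  have hPa : P a = a := hPP o
  have hPb : P b = 0 := hQ o
  have huni : ∀ c : 𝕜, ‖c‖ = 1 → ∀ᵐ x ∂μ, ‖a x + c * b x‖ = 1 := by
    intro c hc
    filter_upwards [(hpair c hc).norm_map_eq_one hon (ho.mono fun x hx _ => by rw [hx, norm_one]),
      Lp.coeFn_add a (c • b), Lp.coeFn_smul c b] with x h1 h2 h3
    have h4 := h1 (Set.mem_univ x)
    rw [hUf] at h4
    rwa [h2, Pi.add_apply, h3, Pi.smul_apply, smul_eq_mul] at h4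
  have hI : ∀ᵐ x ∂μ, (RCLike.I : 𝕜) ≠ 0 → ‖a x + RCLike.I * b x‖ = 1 := by
    by_cases hI0 : (RCLike.I : 𝕜) = 0
    · exact Eventually.of_forall fun x h => absurd hI0 h
    · filter_upwards [huni RCLike.I (RCLike.norm_I_of_ne_zero hI0)] with x hx _ using hx
  have hoab := hP.2.2 rfl o
  have han : ‖a‖ ≤ 1 := ((le_max_left _ _).trans_eq hoab.symm).trans hon
  have hbn : ‖b‖ ≤ 1 := ((le_max_right _ _).trans_eq hoab.symm).trans hon
  have hbound : ∀ (q w : Lp 𝕜 ∞ μ) (c : 𝕜), ‖c‖ = 1 → ‖w‖ ≤ 1 →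
      (P q = q ∧ P w = 0) ∨ (P q = 0 ∧ P w = w) →
      ∀ᵐ x ∂μ, ‖q x + c * ‖q‖ * w x‖ ≤ ‖q‖ := by
    intro q w c hc hw hqw
    have h1 : ‖q + (c * (‖q‖ : 𝕜)) • w‖ ≤ ‖q‖ := by
      have h2 : ‖(c * (‖q‖ : 𝕜)) • w‖ ≤ ‖q‖ := by
        rw [norm_smul, norm_mul, hc, one_mul, RCLike.norm_ofReal, abs_norm]
        exact mul_le_of_le_one_right (norm_nonneg _) hw
      rcases hqw with ⟨h3, h4⟩ | ⟨h3, h4⟩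
      · rw [hmax _ _ h3 (by rw [map_smul, h4, smul_zero])]
        exact max_le le_rfl h2
      · rw [add_comm, hmax _ _ (by rw [map_smul, h4]) h3]
        exact max_le h2 le_rfl
    filter_upwards [ae_norm_le_norm (q + (c * (‖q‖ : 𝕜)) • w),
      Lp.coeFn_add q ((c * (‖q‖ : 𝕜)) • w), Lp.coeFn_smul (c * (‖q‖ : 𝕜)) w] with x h3 h4 h5
    rw [h4, Pi.add_apply, h5, Pi.smul_apply, smul_eq_mul] at h3
    exact h3.trans h1
  rw [mul_eq_zero_iff_ae]
  filter_upwards [huni 1 norm_one, huni (-1) (by simp), hI,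
    hbound (P f) b 1 norm_one hbn (Or.inl ⟨hPP f, hPb⟩),
    hbound (P f) b (-1) (by simp) hbn (Or.inl ⟨hPP f, hPb⟩),
    hbound (g - P g) a 1 norm_one han (Or.inr ⟨hQ g, hPa⟩),
    hbound (g - P g) a (-1) (by simp) han (Or.inr ⟨hQ g, hPa⟩)] with x h1 h2 h3 h4 h5 h6 h7
  rw [one_mul] at h1
  rcases eq_zero_or_eq_zero_of_norm_add_eq_one h1
    (by rw [sub_eq_add_neg, ← neg_one_mul]; exact h2) h3 with h0 | h0
  · left
    exact eq_zero_of_norm_add_unimodular_le h0 h1 (norm_nonneg _) h4 h5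
  · right
    rw [add_comm] at h1
    exact eq_zero_of_norm_add_unimodular_le h0 h1 (norm_nonneg _) h6 h7

theorem IsLpProjection.isMultiplicationOp [Fact (1 ≤ p)] (hμ : IsLocalizable μ) (hp2 : p ≠ 2)
    {P : Lp 𝕜 p μ →L[𝕜] Lp 𝕜 p μ} (hP : IsLpProjection p P) : IsMultiplicationOp P := by
  refine isMultiplicationOp_of_disjoint hμ fun f g => ?_
  by_cases hpt : p = ∞
  · subst hpt
    exact hP.mul_sub_eq_zero_top f g
  · have hPP : ∀ f, P (P f) = P f := fun f => DFunLike.congr_fun hP.1 f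
    rw [mul_eq_zero_iff_norm hp2 hpt]
    -- The sum and the difference of P f and g - P g have the same norm, with additive p-th powers,
    -- which is equality in Clarkson's inequality.
    have h1 := hP.2.1 hpt (P f + (g - P g))
    have h2 := hP.2.1 hpt (P f - (g - P g))
    rw [map_add, map_sub, hPP, hPP, sub_self, add_zero, add_sub_cancel_left] at h1
    rw [map_sub, map_sub, hPP, hPP, sub_self, sub_zero, sub_sub_cancel_left, norm_neg] at h2
    rw [h1, h2]
    ring

end Projections

end

section

variable {Ω : Type*} [MeasurableSpace Ω] {μ : Measure Ω} {p : ℝ≥0∞}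

/-! ### Hermitian idempotents are multiplication operators -/

section Hermitian

theorem exp_smul_of_idempotent {B : Type*} [NormedRing B] [NormedAlgebra ℂ B] [CompleteSpace B]
    {e : B} (he : e * e = e) (c : ℂ) :
    NormedSpace.exp (c • e) = 1 + (NormedSpace.exp c - 1) • e := by
  -- The correction 1 - e at n = 0 accounts for (c e)^0 being 1 and not e.
  have hpow : ∀ n : ℕ, (c • e) ^ n = c ^ n • e + if n = 0 then 1 - e else 0 := by
    intro n
    induction n with
    | zero => simp
    | succ n ih =>
      rw [pow_succ, ih]
      by_cases hn : n = 0
      · simp [hn]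
      · simp [hn, he, smul_smul, pow_succ, mul_comm]
  have h1 := (NormedSpace.exp_series_hasSum_exp' (𝕂 := ℂ) c).smul_const e
  have h2 := h1.add (hasSum_ite_eq 0 (1 - e))
  have h3 := NormedSpace.exp_series_hasSum_exp' (𝕂 := ℂ) (c • e)
  have h4 : HasSum (fun n : ℕ => ((n.factorial : ℂ)⁻¹) • (c • e) ^ n)
      (NormedSpace.exp c • e + (1 - e)) := by
    refine (congrArg (HasSum · _) (funext fun n => ?_)).mpr h2
    rw [hpow, smul_add, smul_smul, smul_eq_mul]
    congr 1
    by_cases hn : n = 0 <;> simp [hn]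
  rw [h3.unique h4, sub_smul, one_smul]
  abel

variable [Fact (1 ≤ p)]

theorem exp_smul_apply {e : Lp ℂ p μ →L[ℂ] Lp ℂ p μ} (he : e * e = e) (c : ℂ) (f : Lp ℂ p μ) :
    NormedSpace.exp (c • e) f = f + (NormedSpace.exp c - 1) • e f := by
  rw [exp_smul_of_idempotent he]
  rfl

/-- The exponential multiplies by a unimodular function and preserves |f|. Non-nullity of μ and
semi-finiteness make L^p non-trivial, so that the operator norm is 1 and not 0. -/
theorem isHermitianElem_chiOp (hμ : IsLocalizable μ) (hμ0 : μ ≠ 0) {D : Set Ω}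
    (hD : MeasurableSet D) : IsHermitianElem (chiOp p μ ℂ hD) := by
  have hnt : Nontrivial (Lp ℂ p μ) := by
    by_contra hn
    rw [not_nontrivial_iff_subsingleton] at hn
    refine hμ0 (Measure.measure_univ_eq_zero.1 ?_)
    refine measure_eq_zero_of_forall_chi_mul ℂ p hμ MeasurableSet.univ fun f => ?_
    rw [Subsingleton.elim f 0, coe_zero_Lp, mul_zero]
  intro t
  refine ContinuousLinearMap.homothety_norm _ fun f => ?_
  rw [exp_smul_apply (isLpProjection_chiOp hD).1, one_mul]
  have hn : ‖NormedSpace.exp (Complex.I * (t : ℂ))‖ = 1 := by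
    rw [← Complex.exp_eq_exp_ℂ, mul_comm]
    exact Complex.norm_exp_ofReal_mul_I t
  have hae : ∀ᵐ x ∂μ, ‖(f + (NormedSpace.exp (Complex.I * (t : ℂ)) - 1) • chiOp p μ ℂ hD f :
      Lp ℂ p μ) x‖ = ‖f x‖ := by
    filter_upwards [Lp.coeFn_add f ((NormedSpace.exp (Complex.I * (t : ℂ)) - 1) •
      chiOp p μ ℂ hD f), Lp.coeFn_smul (NormedSpace.exp (Complex.I * (t : ℂ)) - 1)
      (chiOp p μ ℂ hD f), coeFn_chi_mul hD (f : Ω →ₘ[μ] ℂ)] with x h1 h2 h3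
    rw [h1, Pi.add_apply, h2, Pi.smul_apply, coe_chiOp, h3, smul_eq_mul]
    by_cases hx : x ∈ D
    · rw [Set.indicator_of_mem hx, sub_mul, one_mul, add_sub_cancel, norm_mul, hn, one_mul]
    · rw [Set.indicator_of_notMem hx, mul_zero, add_zero]
  exact le_antisymm (Lp.norm_le_norm_of_ae_le (hae.mono fun x hx => hx.le))
    (Lp.norm_le_norm_of_ae_le (hae.mono fun x hx => hx.ge))

theorem IsHermitianElem.map_mul_map (hp2 : p ≠ 2) {e : Lp ℂ p μ →L[ℂ] Lp ℂ p μ}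
    (he : e * e = e) (hherm : IsHermitianElem e) (t : ℝ) {f g : Lp ℂ p μ}
    (hfg : (f : Ω →ₘ[μ] ℂ) * g = 0) :
    ((f + (Complex.exp (Complex.I * t) - 1) • e f : Lp ℂ p μ) : Ω →ₘ[μ] ℂ) *
      (g + (Complex.exp (Complex.I * t) - 1) • e g : Lp ℂ p μ) = 0 := by
  have hexp : ∀ t : ℝ, NormedSpace.exp ((Complex.I * (t : ℂ)) • e) *
      NormedSpace.exp ((Complex.I * ((-t : ℝ) : ℂ)) • e) = 1 := fun t => by
    ext1 f
    change NormedSpace.exp ((Complex.I * (t : ℂ)) • e)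
      (NormedSpace.exp ((Complex.I * ((-t : ℝ) : ℂ)) • e) f) = f
    have hef : e (e f) = e f := DFunLike.congr_fun he f
    rw [exp_smul_apply he, exp_smul_apply he, map_add, map_smul, hef, ← Complex.exp_eq_exp_ℂ]
    have h1 : Complex.exp (Complex.I * (t : ℂ)) * Complex.exp (Complex.I * ((-t : ℝ) : ℂ)) = 1 := by
      rw [← Complex.exp_add]; simp
    rw [add_assoc, smul_add, smul_smul, ← add_smul, ← add_smul]
    refine add_eq_left.2 ?_
    convert zero_smul ℂ (e f) using 2
    linear_combination h1
  have hpair := isChiPair_univ (hherm t).le (hherm (-t)).le (hexp t) (by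
    have := hexp (-t); rwa [neg_neg] at this)
  have h1 := hpair.map_mul_map hp2 hfg
  rwa [exp_smul_apply he, exp_smul_apply he, ← Complex.exp_eq_exp_ℂ] at h1

/-- Pointwise, write F, G, b, d for the values of f, g, e f, e g. Then (F + λb)(G + λd) = 0 for two
non-zero values of λ and FG = 0, so bd = 0 and Fd + bG = 0. Multiplying the latter by bG leaves
(bG)² = 0. -/
theorem IsHermitianElem.map_mul (hp2 : p ≠ 2) {e : Lp ℂ p μ →L[ℂ] Lp ℂ p μ}
    (he : e * e = e) (hherm : IsHermitianElem e) {f g : Lp ℂ p μ}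
    (hfg : (f : Ω →ₘ[μ] ℂ) * g = 0) : (e f : Ω →ₘ[μ] ℂ) * g = 0 := by
  have h1 := hherm.map_mul_map hp2 he Real.pi hfg
  have h2 := hherm.map_mul_map hp2 he (Real.pi / 2) hfg
  -- The angles π and π/2 give λ = e^{it} - 1 equal to -2 and i - 1.
  have e1 : Complex.exp (Complex.I * (Real.pi : ℂ)) = -1 := by
    rw [mul_comm, Complex.exp_pi_mul_I]
  have e2 : Complex.exp (Complex.I * ((Real.pi / 2 : ℝ) : ℂ)) = Complex.I := by
    rw [mul_comm]; push_cast; exact Complex.exp_pi_div_two_mul_I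
  rw [e1] at h1
  rw [e2] at h2
  rw [mul_eq_zero_iff_ae] at h1 h2 hfg ⊢
  filter_upwards [h1, h2, hfg, Lp.coeFn_add f ((-1 - 1 : ℂ) • e f),
    Lp.coeFn_smul (-1 - 1 : ℂ) (e f), Lp.coeFn_add g ((-1 - 1 : ℂ) • e g),
    Lp.coeFn_smul (-1 - 1 : ℂ) (e g), Lp.coeFn_add f ((Complex.I - 1 : ℂ) • e f),
    Lp.coeFn_smul (Complex.I - 1 : ℂ) (e f), Lp.coeFn_add g ((Complex.I - 1 : ℂ) • e g),
    Lp.coeFn_smul (Complex.I - 1 : ℂ) (e g)] with x h1 h2 h3 a1 a2 a3 a4 a5 a6 a7 a8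
  rw [a1, a3, Pi.add_apply, Pi.add_apply, a2, a4, Pi.smul_apply, Pi.smul_apply, smul_eq_mul,
    smul_eq_mul, ← mul_eq_zero] at h1
  rw [a5, a7, Pi.add_apply, Pi.add_apply, a6, a8, Pi.smul_apply, Pi.smul_apply, smul_eq_mul,
    smul_eq_mul, ← mul_eq_zero] at h2
  rw [← mul_eq_zero] at h3 ⊢
  generalize f x = F at *
  generalize g x = G at *
  generalize e f x = b at *
  generalize e g x = d at *
  have hI := Complex.I_mul_I
  have hbd : b * d = 0 := by
    -- The multipliers eliminate Fd + bG between the two equations.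
    have h4 : (4 : ℂ) * (b * d) = 0 := by
      linear_combination (1 - Complex.I) * h1 - 2 * h2 - (-1 - Complex.I) * h3 + 2 * b * d * hI
    exact (mul_eq_zero.1 h4).resolve_left (by norm_num)
  have hs : F * d + b * G = 0 := by
    have h4 : (2 : ℂ) * (F * d + b * G) = 0 := by
      linear_combination h3 - h1 + 4 * hbd
    exact (mul_eq_zero.1 h4).resolve_left two_ne_zero
  have hsq : (b * G) * (b * G) = 0 := by
    linear_combination b * G * hs - F * G * hbd
  exact mul_self_eq_zero.1 hsq

/-- By the preceding lemma, e applied to a function supported in A is disjoint from its own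
truncation to the complement of A, so e does not enlarge supports and commutes with indicators. -/
theorem IsHermitianElem.intertwines (hp2 : p ≠ 2) {e : Lp ℂ p μ →L[ℂ] Lp ℂ p μ}
    (he : e * e = e) (hherm : IsHermitianElem e) :
    Intertwines e (LinearMap.id : (Ω →ₘ[μ] ℂ) →ₗ[ℂ] (Ω →ₘ[μ] ℂ)) := by
  refine ⟨fun _ _ => rfl, fun _ _ _ hf => hf, fun C hC f => ?_⟩
  have key : ∀ (A : Set Ω) (hA : MeasurableSet A),
      chi μ ℂ Aᶜ * (e (chiOp p μ ℂ hA f) : Ω →ₘ[μ] ℂ) = 0 := by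
    intro A hA
    have hAA : chi μ ℂ A * chi μ ℂ A = chi μ ℂ A := chi_mul_self hA
    have h1 := hherm.map_mul hp2 he (f := chiOp p μ ℂ hA f)
      (g := chiOp p μ ℂ hA.compl (e (chiOp p μ ℂ hA f))) (by
        rw [coe_chiOp, coe_chiOp, chi_compl hA]
        linear_combination -((f : Ω →ₘ[μ] ℂ) * (e (chiOp p μ ℂ hA f) : Ω →ₘ[μ] ℂ)) * hAA)
    rw [coe_chiOp] at h1
    refine eq_zero_of_mul_self_eq_zero ?_
    linear_combination chi μ ℂ Aᶜ * h1
  have h1 := key C hC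
  have h2 := key Cᶜ hC.compl
  rw [compl_compl] at h2
  have h3 : f = chiOp p μ ℂ hC f + chiOp p μ ℂ hC.compl f := Subtype.ext (by
    rw [coe_add_Lp, coe_chiOp, coe_chiOp, chi_compl hC]; ring)
  have h4 : (e f : Ω →ₘ[μ] ℂ) = e (chiOp p μ ℂ hC f) + e (chiOp p μ ℂ hC.compl f) := by
    rw [← coe_add_Lp, ← map_add, ← h3]
  rw [chi_compl hC] at h1
  rw [LinearMap.id_apply, h4]
  linear_combination h1 - h2

theorem IsHermitianElem.isMultiplicationOp (hμ : IsLocalizable μ) (hp2 : p ≠ 2)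
    {e : Lp ℂ p μ →L[ℂ] Lp ℂ p μ} (he : e * e = e) (hherm : IsHermitianElem e) :
    IsMultiplicationOp e := by
  refine isMultiplicationOp_of_disjoint hμ fun f g => ?_
  have hee : ∀ f, e (e f) = e f := fun f => DFunLike.congr_fun he f
  -- Moving e from e f to g - e g turns the product into e f · e(g - e g) = 0.
  have h1 := (hherm.intertwines hp2 he).map_mul_comm (e f) (g - e g)
  rw [map_sub, hee, hee, sub_self, LinearMap.id_apply, coe_zero_Lp, mul_zero] at h1
  exact h1

end Hermitian

/-! ### The inverse semigroup of spatial partial isometries -/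

section Semigroup

theorem eq_mul_of_idempotent_of_commute {M : Type*} [Semigroup M] {e f : M} (he : e * e = e)
    (hef : IsGenInverse e f) (hc : e * f * (f * e) = f * e * (e * f)) : e = f * e := by
  have h1 : e * f * (f * e) = e * f := by
    calc e * f * (f * e) = e * e * f * (f * e) := by rw [he]
      _ = e * (e * f * (f * e)) := by simp only [mul_assoc]
      _ = e * f * e * e * f := by rw [hc]; simp only [mul_assoc]
      _ = e * f := by rw [← hef.1, he]
  have h2 : f * e * e = e := by
    calc f * e * e = f * e * (e * f * e) := by rw [← hef.1]
      _ = f * e * (e * f) * e := by simp only [mul_assoc]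
      _ = e * f * e := by rw [← hc, h1]
      _ = e := hef.1.symm
  rw [mul_assoc, he] at h2
  exact h2.symm

variable {𝕜 : Type*} [RCLike 𝕜] [Fact (1 ≤ p)]

/-- T T' S' S is T, applied after restriction to D', composed with S; moving the restriction past T
leaves an indicator times TS. The generalized inverse identities follow since T'S' and ST commute.
-/
theorem IsChiPair.mul (hμ : IsLocalizable μ) (hp2 : p ≠ 2)
    {T S T' S' : Lp 𝕜 p μ →L[𝕜] Lp 𝕜 p μ} {D E D' E' : Set Ω} (h : IsChiPair T S D E)
    (h' : IsChiPair T' S' D' E') : ∃ F G, IsChiPair (T * T') (S' * S) F G := by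
  have key : ∀ {T S T' S' : Lp 𝕜 p μ →L[𝕜] Lp 𝕜 p μ} {D E D' E' : Set Ω},
      IsChiPair T S D E → IsChiPair T' S' D' E' → ∃ F, MeasurableSet F ∧
        ∀ f, (T (T' (S' (S f))) : Ω →ₘ[μ] 𝕜) = chi μ 𝕜 F * f := by
    intro T S T' S' D E D' E' h h'
    set Φ := h.toPartialSetAut hμ hp2 with hΦ
    have hm : MeasurableSet (D' ∩ Φ.dom) := h'.measurableSet_left.inter Φ.measurableSet_dom
    have hF := Φ.measurableSet_toFun hm Set.inter_subset_right
    refine ⟨Φ.toFun (D' ∩ Φ.dom) ∩ D, hF.inter h.measurableSet_left, fun f => ?_⟩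
    have h1 : T' (S' (S f)) = chiOp p μ 𝕜 h'.measurableSet_left (S f) :=
      Subtype.ext (h'.left_right (S f))
    rw [h1, h.map_chiOp hμ hp2, h.left_right, ← mul_assoc, ← hΦ,
      compOp_chi Φ h'.measurableSet_left, chi_mul_chi hF h.measurableSet_left]
  obtain ⟨F, hF, hF'⟩ := key h h'
  obtain ⟨G, hG, hG'⟩ := key h'.symm h.symm
  have hcomm : T' * S' * (S * T) = S * T * (T' * S') := by
    rw [h'.mul_eq_chiOp, h.symm.mul_eq_chiOp]
    exact (isMultiplicationOp_chiOp _).commute (isMultiplicationOp_chiOp _)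
  refine ⟨F, G, hF, hG, ?_, ?_, hF', hG', ?_, ?_⟩
  · exact (norm_mul_le _ _).trans (mul_le_one₀ h.norm_left (norm_nonneg _) h'.norm_left)
  · exact (norm_mul_le _ _).trans (mul_le_one₀ h'.norm_right (norm_nonneg _) h.norm_right)
  · calc T * T' = (T * S * T) * (T' * S' * T') := by
          rw [← h.isGenInverse.1, ← h'.isGenInverse.1]
      _ = T * (S * T * (T' * S')) * T' := by simp only [mul_assoc]
      _ = T * T' * (S' * S) * (T * T') := by rw [← hcomm]; simp only [mul_assoc]
  · calc S' * S = (S' * T' * S') * (S * T * S) := by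
          rw [← h.isGenInverse.2, ← h'.isGenInverse.2]
      _ = S' * (T' * S' * (S * T)) * S := by simp only [mul_assoc]
      _ = S' * S * (T * T') * (S' * S) := by rw [hcomm]; simp only [mul_assoc]

theorem IsChiPair.isMultiplicationOp_of_idempotent {T S : Lp 𝕜 p μ →L[𝕜] Lp 𝕜 p μ}
    {D D' : Set Ω} (h : IsChiPair T S D D') (hT : T * T = T) : IsMultiplicationOp T := by
  rw [eq_mul_of_idempotent_of_commute hT h.isGenInverse (by
    rw [h.mul_eq_chiOp, h.symm.mul_eq_chiOp]
    exact (isMultiplicationOp_chiOp _).commute (isMultiplicationOp_chiOp _)),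
    h.symm.mul_eq_chiOp]
  exact isMultiplicationOp_chiOp _

/-- Closure under products makes TR and RT members for any generalized inverse R in the set, so
these idempotents are multiplications. They commute with TS and ST, which yields R = STR = S. -/
theorem isInverseSubsemigroup_isChiPair (hμ : IsLocalizable μ) (hp2 : p ≠ 2) :
    IsInverseSubsemigroup {T : Lp 𝕜 p μ →L[𝕜] Lp 𝕜 p μ | ∃ S D D', IsChiPair T S D D'} := by
  have hmul : ∀ s ∈ {T : Lp 𝕜 p μ →L[𝕜] Lp 𝕜 p μ | ∃ S D D', IsChiPair T S D D'},
      ∀ t ∈ {T : Lp 𝕜 p μ →L[𝕜] Lp 𝕜 p μ | ∃ S D D', IsChiPair T S D D'},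
      s * t ∈ {T : Lp 𝕜 p μ →L[𝕜] Lp 𝕜 p μ | ∃ S D D', IsChiPair T S D D'} := by
    rintro T ⟨S, D, E, h⟩ T' ⟨S', D', E', h'⟩
    exact ⟨_, h.mul hμ hp2 h'⟩
  refine ⟨hmul, fun T hT => ?_⟩
  obtain ⟨S, D, E, h⟩ := id hT
  refine ⟨S, ⟨⟨T, E, D, h.symm⟩, h.isGenInverse⟩, ?_⟩
  rintro R ⟨hR, hTR⟩
  have hidem : ∀ {A B : Lp 𝕜 p μ →L[𝕜] Lp 𝕜 p μ}, A = A * B * A → A * B * (A * B) = A * B :=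
    fun hAB => by rw [← mul_assoc, ← hAB]
  have m1 : IsMultiplicationOp (T * R) := by
    obtain ⟨_, _, _, hp⟩ := hmul T hT R hR
    exact hp.isMultiplicationOp_of_idempotent (hidem hTR.1)
  have m2 : IsMultiplicationOp (R * T) := by
    obtain ⟨_, _, _, hp⟩ := hmul R hR T hT
    exact hp.isMultiplicationOp_of_idempotent (hidem hTR.2)
  have m3 : IsMultiplicationOp (T * S) := by
    rw [h.mul_eq_chiOp]; exact isMultiplicationOp_chiOp _
  have m4 : IsMultiplicationOp (S * T) := by
    rw [h.symm.mul_eq_chiOp]; exact isMultiplicationOp_chiOp _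
  have e1 : S = S * T * R := by
    calc S = S * T * S := h.isGenInverse.2
      _ = S * (T * R * T) * S := by rw [← hTR.1]
      _ = S * ((T * R) * (T * S)) := by simp only [mul_assoc]
      _ = S * T * S * (T * R) := by rw [m1.commute m3]; simp only [mul_assoc]
      _ = S * T * R := by rw [← h.isGenInverse.2, mul_assoc]
  have e2 : R = S * T * R := by
    calc R = R * T * R := hTR.2
      _ = R * (T * S * T) * R := by rw [← h.isGenInverse.1]
      _ = ((R * T) * (S * T)) * R := by simp only [mul_assoc]
      _ = S * T * (R * T * R) := by rw [m2.commute m4]; simp only [mul_assoc]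
      _ = S * T * R := by rw [← hTR.2]
  exact e2.trans e1.symm

theorem LpPIso_eq (hμ : IsLocalizable μ) (hp2 : p ≠ 2) :
    LpPIso 𝕜 (Lp 𝕜 p μ) p = {T | ∃ S D D', IsChiPair T S D D'} := by
  ext T
  constructor
  · rintro ⟨hT, S, hS, hTS, h1, h2⟩
    exact ⟨S, isChiPair_of_isMultiplicationOp hT hS hTS (h1.isMultiplicationOp hμ hp2)
      (h2.isMultiplicationOp hμ hp2)⟩
  · rintro ⟨S, D, D', h⟩
    refine ⟨h.norm_left, S, h.norm_right, h.isGenInverse, ?_, ?_⟩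
    · rw [h.mul_eq_chiOp]; exact isLpProjection_chiOp _
    · rw [h.symm.mul_eq_chiOp]; exact isLpProjection_chiOp _

theorem MPPIso_eq (hμ : IsLocalizable μ) (hμ0 : μ ≠ 0) (hp2 : p ≠ 2) :
    MPPIso (Lp ℂ p μ →L[ℂ] Lp ℂ p μ) = {T | ∃ S D D', IsChiPair T S D D'} := by
  ext T
  constructor
  · rintro ⟨hT, S, hS, hTS, h1, h2⟩
    refine ⟨S, isChiPair_of_isMultiplicationOp hT hS hTS
      (h1.isMultiplicationOp hμ hp2 ?_) (h2.isMultiplicationOp hμ hp2 ?_)⟩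
    · rw [← mul_assoc, ← hTS.1]
    · rw [← mul_assoc, ← hTS.2]
  · rintro ⟨S, D, D', h⟩
    refine ⟨h.norm_left, S, h.norm_right, h.isGenInverse, ?_, ?_⟩
    · rw [h.mul_eq_chiOp]; exact isHermitianElem_chiOp hμ hμ0 _
    · rw [h.symm.mul_eq_chiOp]; exact isHermitianElem_chiOp hμ hμ0 _

theorem SPIso_eq (hμ : IsLocalizable μ) (hp2 : p ≠ 2) :
    SPIso 𝕜 p μ = {T | ∃ S D D', IsChiPair T S D D'} :=
  Set.ext fun _ => exists_isChiPair_iff_mem_SPIso hμ hp2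

end Semigroup

end

end SpatialPI

end

theorem mainTheorem5 {𝕜 : Type*} [RCLike 𝕜] {Ω : Type*} [MeasurableSpace Ω] (μ : Measure Ω)
    (hμ : SpatialPI.IsLocalizable μ) (p : ℝ≥0∞) [Fact (1 ≤ p)] (hp : p ≠ 2) :
    (∀ T : Lp 𝕜 p μ →L[𝕜] Lp 𝕜 p μ,
      T ∈ SpatialPI.SPIso 𝕜 p μ ↔
        ‖T‖ ≤ 1 ∧ ∃ S : Lp 𝕜 p μ →L[𝕜] Lp 𝕜 p μ, ‖S‖ ≤ 1 ∧ SpatialPI.IsGenInverse T S ∧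
          SpatialPI.IsMultiplicationOp (T * S) ∧ SpatialPI.IsMultiplicationOp (S * T)) ∧
    SpatialPI.SPIso 𝕜 p μ = SpatialPI.LpPIso 𝕜 (Lp 𝕜 p μ) p ∧
    SpatialPI.IsInverseSubsemigroup (SpatialPI.LpPIso 𝕜 (Lp 𝕜 p μ) p) ∧
    (μ ≠ 0 → SpatialPI.SPIso ℂ p μ = SpatialPI.MPPIso (Lp ℂ p μ →L[ℂ] Lp ℂ p μ)) := by
  refine ⟨fun T => ?_, ?_, ?_, fun hμ0 => ?_⟩
  · rw [SpatialPI.exists_isChiPair_iff_mem_SPIso hμ hp,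
      SpatialPI.exists_isChiPair_iff_isMultiplicationOp]
  · rw [SpatialPI.SPIso_eq hμ hp, SpatialPI.LpPIso_eq hμ hp]
  · rw [SpatialPI.LpPIso_eq hμ hp]
    exact SpatialPI.isInverseSubsemigroup_isChiPair hμ hp
  · rw [SpatialPI.SPIso_eq hμ hp, SpatialPI.MPPIso_eq hμ hμ0 hp]
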